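/- Let $k>0$ and $\nu,a_0,\dots,a_4\in\mathbb R$, and set $X=\sum_{j=0}^4 a_jx^j$, $Y=\sum_{j=0}^4 a_jy^j$, $$H=(\nu x+y)\bigl((\nu x-y)(a_1-a_3xy)-2(1-\nu)(a_0-a_4x^2y^2)\bigr),\qquad F=Xy^2-x^2Y,$$ $$G=X(a_0\nu^2+2a_3\nu y^3-a_4y^4+2a_4\nu y^4)+(a_0-2a_0\nu-2a_1\nu x-a_4\nu^2x^4)Y .$$ Let $g$ be the Chen–Teo metric $$g=\frac{kH}{(x-y)^3}\Bigl(\frac{dx^2}{X}-\frac{dy^2}{Y}-\frac{XY}{kF}\,d\phi^2\Bigr)+\frac{(F\,d\tau+G\,d\phi)^2}{FH(x-y)}$$ on the open set $D\subset\mathbb R^4$ of points $(x,y,\tau,\phi)$ with $y<x$, $X>0$, $Y<0$, $H>0$ (on which $g$ is Riemannian), oriented by $dx\wedge dy\wedge d\tau\wedge d\phi$. Let $W^+$ be the self dual Weyl tensor, $|W^+|=(W^+_{abcd}W^{+abcd})^{1/2}$, and $$u=-\frac{x-y}{\nu x+y}.$$ Let $L,N,M,P$ be the complex null tetrad $$L=\tfrac1{\sqrt2}\Bigl(\sqrt{\tfrac{H(x-y)}{F}}\,\partial_\tau+i\sqrt{\tfrac{F(x-y)^3}{HX(-Y)}}\bigl(\partial_\phi-\tfrac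 GF\partial_\tau\bigr)\Bigr),\quad N=\bar L,\quad M=\frac{i\sqrt{(x-y)^3}}{\sqrt{2kH}}\bigl(\sqrt X\partial_x+i\sqrt{-Y}\partial_y\bigr),\quad P=-\bar M,$$ with indices lowered by $g$; let $f=x\sqrt{-Y}+iy\sqrt X$ and $e^{i\psi}=i f/|f|$, let $$\hat L=\tfrac1{\sqrt2}(L+e^{i\psi}P),\quad \hat N=\tfrac1{\sqrt2}(N-e^{-i\psi}M),\quad \hat M=\tfrac1{\sqrt2}(M+e^{i\psi}N),\quad \hat P=\tfrac1{\sqrt2}(P-e^{-i\psi}L)$$ be the adapted tetrad, and $\hat Z^1_{ab}=\hat L_{[a}\hat N_{b]}-\hat M_{[a}\hat P_{b]}$. Then, on $D$, $\hat Z^1_{ab}=\alpha_{[a}d\tau_{b]}+\beta_{[a}d\phi_{b]}$ with $$\alpha=\frac{i\sqrt k\,(x\,dy-y\,dx)}{(x-y)^2},\qquad \beta=\frac{i\sqrt k\,\bigl((Gx(x-y)+HXy)\,dy-(Gy(x-y)+HYx)\,dx\bigr)}{F(x-y)^3},$$ and the following statements hold on $D$. 1. Let $\nu\neq-1$ and $c=\bigl(\tfrac{k}{\sqrt6(1+\nu)}\bigr)^{1/3}$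 (real cube root). Then $|u|=|c|\,|W^+|^{1/3}$, and $u=c\,|W^+|^{1/3}$ at every point where $1+\nu$ and $\nu x+y$ have opposite signs (so that $u$ and $c$ have the same sign). If $\nu=-1$, then $W^+=0$ and $u=1$. 2. $J_a{}^b=2i\,g^{bc}\hat Z^1_{ac}$ is real and is an integrable complex structure ($J^2=-1$ and the Nijenhuis tensor of $J$ vanishes). 3. The metric $\bar g=u^2g$ is Kähler with respect to $J$, with Kähler form $\bar\omega_{ab}=J_a{}^c\bar g_{cb}$. 4. $Y_{ab}=-\tfrac{2i}{3}u^{-1}\hat Z^1_{ab}$ is a real conformal Killing–Yano 2-form of $g$, and $$\xi^a:=g^{ac}\nabla^bY_{cb}=\bar g^{ac}J_c{}^b\nabla_bu=\frac{1+\nu}{\sqrt k}(\partial_\tau)^a .$$ The field $\xi$ is Killing for $g$ and for $\bar g$ and is Hamiltonian, $\bar\omega(\xi,\cdot)=du$; and $\bar g$ is extremal Kähler (the $\bar g$-gradient of $\mathrm{scal}_{\bar g}$ is a real holomorphic vector field). 5. $\mathrm{scal}_{\bar g}=\dfrac{6(1+\nu)}{k}\,u$. In particular, if $\nu=-1$,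 then $\bar g=g$ and $\mathrm{scal}_{\bar g}=0$. -/

import Mathlib

open scoped ContDiff

noncomputable section

/-! ### Tensor calculus in a coordinate chart of a four-manifold

Points are coordinate vectors `p : Fin 4 → ℝ`; a tensor field is the array of its components.
A metric `g` is a matrix-valued function, and `(g p)⁻¹ a b` are the components `g^{ab}`. -/

namespace Chart

/-- Coordinate space. -/
abbrev Pt : Type := Fin 4 → ℝ

/-- Fields of (real) 4×4 matrices. -/
abbrev MatField : Type := Pt → Matrix (Fin 4) (Fin 4) ℝ

/-- The partial derivative `∂_i f` at `p`. -/
def pd (i : Fin 4) (f : Pt → ℝ) (p : Pt) : ℝ := fderiv ℝ f p (Pi.single i 1)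

/-- The matrix field has smooth components on `U`. -/
def SmoothOn (U : Set Pt) (T : MatField) : Prop :=
  ∀ a b, ContDiffOn ℝ ∞ (fun p => T p a b) U

/-- Christoffel symbols `Γ^a_{bc}` of the Levi-Civita connection. -/
def christoffel (g : MatField) (p : Pt) (a b c : Fin 4) : ℝ :=
  (1 / 2) * ∑ e, (g p)⁻¹ a e *
    (pd b (fun q => g q e c) p + pd c (fun q => g q e b) p - pd e (fun q => g q b c) p)

/-- The curvature `R^a_{bcd} = ∂_c Γ^a_{db} - ∂_d Γ^a_{cb} + Γ^a_{ce} Γ^e_{db} - Γ^a_{de} Γ^e_{cb}`. -/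
def riemannUp (g : MatField) (p : Pt) (a b c d : Fin 4) : ℝ :=
  pd c (fun q => christoffel g q a d b) p - pd d (fun q => christoffel g q a c b) p +
    ∑ e, (christoffel g p a c e * christoffel g p e d b -
      christoffel g p a d e * christoffel g p e c b)

/-- `R_{abcd} = g_{ae} R^e_{bcd}`. -/
def riemann (g : MatField) (p : Pt) (a b c d : Fin 4) : ℝ :=
  ∑ e, g p a e * riemannUp g p e b c d

/-- `R_{bd} = R^a_{bad}`. -/
def ricci (g : MatField) (p : Pt) (b d : Fin 4) : ℝ :=
  ∑ a, riemannUp g p a b a d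

/-- The scalar curvature `g^{bd} R_{bd}`. -/
def scal (g : MatField) (p : Pt) : ℝ :=
  ∑ b, ∑ d, (g p)⁻¹ b d * ricci g p b d

/-- The Weyl tensor `W_{abcd}` in dimension four. -/
def weyl (g : MatField) (p : Pt) (a b c d : Fin 4) : ℝ :=
  riemann g p a b c d
    - (1 / 2) * (g p a c * ricci g p b d - g p a d * ricci g p b c
        + g p b d * ricci g p a c - g p b c * ricci g p a d)
    + (scal g p / 6) * (g p a c * g p b d - g p a d * g p b c)

/-- The totally antisymmetric symbol with value `1` at `(0, 1, 2, 3)`. -/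
def leviCivita (a b c d : Fin 4) : ℝ :=
  Matrix.det (Matrix.of fun i j : Fin 4 => if ![a, b, c, d] i = j then (1 : ℝ) else 0)

/-- The volume form of `g` in the orientation in which the coordinates `0, 1, 2, 3`, in this order,
are positively oriented. -/
def volForm (g : MatField) (p : Pt) (a b c d : Fin 4) : ℝ :=
  Real.sqrt (g p).det * leviCivita a b c d

/-- The self dual Weyl tensor `W⁺ = (W + *W) / 2`, where
`(*W)_{abcd} = (1/2) ε_{ab}^{ef} W_{efcd}`. -/
def weylPlus (g : MatField) (p : Pt) (a b c d : Fin 4) : ℝ :=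
  (1 / 2) * (weyl g p a b c d + (1 / 2) * ∑ e, ∑ f, ∑ m, ∑ n,
    volForm g p a b m n * (g p)⁻¹ m e * (g p)⁻¹ n f * weyl g p e f c d)

/-- `|W⁺| = (W⁺_{abcd} W⁺^{abcd})^{1/2}`. -/
def weylPlusNorm (g : MatField) (p : Pt) : ℝ :=
  Real.sqrt (∑ a, ∑ b, ∑ c, ∑ d, ∑ a', ∑ b', ∑ c', ∑ d',
    (g p)⁻¹ a a' * (g p)⁻¹ b b' * (g p)⁻¹ c c' * (g p)⁻¹ d d' *
      weylPlus g p a b c d * weylPlus g p a' b' c' d')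

/-- The covariant derivative `∇_a T_{bc}`. -/
def covDeriv (g T : MatField) (p : Pt) (a b c : Fin 4) : ℝ :=
  pd a (fun q => T q b c) p -
    ∑ e, (christoffel g p e a b * T p e c + christoffel g p e a c * T p b e)

/-- `T` is a smooth 2-form on `U` that satisfies the conformal Killing-Yano equation
`∇_a T_{bc} = ∇_{[a} T_{bc]} + (1/3) (g_{ab} K_c - g_{ac} K_b)`, with `K_c = ∇^d T_{dc}`. -/
structure IsConformalKillingYanoOn (U : Set Pt) (g T : MatField) : Prop where
  smooth : SmoothOn U T
  antisymm : ∀ p ∈ U, ∀ a b, T p a b = - T p b a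
  eqn : ∀ p ∈ U, ∀ a b c,
    covDeriv g T p a b c =
      (1 / 3) * (covDeriv g T p a b c + covDeriv g T p b c a + covDeriv g T p c a b) +
      (1 / 3) * (g p a b * (∑ d, ∑ e, (g p)⁻¹ d e * covDeriv g T p e d c)
        - g p a c * (∑ d, ∑ e, (g p)⁻¹ d e * covDeriv g T p e d b))

/-- The Nijenhuis tensor `N_{ab}^c` of `J`, that is, the components of
`[JV, JW] - J[JV, W] - J[V, JW] - [V, W]` (if `J² = -1`). The entry `J p a b` is `J_a^b`,
so that `J ∂_a = J_a^b ∂_b`. -/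
def nijenhuis (J : MatField) (p : Pt) (a b c : Fin 4) : ℝ :=
  ∑ d, (J p a d * pd d (fun q => J q b c) p - J p b d * pd d (fun q => J q a c) p
    - J p d c * (pd a (fun q => J q b d) p - pd b (fun q => J q a d) p))

/-- `J` is an integrable complex structure on `U`. -/
structure IsComplexStructureOn (U : Set Pt) (J : MatField) : Prop where
  smooth : SmoothOn U J
  sq : ∀ p ∈ U, J p * J p = -1
  integrable : ∀ p ∈ U, ∀ a b c, nijenhuis J p a b c = 0

/-- The 2-form `ω_{ab} = J_a^c g_{cb}`. -/
def kahlerForm (J g : MatField) : MatField := fun p => J p * g p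

/-- `(U, J, g)` is Kähler, with Kähler form `J_a^c g_{cb}`. -/
structure IsKahlerOn (U : Set Pt) (J g : MatField) : Prop where
  smooth : SmoothOn U g
  posDef : ∀ p ∈ U, (g p).PosDef
  complexStructure : IsComplexStructureOn U J
  hermitian : ∀ p ∈ U, ∀ a b, ∑ c, ∑ d, J p a c * J p b d * g p c d = g p a b
  closed : ∀ p ∈ U, ∀ a b c,
    pd a (fun q => kahlerForm J g q b c) p + pd b (fun q => kahlerForm J g q c a) p
      + pd c (fun q => kahlerForm J g q a b) p = 0

/-- The gradient `g^{ab} ∂_b h`. -/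
def grad (g : MatField) (h : Pt → ℝ) (p : Pt) (a : Fin 4) : ℝ :=
  ∑ b, (g p)⁻¹ a b * pd b h p

/-- The Lie derivative `(L_V J)_a^b`. -/
def lieDerivEndo (V : Pt → Fin 4 → ℝ) (J : MatField) (p : Pt) (a b : Fin 4) : ℝ :=
  ∑ c, (V p c * pd c (fun q => J q a b) p - J p a c * pd c (fun q => V q b) p
    + J p c b * pd a (fun q => V q c) p)

/-- Extremal Kähler (Calabi): the gradient of the scalar curvature is a real holomorphic vector
field. -/
structure IsExtremalKahlerOn (U : Set Pt) (J g : MatField) : Prop where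
  kahler : IsKahlerOn U J g
  holomorphic : ∀ p ∈ U, ∀ a b, lieDerivEndo (grad g (scal g)) J p a b = 0

/-- `V` is a smooth Killing field of `g` on `U`: `L_V g = 0`. -/
structure IsKillingOn (U : Set Pt) (g : MatField) (V : Pt → Fin 4 → ℝ) : Prop where
  smooth : ∀ a, ContDiffOn ℝ ∞ (fun p => V p a) U
  lie : ∀ p ∈ U, ∀ a b,
    ∑ c, (V p c * pd c (fun q => g q a b) p + g p c b * pd a (fun q => V q c) p
      + g p a c * pd b (fun q => V q c) p) = 0

/-- `V` is the Hamiltonian vector field on `U` of the function `h`, with respect to the 2-form `w`: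
`w(V, ·) = dh`. -/
structure IsHamiltonianOn (U : Set Pt) (w : MatField) (V : Pt → Fin 4 → ℝ) (h : Pt → ℝ) :
    Prop where
  smooth : ContDiffOn ℝ ∞ h U
  eqn : ∀ p ∈ U, ∀ a, ∑ b, V p b * w p b a = pd a h p

/-- `α_{[a} β_{b]} = (α_a β_b - α_b β_a) / 2`. -/
def wedge (α β : Fin 4 → ℂ) (a b : Fin 4) : ℂ := (α a * β b - α b * β a) / 2

/-- Real cube root. -/
def cubeRoot (r : ℝ) : ℝ := (SignType.sign r : ℝ) * |r| ^ (1 / 3 : ℝ)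

end Chart

/-! ### The Chen-Teo metrics

The coordinates are `(p 0, p 1, p 2, p 3) = (x, y, τ, φ)`. -/

/-- The parameters of the Chen-Teo family. -/
structure ChenTeo where
  (k ν a₀ a₁ a₂ a₃ a₄ : ℝ)

namespace ChenTeo

open Chart Complex

variable (P : ChenTeo)

/-- The quartic polynomial `a₀ + a₁ t + a₂ t² + a₃ t³ + a₄ t⁴`. -/
def quartic (t : ℝ) : ℝ := P.a₀ + P.a₁ * t + P.a₂ * t ^ 2 + P.a₃ * t ^ 3 + P.a₄ * t ^ 4

def X (p : Pt) : ℝ := P.quartic (p 0)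

def Y (p : Pt) : ℝ := P.quartic (p 1)

def H (p : Pt) : ℝ :=
  (P.ν * p 0 + p 1) * ((P.ν * p 0 - p 1) * (P.a₁ - P.a₃ * p 0 * p 1)
    - 2 * (1 - P.ν) * (P.a₀ - P.a₄ * p 0 ^ 2 * p 1 ^ 2))

def F (p : Pt) : ℝ := P.X p * p 1 ^ 2 - p 0 ^ 2 * P.Y p

def G (p : Pt) : ℝ :=
  P.X p * (P.a₀ * P.ν ^ 2 + 2 * P.a₃ * P.ν * p 1 ^ 3 - P.a₄ * p 1 ^ 4
      + 2 * P.a₄ * P.ν * p 1 ^ 4)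
    + (P.a₀ - 2 * P.a₀ * P.ν - 2 * P.a₁ * P.ν * p 0 - P.a₄ * P.ν ^ 2 * p 0 ^ 4) * P.Y p

/-- The coordinate domain; for `k > 0` the metric is Riemannian there. -/
def domain : Set Pt := {p | p 1 < p 0 ∧ 0 < P.X p ∧ P.Y p < 0 ∧ 0 < P.H p}

/-- The Chen-Teo metric
`k H / (x - y)³ (dx²/X - dy²/Y - X Y/(k F) dφ²) + (F dτ + G dφ)² / (F H (x - y))`. -/
def metric : MatField := fun p =>
  let A : ℝ := P.k * P.H p / (p 0 - p 1) ^ 3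
  let B : ℝ := P.F p * P.H p * (p 0 - p 1)
  !![A / P.X p, 0, 0, 0;
     0, -(A / P.Y p), 0, 0;
     0, 0, P.F p ^ 2 / B, P.F p * P.G p / B;
     0, 0, P.F p * P.G p / B, P.G p ^ 2 / B - A * (P.X p * P.Y p / (P.k * P.F p))]

/-- The function `u = -(x - y) / (ν x + y)`. -/
def u (p : Pt) : ℝ := -(p 0 - p 1) / (P.ν * p 0 + p 1)

/-- The metric `u² g`. -/
def metricBar : MatField := fun p => P.u p ^ 2 • P.metric p

/-! The null tetrad `L, N, M, P` (as vectors), with `N = conj L` and `P = -conj M`. -/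

def vecL (p : Pt) : Fin 4 → ℂ :=
  let A : ℝ := Real.sqrt (P.H p * (p 0 - p 1) / P.F p)
  let B : ℝ := Real.sqrt (P.F p * (p 0 - p 1) ^ 3 / (P.H p * P.X p * (-P.Y p)))
  fun a => (1 / (Real.sqrt 2 : ℂ)) *
    (![0, 0, (A : ℂ) - I * B * (P.G p / P.F p), I * B] : Fin 4 → ℂ) a

def vecN (p : Pt) : Fin 4 → ℂ :=
  let A : ℝ := Real.sqrt (P.H p * (p 0 - p 1) / P.F p)
  let B : ℝ := Real.sqrt (P.F p * (p 0 - p 1) ^ 3 / (P.H p * P.X p * (-P.Y p)))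
  fun a => (1 / (Real.sqrt 2 : ℂ)) *
    (![0, 0, (A : ℂ) + I * B * (P.G p / P.F p), -(I * B)] : Fin 4 → ℂ) a

def vecM (p : Pt) : Fin 4 → ℂ := fun a =>
  I * (Real.sqrt ((p 0 - p 1) ^ 3) : ℂ) / (Real.sqrt (2 * P.k * P.H p) : ℂ) *
    (![(Real.sqrt (P.X p) : ℂ), I * (Real.sqrt (-P.Y p) : ℂ), 0, 0] : Fin 4 → ℂ) a

def vecP (p : Pt) : Fin 4 → ℂ := fun a =>
  I * (Real.sqrt ((p 0 - p 1) ^ 3) : ℂ) / (Real.sqrt (2 * P.k * P.H p) : ℂ) *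
    (![(Real.sqrt (P.X p) : ℂ), -(I * (Real.sqrt (-P.Y p) : ℂ)), 0, 0] : Fin 4 → ℂ) a

/-- Lowering an index with the metric. -/
def lower (p : Pt) (V : Fin 4 → ℂ) : Fin 4 → ℂ := fun a => ∑ b, (P.metric p a b : ℂ) * V b

/-- `f = x √(-Y) + i y √X`, so that `F = |f|²`. -/
def f (p : Pt) : ℂ := p 0 * (Real.sqrt (-P.Y p) : ℂ) + I * p 1 * (Real.sqrt (P.X p) : ℂ)

/-- The phase `e^{iψ} = i (f / conj f)^{1/2}`, where the square root of the unit complex number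
`f / conj f` is the smooth branch `f / |f|`. -/
def phase (p : Pt) : ℂ := I * (P.f p / (‖P.f p‖ : ℂ))

/-! The adapted tetrad, as covectors: the tetrad above rotated by the angle `χ = π/4` and the phase
`e^{iψ}`. -/

def hatL (p : Pt) : Fin 4 → ℂ := fun a =>
  (1 / (Real.sqrt 2 : ℂ)) * (P.lower p (P.vecL p) a + P.phase p * P.lower p (P.vecP p) a)

def hatN (p : Pt) : Fin 4 → ℂ := fun a =>
  (1 / (Real.sqrt 2 : ℂ)) * (P.lower p (P.vecN p) a - (P.phase p)⁻¹ * P.lower p (P.vecM p) a)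

def hatM (p : Pt) : Fin 4 → ℂ := fun a =>
  (1 / (Real.sqrt 2 : ℂ)) * (P.lower p (P.vecM p) a + P.phase p * P.lower p (P.vecN p) a)

def hatP (p : Pt) : Fin 4 → ℂ := fun a =>
  (1 / (Real.sqrt 2 : ℂ)) * (P.lower p (P.vecP p) a - (P.phase p)⁻¹ * P.lower p (P.vecL p) a)

/-- The middle self dual 2-form `Ẑ¹_{ab} = L̂_{[a} N̂_{b]} - M̂_{[a} P̂_{b]}` of the adapted tetrad. -/
def hatZ (p : Pt) (a b : Fin 4) : ℂ :=
  wedge (P.hatL p) (P.hatN p) a b - wedge (P.hatM p) (P.hatP p) a b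

/-- The 1-form `α = i √k (x dy - y dx) / (x - y)²`. -/
def formα (p : Pt) : Fin 4 → ℂ := fun a =>
  I * (Real.sqrt P.k : ℂ) / ((p 0 : ℂ) - p 1) ^ 2 * (![-(p 1 : ℂ), (p 0 : ℂ), 0, 0] : Fin 4 → ℂ) a

/-- The 1-form
`β = i √k ((G x (x - y) + H X y) dy - (G y (x - y) + H Y x) dx) / (F (x - y)³)`. -/
def formβ (p : Pt) : Fin 4 → ℂ := fun a =>
  I * (Real.sqrt P.k : ℂ) / (P.F p * ((p 0 : ℂ) - p 1) ^ 3) *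
    (![-((P.G p * p 1 * (p 0 - p 1) + P.H p * P.Y p * p 0 : ℝ) : ℂ),
      ((P.G p * p 0 * (p 0 - p 1) + P.H p * P.X p * p 1 : ℝ) : ℂ), 0, 0] : Fin 4 → ℂ) a

/-- `J_a^b = 2 i g^{bc} Ẑ¹_{ac}`, as a complex array. -/
def complexJ (p : Pt) (a b : Fin 4) : ℂ :=
  2 * I * ∑ c, (((P.metric p)⁻¹ b c : ℝ) : ℂ) * P.hatZ p a c

/-- `Y_{ab} = -(2 i / 3) u⁻¹ Ẑ¹_{ab}`, as a complex array. -/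
def complexY (p : Pt) (a b : Fin 4) : ℂ :=
  -(2 * I / 3) * ((P.u p)⁻¹ : ℝ) * P.hatZ p a b

/-- The real part of `complexJ` (which is real). -/
def J : MatField := fun p => Matrix.of fun a b => (P.complexJ p a b).re

/-- The real part of `complexY` (which is real). -/
def killingYano : MatField := fun p => Matrix.of fun a b => (P.complexY p a b).re

/-- `ξ^a = g^{ac} ∇^b Y_{cb}`. -/
def ξ (p : Pt) (a : Fin 4) : ℝ :=
  ∑ c, (P.metric p)⁻¹ a c *
    ∑ b, ∑ d, (P.metric p)⁻¹ b d * covDeriv P.metric P.killingYano p d c b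

/-- The constant `c = (k / (√6 (1 + ν)))^{1/3}`. -/
def c : ℝ := cubeRoot (P.k / (Real.sqrt 6 * (1 + P.ν)))

end ChenTeo

end

/-! The curvature of the Chen–Teo metric is never written out. Everything is read off from one
explicit real 2-form together with general facts about Kähler surfaces and conformal rescaling.

The form: the rotation by `π/4` in the adapted tetrad cancels the purely base and purely fibre parts
of `Ẑ¹` (`wedge_rotation`). After the square roots are eliminated, `2iẐ¹` is the real form `twoForm`
(`hatZ_eq`), which only pairs `dx, dy` with `dτ, dφ`. The apparent denominator `F` divides out and
leaves polynomials `Q₁`, `Q₂` (`F_mul_Q₁`, `F_mul_Q₂`). Hence `J` exchanges base and fibre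
directions and depends on `x, y` alone. Writing `ℓ = νx + y`, so that `u = -(x - y)/ℓ`, the claims
about `J` and `ω̄ = u² J g` become polynomial identities: `J² = -1` is `y Q₂ - x Q₁ = H (x - y)`
(`Q₂_sub_Q₁`), integrability is the equality of two first derivatives (`nijenhuis_matJ`), and `dω̄ =
0` is an elementary check plus `pd_Q₁_add_pd_Q₂` (`closed_twoFormBar`).

Scalar curvature: a closed Hermitian form with integrable `J` is parallel
(`IsKahlerOn.nablaJ_eq_zero`), so the curvature commutes with `J`, and the trace of `J` against the
curvature is twice the Ricci form. On the components that matter this trace is the exterior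
derivative of `θ_d = tr (J Γ_d)`, which is the divergence of `J ∂_d`. If that divergence is `η (J
∂_d)`, then `scal` is minus the divergence of the vector dual to `η` (`IsKahlerOn.mul_scal_eq`).
This is a coordinate version of the formula for the Ricci form as a complex Hessian of the logarithm
of the volume. Here `η` is the logarithmic differential of `X Y / ℓ⁴`, and the divergence collapses
to `6 (1 + ν) u / k` (`scal_metricBar`).

Weyl tensor: on a Kähler surface `W⁺` is `scal / 24` times a universal tensor built from `ω` and
`g`, of squared norm 96, so `|W⁺| = |scal| / √6` (`IsKahlerOn.weylPlusNorm_eq`). Conformal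
covariance (`weylPlusNorm_conf`) then gives `|W⁺| = |u|³ √6 |1 + ν| / k` for `g`. Taking cube roots
relates `u` to `|W⁺|`, and `ν = -1` makes `scal`, hence `W⁺`, vanish.

Killing–Yano form and Killing field: `ω̄` is parallel for `u² g`, and conformal Killing–Yano 2-forms
have conformal weight 3, so `u⁻³ ω̄`, proportional to `u⁻¹ Ẑ¹`, is conformal Killing–Yano for `g`.
Its divergence is the symplectic gradient of `u` (`divergence_confKahler`). The `∂_τ` row of `ω̄` is
proportional to `du` (`pd_u_eq`), so this gradient is a constant multiple of `∂_τ`. It is Killing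
because nothing depends on `τ`. As `scal` is a constant times `u`, its gradient is a multiple of `J
∂_τ`, which is holomorphic because `J` is integrable and independent of `τ`. -/

noncomputable section

namespace Chart

open Matrix

/-! ### Partial derivatives -/

section PartialDerivatives

variable {U : Set Pt} {p : Pt} {f h : Pt → ℝ}

theorem differentiableAt_of_contDiffOn (hU : IsOpen U) (hf : ContDiffOn ℝ ∞ f U) (hp : p ∈ U) :
    DifferentiableAt ℝ f p :=
  (hf.contDiffAt (hU.mem_nhds hp)).differentiableAt (by simp)

theorem pd_congr (hU : IsOpen U) (hfh : ∀ q ∈ U, f q = h q) (hp : p ∈ U) (i : Fin 4) :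
    pd i f p = pd i h p := by
  have : f =ᶠ[nhds p] h := Filter.eventuallyEq_of_mem (hU.mem_nhds hp) hfh
  simp only [pd, this.fderiv_eq]

theorem pd_const (i : Fin 4) (c : ℝ) : pd i (fun _ => c) p = 0 := by
  simp [pd]

theorem pd_add (i : Fin 4) (hf : DifferentiableAt ℝ f p) (hh : DifferentiableAt ℝ h p) :
    pd i (fun q => f q + h q) p = pd i f p + pd i h p := by
  simp [pd, fderiv_fun_add hf hh]

theorem pd_sub (i : Fin 4) (hf : DifferentiableAt ℝ f p) (hh : DifferentiableAt ℝ h p) :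
    pd i (fun q => f q - h q) p = pd i f p - pd i h p := by
  simp [pd, fderiv_fun_sub hf hh]

theorem pd_neg (i : Fin 4) : pd i (fun q => -f q) p = -pd i f p := by
  simp [pd, fderiv_fun_neg]

theorem pd_mul (i : Fin 4) (hf : DifferentiableAt ℝ f p) (hh : DifferentiableAt ℝ h p) :
    pd i (fun q => f q * h q) p = pd i f p * h p + f p * pd i h p := by
  simp [pd, fderiv_fun_mul hf hh]
  ring

theorem pd_const_mul (i : Fin 4) (c : ℝ) (hf : DifferentiableAt ℝ f p) :
    pd i (fun q => c * f q) p = c * pd i f p := by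
  rw [pd_mul i (differentiableAt_const c) hf, pd_const]
  ring

theorem pd_sum {ι : Type*} (s : Finset ι) {F : ι → Pt → ℝ} (i : Fin 4)
    (hF : ∀ k ∈ s, DifferentiableAt ℝ (F k) p) :
    pd i (fun q => ∑ k ∈ s, F k q) p = ∑ k ∈ s, pd i (F k) p := by
  simp [pd, fderiv_fun_sum hF]

theorem contDiffOn_pd (hU : IsOpen U) (hf : ContDiffOn ℝ ∞ f U) (i : Fin 4) :
    ContDiffOn ℝ ∞ (pd i f) U :=
  ((contDiffOn_infty_iff_fderiv_of_isOpen hU).1 hf).2.clm_apply contDiffOn_const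

theorem pd_comm (hU : IsOpen U) (hf : ContDiffOn ℝ ∞ f U) (hp : p ∈ U) (i j : Fin 4) :
    pd i (pd j f) p = pd j (pd i f) p := by
  have hf' := hf.contDiffAt (hU.mem_nhds hp)
  have hd : DifferentiableAt ℝ (fderiv ℝ f) p :=
    (((contDiffOn_infty_iff_fderiv_of_isOpen hU).1 hf).2.contDiffAt
      (hU.mem_nhds hp)).differentiableAt (by simp)
  have key : ∀ a b : Fin 4, pd a (pd b f) p
      = fderiv ℝ (fderiv ℝ f) p (Pi.single a 1) (Pi.single b 1) := by
    intro a b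
    change fderiv ℝ (fun q => fderiv ℝ f q (Pi.single b 1)) p (Pi.single a 1) = _
    rw [fderiv_clm_apply hd (differentiableAt_const _)]
    simp
  rw [key, key]
  exact (hf'.isSymmSndFDerivAt (by
    rw [minSmoothness_of_isRCLikeNormedField]
    exact WithTop.coe_le_coe.2 le_top)) _ _

end PartialDerivatives

/-! ### Matrix fields -/

/-- The entrywise partial derivative of a matrix field. -/
def mpd (i : Fin 4) (M : MatField) (p : Pt) : Matrix (Fin 4) (Fin 4) ℝ :=
  Matrix.of fun a b => pd i (fun q => M q a b) p

section MatFields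

variable {U : Set Pt} {p : Pt} {M N : MatField}

theorem mpd_apply (i a b : Fin 4) : mpd i M p a b = pd i (fun q => M q a b) p := rfl

theorem SmoothOn.differentiableAt (hU : IsOpen U) (hM : SmoothOn U M) (hp : p ∈ U)
    (a b : Fin 4) : DifferentiableAt ℝ (fun q => M q a b) p :=
  differentiableAt_of_contDiffOn hU (hM a b) hp

theorem SmoothOn.mul (hM : SmoothOn U M) (hN : SmoothOn U N) :
    SmoothOn U fun q => M q * N q := fun a b => by
  simp only [Matrix.mul_apply]
  exact ContDiffOn.sum fun c _ => (hM a c).mul (hN c b)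

theorem SmoothOn.transpose (hM : SmoothOn U M) : SmoothOn U fun q => (M q)ᵀ :=
  fun a b => hM b a

theorem SmoothOn.congr (hM : SmoothOn U M) (h : ∀ q ∈ U, N q = M q) : SmoothOn U N :=
  fun a b => (hM a b).congr fun q hq => by rw [h q hq]

theorem mpd_congr (hU : IsOpen U) (h : ∀ q ∈ U, M q = N q) (hp : p ∈ U) (i : Fin 4) :
    mpd i M p = mpd i N p := by
  ext a b
  exact pd_congr hU (fun q hq => by rw [h q hq]) hp i

theorem mpd_const (A : Matrix (Fin 4) (Fin 4) ℝ) (i : Fin 4) : mpd i (fun _ => A) p = 0 := by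
  ext a b
  exact pd_const i _

theorem mpd_mul (hU : IsOpen U) (hM : SmoothOn U M) (hN : SmoothOn U N) (hp : p ∈ U)
    (i : Fin 4) : mpd i (fun q => M q * N q) p = mpd i M p * N p + M p * mpd i N p := by
  ext a b
  have := fun c => hM.differentiableAt hU hp a c
  have := fun c => hN.differentiableAt hU hp c b
  simp only [mpd_apply, Matrix.mul_apply, Matrix.add_apply]
  rw [pd_sum _ _ fun c _ => (by fun_prop), ← Finset.sum_add_distrib]
  exact Finset.sum_congr rfl fun c _ => pd_mul i (by fun_prop) (by fun_prop)

theorem mpd_add (hU : IsOpen U) (hM : SmoothOn U M) (hN : SmoothOn U N) (hp : p ∈ U)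
    (i : Fin 4) : mpd i (fun q => M q + N q) p = mpd i M p + mpd i N p := by
  ext a b
  exact pd_add i (hM.differentiableAt hU hp a b) (hN.differentiableAt hU hp a b)

theorem mpd_sub (hU : IsOpen U) (hM : SmoothOn U M) (hN : SmoothOn U N) (hp : p ∈ U)
    (i : Fin 4) : mpd i (fun q => M q - N q) p = mpd i M p - mpd i N p := by
  ext a b
  exact pd_sub i (hM.differentiableAt hU hp a b) (hN.differentiableAt hU hp a b)

theorem mpd_transpose (i : Fin 4) : mpd i (fun q => (M q)ᵀ) p = (mpd i M p)ᵀ := rfl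

theorem mpd_comm (hU : IsOpen U) (hM : SmoothOn U M) (hp : p ∈ U) (i j : Fin 4) :
    mpd i (mpd j M) p = mpd j (mpd i M) p := by
  ext a b
  exact pd_comm hU (hM a b) hp i j

theorem contDiffOn_det (hM : SmoothOn U M) : ContDiffOn ℝ ∞ (fun q => (M q).det) U := by
  simp only [Matrix.det_apply]
  exact ContDiffOn.sum fun σ _ => ((contDiffOn_prod fun c _ => hM _ _).const_smul _)

theorem SmoothOn.inv (hM : SmoothOn U M) (hdet : ∀ q ∈ U, (M q).det ≠ 0) :
    SmoothOn U fun q => (M q)⁻¹ := by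
  intro a b
  simp only [Matrix.inv_def, Matrix.smul_apply, smul_eq_mul, Ring.inverse_eq_inv',
    Matrix.adjugate_apply]
  refine ((contDiffOn_det hM).inv hdet).mul (contDiffOn_det fun c d => ?_)
  by_cases hc : c = b
  · subst hc
    simpa using contDiffOn_const
  · simpa [Matrix.updateRow_ne hc] using hM c d

end MatFields

/-! ### Connection and curvature as matrices -/

/-- The connection matrices `(Γ_c)^a_b`. -/
def gam (g : MatField) (c : Fin 4) : MatField := fun p => Matrix.of fun a b => christoffel g p a c b

/-- The curvature matrices `(R_{cd})^a_b`. -/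
def curv (g : MatField) (c d : Fin 4) : MatField :=
  fun p => Matrix.of fun a b => riemannUp g p a b c d

/-- A smooth symmetric non-degenerate matrix field on an open set. -/
structure IsMetricOn (U : Set Pt) (g : MatField) : Prop where
  isOpen : IsOpen U
  smooth : SmoothOn U g
  symm : ∀ p ∈ U, (g p)ᵀ = g p
  det : ∀ p ∈ U, (g p).det ≠ 0

section Metric

variable {U : Set Pt} {p : Pt} {g : MatField}

theorem gam_apply (c a b : Fin 4) : gam g c p a b = christoffel g p a c b := rfl

theorem curv_apply (a b c d : Fin 4) : curv g c d p a b = riemannUp g p a b c d := rfl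

/-- The structure equation `R_{cd} = ∂_c Γ_d - ∂_d Γ_c + [Γ_c, Γ_d]`. In this form the curvature
identities become computations in a noncommutative matrix ring. -/
theorem curv_eq (c d : Fin 4) : curv g c d p
    = mpd c (gam g d) p - mpd d (gam g c) p + (gam g c p * gam g d p - gam g d p * gam g c p) := by
  ext a b
  simp only [curv_apply, riemannUp, Matrix.add_apply, Matrix.sub_apply, Matrix.mul_apply,
    mpd_apply, gam_apply, Finset.sum_sub_distrib]

namespace IsMetricOn

variable (hg : IsMetricOn U g)
include hg

theorem isUnit_det (hp : p ∈ U) : IsUnit (g p).det := isUnit_iff_ne_zero.2 (hg.det p hp)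

theorem mul_inv (hp : p ∈ U) : g p * (g p)⁻¹ = 1 := Matrix.mul_nonsing_inv _ (hg.isUnit_det hp)

theorem inv_mul (hp : p ∈ U) : (g p)⁻¹ * g p = 1 := Matrix.nonsing_inv_mul _ (hg.isUnit_det hp)

theorem symm_apply (hp : p ∈ U) (a b : Fin 4) : g p a b = g p b a := by
  conv_lhs => rw [← hg.symm p hp]
  rfl

theorem inv_transpose (hp : p ∈ U) : ((g p)⁻¹)ᵀ = (g p)⁻¹ := by
  rw [Matrix.transpose_nonsing_inv, hg.symm p hp]

theorem inv_symm_apply (hp : p ∈ U) (a b : Fin 4) : (g p)⁻¹ a b = (g p)⁻¹ b a := by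
  conv_lhs => rw [← hg.inv_transpose hp]
  rfl

theorem smooth_inv : SmoothOn U fun q => (g q)⁻¹ := hg.smooth.inv hg.det

theorem pd_symm (hp : p ∈ U) (c a b : Fin 4) :
    pd c (fun q => g q a b) p = pd c (fun q => g q b a) p :=
  pd_congr hg.isOpen (fun _ hq => hg.symm_apply hq a b) hp c

theorem christoffel_symm (hp : p ∈ U) (a b c : Fin 4) :
    christoffel g p a b c = christoffel g p a c b := by
  simp only [christoffel]
  congr 1
  refine Finset.sum_congr rfl fun e _ => ?_
  rw [hg.pd_symm hp e b c]
  ring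

theorem smooth_gam (c : Fin 4) : SmoothOn U (gam g c) := fun a b => by
  have h := fun i (x y : Fin 4) => contDiffOn_pd hg.isOpen (hg.smooth x y) i
  simp only [gam_apply, christoffel]
  exact contDiffOn_const.mul (ContDiffOn.sum fun e _ => (hg.smooth_inv a e).mul
    (((h _ _ _).add (h _ _ _)).sub (h _ _ _)))

theorem lower_gam (hp : p ∈ U) (a b c : Fin 4) : (g p * gam g c p) a b = (1 / 2) *
    (pd c (fun q => g q a b) p + pd b (fun q => g q a c) p - pd a (fun q => g q c b) p) := by
  have h : gam g c p = (g p)⁻¹ * Matrix.of fun e b => (1 / 2) *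
      (pd c (fun q => g q e b) p + pd b (fun q => g q e c) p - pd e (fun q => g q c b) p) := by
    ext a b
    simp only [gam_apply, christoffel, Matrix.mul_apply, Matrix.of_apply, Finset.mul_sum]
    exact Finset.sum_congr rfl fun e _ => by ring
  rw [h, ← Matrix.mul_assoc, hg.mul_inv hp, Matrix.one_mul, Matrix.of_apply]

/-- Metric compatibility. -/
theorem mpd_metric (hp : p ∈ U) (c : Fin 4) :
    mpd c g p = g p * gam g c p + (gam g c p)ᵀ * g p := by
  have h : (gam g c p)ᵀ * g p = (g p * gam g c p)ᵀ := by
    rw [Matrix.transpose_mul, hg.symm p hp]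
  ext a b
  rw [h, Matrix.add_apply, Matrix.transpose_apply, hg.lower_gam hp, hg.lower_gam hp,
    hg.pd_symm hp c b a, hg.pd_symm hp b a c, hg.pd_symm hp a b c, mpd_apply]
  ring

theorem mpd_inv (hp : p ∈ U) (c : Fin 4) : mpd c (fun q => (g q)⁻¹) p
    = -(gam g c p * (g p)⁻¹) - (g p)⁻¹ * (gam g c p)ᵀ := by
  have h := mpd_mul hg.isOpen hg.smooth_inv hg.smooth hp c
  rw [mpd_congr hg.isOpen (fun q hq => hg.inv_mul hq) hp, mpd_const, hg.mpd_metric hp] at h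
  -- A tautology, arranged so that the derivative of `g⁻¹ g = 1` and the products `g⁻¹ g`, `g g⁻¹`
  -- occur literally and can be rewritten.
  have h2 : mpd c (fun q => (g q)⁻¹) p
      = (mpd c (fun q => (g q)⁻¹) p * g p + (g p)⁻¹ * (g p * gam g c p + (gam g c p)ᵀ * g p))
        * (g p)⁻¹ - (g p)⁻¹ * g p * gam g c p * (g p)⁻¹
        - (g p)⁻¹ * (gam g c p)ᵀ * (g p * (g p)⁻¹)
        + mpd c (fun q => (g q)⁻¹) p * (1 - g p * (g p)⁻¹) := by noncomm_ring
  rw [h2, ← h, hg.inv_mul hp, hg.mul_inv hp]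
  simp

/-- Expand `∂_c ∂_d g` by metric compatibility. The symmetry of mixed partial derivatives leaves
exactly the curvature lowered by `g` plus its transpose. -/
theorem lower_curv_antisymm (hp : p ∈ U) (c d : Fin 4) :
    g p * curv g c d p + (curv g c d p)ᵀ * g p = 0 := by
  have hU := hg.isOpen
  have hs := hg.smooth
  have key : ∀ c d : Fin 4, mpd c (mpd d g) p
      = (g p * gam g c p + (gam g c p)ᵀ * g p) * gam g d p + g p * mpd c (gam g d) p
        + ((mpd c (gam g d) p)ᵀ * g p
          + (gam g d p)ᵀ * (g p * gam g c p + (gam g c p)ᵀ * g p)) := by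
    intro c d
    have hd := hg.smooth_gam d
    rw [mpd_congr hU (fun q hq => hg.mpd_metric hq d) hp,
      mpd_add hU (hs.mul hd) (hd.transpose.mul hs) hp, mpd_mul hU hs hd hp,
      mpd_mul hU hd.transpose hs hp, hg.mpd_metric hp, mpd_transpose]
  have h := mpd_comm hU hs hp c d
  rw [key c d, key d c, ← sub_eq_zero] at h
  rw [curv_eq, ← h]
  simp only [Matrix.transpose_add, Matrix.transpose_sub, Matrix.transpose_mul]
  noncomm_ring

omit hg in
theorem riemann_eq (a b c d : Fin 4) : riemann g p a b c d = (g p * curv g c d p) a b := by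
  simp only [riemann, Matrix.mul_apply, curv_apply]

omit hg in
theorem riemannUp_antisymm (a b c d : Fin 4) : riemannUp g p a b c d = -riemannUp g p a b d c := by
  rw [← curv_apply, ← curv_apply, curv_eq, curv_eq, ← Matrix.neg_apply]
  exact congrFun (congrFun (by abel) a) b

omit hg in
theorem riemann_antisymm_right (a b c d : Fin 4) :
    riemann g p a b c d = -riemann g p a b d c := by
  simp only [riemann, ← Finset.sum_neg_distrib]
  exact Finset.sum_congr rfl fun e _ => by rw [riemannUp_antisymm]; ring

theorem riemann_antisymm_left (hp : p ∈ U) (a b c d : Fin 4) :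
    riemann g p a b c d = -riemann g p b a c d := by
  have h := congrFun (congrFun (hg.lower_curv_antisymm hp c d) a) b
  have h2 : (curv g c d p)ᵀ * g p = (g p * curv g c d p)ᵀ := by
    rw [Matrix.transpose_mul, hg.symm p hp]
  rw [h2] at h
  rw [riemann_eq, riemann_eq]
  exact eq_neg_of_add_eq_zero_left h

/-- The first Bianchi identity. -/
theorem riemannUp_bianchi (hp : p ∈ U) (a b c d : Fin 4) :
    riemannUp g p a b c d + riemannUp g p a c d b + riemannUp g p a d b c = 0 := by
  have hpd : ∀ i x y : Fin 4, pd i (fun q => christoffel g q a x y) p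
      = pd i (fun q => christoffel g q a y x) p := fun i x y =>
    pd_congr hg.isOpen (fun q hq => hg.christoffel_symm hq a x y) hp i
  simp only [riemannUp]
  rw [hpd c d b, hpd d b c, hpd b c d]
  have hs : ∀ x y z : Fin 4, ∑ e, (christoffel g p a x e * christoffel g p e y z)
      = ∑ e, (christoffel g p a x e * christoffel g p e z y) := fun x y z =>
    Finset.sum_congr rfl fun e _ => by rw [hg.christoffel_symm hp e y z]
  simp only [Finset.sum_sub_distrib]
  rw [hs c d b, hs d b c, hs b c d]
  ring

theorem riemann_bianchi (hp : p ∈ U) (a b c d : Fin 4) :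
    riemann g p a b c d + riemann g p a c d b + riemann g p a d b c = 0 := by
  simp only [riemann, ← Finset.sum_add_distrib, ← mul_add, hg.riemannUp_bianchi hp, mul_zero,
    Finset.sum_const_zero]

/-- The classical octahedron argument: combine the four first Bianchi identities for the cyclic
shifts of `a b c d`, and cancel by the two antisymmetries. -/
theorem riemann_pair_symm (hp : p ∈ U) (a b c d : Fin 4) :
    riemann g p a b c d = riemann g p c d a b := by
  have h1 := hg.riemann_bianchi hp a b c d
  have h2 := hg.riemann_bianchi hp b c d a
  have h3 := hg.riemann_bianchi hp c d a b
  have h4 := hg.riemann_bianchi hp d a b c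
  have A := hg.riemann_antisymm_left hp
  have B := fun a b c d => riemann_antisymm_right (g := g) (p := p) a b c d
  linarith [A a c d b, A b d a c, A b c d a, A c d a b, A d b c a, A c a b d, A d a b c, A d c a b,
    B a b c d, B a c d b, B a d b c, B b c d a, B b d a c, B b a c d, B c d a b, B c a b d,
    B c b d a, B d a b c, B d b c a, B d c a b, A b a c d, A c b d a, A a d b c]

theorem riemannUp_eq (hp : p ∈ U) (a b c d : Fin 4) :
    riemannUp g p a b c d = ∑ e, (g p)⁻¹ a e * riemann g p e b c d := by
  simp only [riemann_eq]
  rw [← Matrix.mul_apply, ← Matrix.mul_assoc, hg.inv_mul hp, Matrix.one_mul, curv_apply]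

theorem ricci_eq (hp : p ∈ U) (b d : Fin 4) :
    ricci g p b d = ∑ a, ∑ c, (g p)⁻¹ a c * riemann g p a b c d := by
  simp only [ricci, hg.riemannUp_eq hp]
  rw [Finset.sum_comm]
  exact Finset.sum_congr rfl fun a _ => Finset.sum_congr rfl fun c _ => by
    rw [hg.inv_symm_apply hp]

theorem ricci_symm (hp : p ∈ U) (b d : Fin 4) : ricci g p b d = ricci g p d b := by
  rw [hg.ricci_eq hp, hg.ricci_eq hp, Finset.sum_comm]
  exact Finset.sum_congr rfl fun a _ => Finset.sum_congr rfl fun c _ => by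
    rw [hg.riemann_pair_symm hp, hg.inv_symm_apply hp]

end IsMetricOn

end Metric

end Chart

end

noncomputable section

namespace Chart

open Matrix

/-! ### Conformal change of the metric -/

/-- The conformally rescaled metric `u² g`. -/
def conf (u : Pt → ℝ) (g : MatField) : MatField := fun p => u p ^ 2 • g p

/-- The logarithmic differential `∂_a u / u`. -/
def logd (u : Pt → ℝ) (a : Fin 4) (p : Pt) : ℝ := pd a u p / u p

/-- The logarithmic gradient `g^{ab} ∂_b u / u`. -/
def logGrad (u : Pt → ℝ) (g : MatField) (a : Fin 4) (p : Pt) : ℝ :=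
  ∑ b, (g p)⁻¹ a b * logd u b p

/-- The difference of the connection matrices of `u² g` and `g`. -/
def confDiff (u : Pt → ℝ) (g : MatField) (c : Fin 4) : MatField := fun p => Matrix.of fun a b =>
  (1 : Matrix (Fin 4) (Fin 4) ℝ) a b * logd u c p + (1 : Matrix (Fin 4) (Fin 4) ℝ) a c * logd u b p
    - g p c b * logGrad u g a p

/-- The covariant derivative of the logarithmic differential. -/
def confHess (u : Pt → ℝ) (g : MatField) (c b : Fin 4) (p : Pt) : ℝ :=
  pd c (logd u b) p - ∑ e, christoffel g p e c b * logd u e p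

/-- The symmetric tensor `h` for which `u² g` has the curvature of `g` plus the
Kulkarni-Nomizu product of `g` and `-h`. -/
def confSchouten (u : Pt → ℝ) (g : MatField) (c b : Fin 4) (p : Pt) : ℝ :=
  confHess u g c b p - logd u c p * logd u b p
    + 1 / 2 * (∑ e, logGrad u g e p * logd u e p) * g p c b

section Conformal

variable {U : Set Pt} {p : Pt} {g : MatField} {u : Pt → ℝ}

theorem conf_inv (hg : IsMetricOn U g) (hp : p ∈ U) (hu : u p ≠ 0) :
    (conf u g p)⁻¹ = (u p ^ 2)⁻¹ • (g p)⁻¹ := by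
  refine Matrix.inv_eq_left_inv ?_
  rw [conf, Matrix.smul_mul, Matrix.mul_smul, smul_smul, hg.inv_mul hp, inv_mul_cancel₀ (by positivity),
    one_smul]

theorem IsMetricOn.conf (hg : IsMetricOn U g) (hu : ContDiffOn ℝ ∞ u U) (hu0 : ∀ q ∈ U, u q ≠ 0) :
    IsMetricOn U (conf u g) where
  isOpen := hg.isOpen
  smooth a b := (hu.pow 2).mul (hg.smooth a b)
  symm q hq := by rw [Chart.conf, Matrix.transpose_smul, hg.symm q hq]
  det q hq := by
    rw [Chart.conf, Matrix.det_smul]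
    exact mul_ne_zero (pow_ne_zero _ (pow_ne_zero _ (hu0 q hq))) (hg.det q hq)

theorem pd_conf (hg : IsMetricOn U g) (hu : ContDiffOn ℝ ∞ u U) (hp : p ∈ U) (hu0 : u p ≠ 0)
    (c a b : Fin 4) : pd c (fun q => conf u g q a b) p
      = u p ^ 2 * (pd c (fun q => g q a b) p + 2 * logd u c p * g p a b) := by
  have h1 := differentiableAt_of_contDiffOn hg.isOpen hu hp
  have h2 := hg.smooth.differentiableAt hg.isOpen hp a b
  have : (fun q => conf u g q a b) = fun q => u q * (u q * g q a b) := by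
    ext q
    simp only [conf, Matrix.smul_apply, smul_eq_mul]
    ring
  rw [this, pd_mul c h1 (h1.fun_mul h2), pd_mul c h1 h2, logd]
  field_simp
  ring

theorem sum_metric_logGrad (hg : IsMetricOn U g) (hp : p ∈ U) (c : Fin 4) :
    ∑ e, g p c e * logGrad u g e p = logd u c p := by
  have h : (g p *ᵥ ((g p)⁻¹ *ᵥ fun b => logd u b p)) c = logd u c p := by
    rw [Matrix.mulVec_mulVec, hg.mul_inv hp, Matrix.one_mulVec]
  exact h

theorem sum_inv_mul (hg : IsMetricOn U g) (hp : p ∈ U) (a c : Fin 4) :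
    ∑ e, (g p)⁻¹ a e * g p e c = (1 : Matrix (Fin 4) (Fin 4) ℝ) a c := by
  rw [← Matrix.mul_apply, hg.inv_mul hp]

theorem gam_conf (hg : IsMetricOn U g) (hu : ContDiffOn ℝ ∞ u U) (hp : p ∈ U) (hu0 : u p ≠ 0)
    (c : Fin 4) : gam (conf u g) c p = gam g c p + confDiff u g c p := by
  ext a b
  -- The Kronecker deltas are rewritten as `g⁻¹ g`, so that both sides become sums over the same
  -- index and can be compared termwise.
  simp only [gam_apply, christoffel, confDiff, Matrix.add_apply, Matrix.of_apply, conf_inv hg hp hu0,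
    Matrix.smul_apply, smul_eq_mul, pd_conf hg hu hp hu0, ← sum_inv_mul hg hp, logGrad,
    Finset.mul_sum, Finset.sum_mul, ← Finset.sum_add_distrib, ← Finset.sum_sub_distrib]
  refine Finset.sum_congr rfl fun e _ => ?_
  field_simp
  ring

theorem contDiffOn_logd (hU : IsOpen U) (hu : ContDiffOn ℝ ∞ u U) (hu0 : ∀ q ∈ U, u q ≠ 0)
    (a : Fin 4) : ContDiffOn ℝ ∞ (logd u a) U :=
  (contDiffOn_pd hU hu a).div hu hu0

theorem contDiffOn_logGrad (hg : IsMetricOn U g) (hu : ContDiffOn ℝ ∞ u U)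
    (hu0 : ∀ q ∈ U, u q ≠ 0) (a : Fin 4) : ContDiffOn ℝ ∞ (logGrad u g a) U := by
  unfold logGrad
  exact ContDiffOn.sum fun b _ => (hg.smooth_inv a b).mul (contDiffOn_logd hg.isOpen hu hu0 b)

theorem smooth_confDiff (hg : IsMetricOn U g) (hu : ContDiffOn ℝ ∞ u U)
    (hu0 : ∀ q ∈ U, u q ≠ 0) (c : Fin 4) : SmoothOn U (confDiff u g c) := fun a b =>
  ((contDiffOn_const.mul (contDiffOn_logd hg.isOpen hu hu0 c)).add
    (contDiffOn_const.mul (contDiffOn_logd hg.isOpen hu hu0 b))).sub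
    ((hg.smooth c b).mul (contDiffOn_logGrad hg hu hu0 a))

/-- For connections `Γ` and `Γ + C` the curvatures differ by `D_c C_d - D_d C_c + [C_c, C_d]`. The
Christoffel terms on the form indices may be left out because the connection is torsion free. -/
theorem curv_conf (hg : IsMetricOn U g) (hu : ContDiffOn ℝ ∞ u U) (hu0 : ∀ q ∈ U, u q ≠ 0)
    (hp : p ∈ U) (c d : Fin 4) : curv (conf u g) c d p = curv g c d p
      + (mpd c (confDiff u g d) p + gam g c p * confDiff u g d p - confDiff u g d p * gam g c p)
      - (mpd d (confDiff u g c) p + gam g d p * confDiff u g c p - confDiff u g c p * gam g d p)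
      + (confDiff u g c p * confDiff u g d p - confDiff u g d p * confDiff u g c p) := by
  have key : ∀ c d : Fin 4, mpd c (gam (conf u g) d) p
      = mpd c (gam g d) p + mpd c (confDiff u g d) p := fun c d => by
    rw [mpd_congr hg.isOpen (fun q hq => gam_conf hg hu hq (hu0 q hq) d) hp,
      mpd_add hg.isOpen (hg.smooth_gam d) (smooth_confDiff hg hu hu0 d) hp]
  rw [curv_eq, curv_eq, key, key, gam_conf hg hu hp (hu0 p hp), gam_conf hg hu hp (hu0 p hp)]
  noncomm_ring

/-- The form `du / u` is closed. This is deduced from the symmetry of second derivatives of `u`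
itself, so only `u ≠ 0` is needed, not a sign. -/
theorem pd_logd_symm (hU : IsOpen U) (hu : ContDiffOn ℝ ∞ u U) (hu0 : ∀ q ∈ U, u q ≠ 0)
    (hp : p ∈ U) (c d : Fin 4) : pd c (logd u d) p = pd d (logd u c) p := by
  have key : ∀ c d : Fin 4, pd c (pd d u) p
      = u p * pd c (logd u d) p + u p * (logd u c p * logd u d p) := fun c d => by
    have hd := differentiableAt_of_contDiffOn hU (contDiffOn_logd hU hu hu0 d) hp
    have hu' := differentiableAt_of_contDiffOn hU hu hp
    have h : ∀ q ∈ U, pd d u q = u q * logd u d q := fun q hq => by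
      have := hu0 q hq
      rw [logd]; field_simp
    have h0 := hu0 p hp
    rw [pd_congr hU h hp, pd_mul c hu' hd]
    simp only [logd]
    field_simp
    ring
  have h := pd_comm hU hu hp c d
  rw [key c d, key d c] at h
  have h0 := hu0 p hp
  refine mul_left_cancel₀ h0 ?_
  linarith

/-- Raising an index commutes with covariant differentiation, because `g⁻¹` is parallel (`mpd_inv`).
-/
theorem pd_logGrad (hg : IsMetricOn U g) (hu : ContDiffOn ℝ ∞ u U) (hu0 : ∀ q ∈ U, u q ≠ 0)
    (hp : p ∈ U) (c a : Fin 4) :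
    pd c (logGrad u g a) p + ∑ e, christoffel g p a c e * logGrad u g e p
      = ∑ b, (g p)⁻¹ a b * confHess u g c b p := by
  have hd := fun b => differentiableAt_of_contDiffOn hg.isOpen (contDiffOn_logd hg.isOpen hu hu0 b) hp
  have hi := fun b => hg.smooth_inv.differentiableAt hg.isOpen hp a b
  have h1 : pd c (logGrad u g a) p = ((mpd c (fun q => (g q)⁻¹) p) *ᵥ fun b => logd u b p) a
      + ((g p)⁻¹ *ᵥ fun b => pd c (logd u b) p) a := by
    unfold logGrad
    rw [pd_sum _ _ fun b _ => (hi b).fun_mul (hd b)]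
    simp only [Matrix.mulVec, dotProduct, ← Finset.sum_add_distrib]
    exact Finset.sum_congr rfl fun b _ => pd_mul c (hi b) (hd b)
  have h2 : ∑ e, christoffel g p a c e * logGrad u g e p
      = ((gam g c p * (g p)⁻¹) *ᵥ fun b => logd u b p) a := by
    rw [← Matrix.mulVec_mulVec]; rfl
  have h3 : ∑ b, (g p)⁻¹ a b * confHess u g c b p = ((g p)⁻¹ *ᵥ fun b => pd c (logd u b) p) a
      - (((g p)⁻¹ * (gam g c p)ᵀ) *ᵥ fun b => logd u b p) a := by
    rw [← Matrix.mulVec_mulVec]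
    simp only [Matrix.mulVec, dotProduct, confHess, ← Finset.sum_sub_distrib, mul_sub,
      Matrix.transpose_apply, gam_apply]
  rw [h1, h2, h3, hg.mpd_inv hp, Matrix.sub_mulVec, Matrix.neg_mulVec]
  simp only [Pi.sub_apply, Pi.neg_apply]
  ring

theorem confHess_symm (hg : IsMetricOn U g) (hu : ContDiffOn ℝ ∞ u U) (hu0 : ∀ q ∈ U, u q ≠ 0)
    (hp : p ∈ U) (c b : Fin 4) : confHess u g c b p = confHess u g b c p := by
  simp only [confHess]
  rw [pd_logd_symm hg.isOpen hu hu0 hp]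
  congr 1
  exact Finset.sum_congr rfl fun e _ => by rw [hg.christoffel_symm hp]

theorem confSchouten_symm (hg : IsMetricOn U g) (hu : ContDiffOn ℝ ∞ u U)
    (hu0 : ∀ q ∈ U, u q ≠ 0) (hp : p ∈ U) (c b : Fin 4) :
    confSchouten u g c b p = confSchouten u g b c p := by
  simp only [confSchouten]
  rw [confHess_symm hg hu hu0 hp, hg.symm_apply hp]
  ring

theorem sum_inv_confSchouten (hg : IsMetricOn U g) (hu : ContDiffOn ℝ ∞ u U)
    (hu0 : ∀ q ∈ U, u q ≠ 0) (hp : p ∈ U) (c a : Fin 4) :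
    ∑ e, (g p)⁻¹ a e * confSchouten u g c e p
      = pd c (logGrad u g a) p + ∑ e, christoffel g p a c e * logGrad u g e p
        - logd u c p * logGrad u g a p
        + 1 / 2 * (∑ e, logGrad u g e p * logd u e p) * (1 : Matrix (Fin 4) (Fin 4) ℝ) a c := by
  rw [pd_logGrad hg hu hu0 hp, ← sum_inv_mul hg hp]
  simp only [confSchouten]
  generalize (∑ e, logGrad u g e p * logd u e p) = N
  rw [logGrad, Finset.mul_sum, Finset.mul_sum, ← Finset.sum_sub_distrib, ← Finset.sum_add_distrib]
  refine Finset.sum_congr rfl fun e _ => ?_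
  rw [hg.symm_apply hp c e]
  ring

/-- The core of the conformal calculation. The derivatives and connection terms in `curv_conf`
assemble into the Hessian of `log |u|`, and the commutator supplies the quadratic terms of
`confSchouten`. Everything symmetric in `c, d` drops out. -/
theorem riemannUp_conf (hg : IsMetricOn U g) (hu : ContDiffOn ℝ ∞ u U) (hu0 : ∀ q ∈ U, u q ≠ 0)
    (hp : p ∈ U) (a b c d : Fin 4) : riemannUp (conf u g) p a b c d = riemannUp g p a b c d
      + (1 : Matrix (Fin 4) (Fin 4) ℝ) a d * confSchouten u g c b p
      - (1 : Matrix (Fin 4) (Fin 4) ℝ) a c * confSchouten u g d b p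
      - g p d b * (∑ e, (g p)⁻¹ a e * confSchouten u g c e p)
      + g p c b * (∑ e, (g p)⁻¹ a e * confSchouten u g d e p) := by
  have hU := hg.isOpen
  have hmpd : ∀ c d : Fin 4, mpd c (confDiff u g d) p a b
      = (1 : Matrix (Fin 4) (Fin 4) ℝ) a b * pd c (logd u d) p
        + (1 : Matrix (Fin 4) (Fin 4) ℝ) a d * pd c (logd u b) p
        - (((g p * gam g c p) d b + (g p * gam g c p) b d) * logGrad u g a p
          + g p d b * pd c (logGrad u g a) p) := by
    intro c d
    have hl := fun b => differentiableAt_of_contDiffOn hU (contDiffOn_logd hU hu hu0 b) hp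
    have hG := differentiableAt_of_contDiffOn hU (contDiffOn_logGrad hg hu hu0 a) hp
    have hgd := hg.smooth.differentiableAt hU hp d b
    have hm : pd c (fun q => g q d b) p = (g p * gam g c p) d b + (g p * gam g c p) b d := by
      have h2 : (gam g c p)ᵀ * g p = (g p * gam g c p)ᵀ := by
        rw [Matrix.transpose_mul, hg.symm p hp]
      rw [← mpd_apply, hg.mpd_metric hp, h2]
      rfl
    have h1 := hl d
    have h2 := hl b
    simp only [mpd_apply, confDiff, Matrix.of_apply]
    rw [pd_sub _ (by fun_prop) (by fun_prop), pd_add _ (by fun_prop) (by fun_prop),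
      pd_const_mul _ _ (by fun_prop), pd_const_mul _ _ (by fun_prop),
      pd_mul _ (by fun_prop) (by fun_prop), hm]
  have hGC : ∀ c d : Fin 4, (gam g c p * confDiff u g d p) a b
      = christoffel g p a c b * logd u d p + christoffel g p a c d * logd u b p
        - g p d b * ∑ e, christoffel g p a c e * logGrad u g e p := by
    intro c d
    simp only [Matrix.mul_apply, confDiff, Matrix.of_apply, gam_apply, mul_sub, mul_add,
      Finset.sum_sub_distrib, Finset.sum_add_distrib, Matrix.one_apply, Finset.mul_sum]
    congr 1
    · simp
    · exact Finset.sum_congr rfl fun e _ => by ring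
  have hCG : ∀ c d : Fin 4, (confDiff u g d p * gam g c p) a b
      = christoffel g p a c b * logd u d p
        + (1 : Matrix (Fin 4) (Fin 4) ℝ) a d * (∑ e, christoffel g p e c b * logd u e p)
        - logGrad u g a p * (g p * gam g c p) d b := by
    intro c d
    simp only [Matrix.mul_apply, confDiff, Matrix.of_apply, gam_apply, sub_mul, add_mul,
      Finset.sum_sub_distrib, Finset.sum_add_distrib, Matrix.one_apply, Finset.mul_sum]
    congr 1
    · congr 1
      · simp [mul_comm]
      · exact Finset.sum_congr rfl fun e _ => by ring
    · exact Finset.sum_congr rfl fun e _ => by ring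
  have hCC : ∀ c d : Fin 4, (confDiff u g c p * confDiff u g d p) a b
      = logd u c p * confDiff u g d p a b
        + (1 : Matrix (Fin 4) (Fin 4) ℝ) a c * (2 * logd u b p * logd u d p
          - g p d b * ∑ e, logGrad u g e p * logd u e p)
        - logGrad u g a p * (g p c b * logd u d p + g p c d * logd u b p
          - g p d b * logd u c p) := by
    intro c d
    have h1 : ∑ e, g p c e * confDiff u g d p e b
        = g p c b * logd u d p + g p c d * logd u b p - g p d b * logd u c p := by
      simp only [← sum_metric_logGrad hg hp c (u := u), confDiff, Matrix.of_apply, mul_sub, mul_add,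
        Finset.sum_sub_distrib, Finset.sum_add_distrib, Matrix.one_apply, Finset.mul_sum]
      congr 1
      · simp
      · exact Finset.sum_congr rfl fun e _ => by ring
    have h2 : ∑ e, logd u e p * confDiff u g d p e b = 2 * logd u b p * logd u d p
          - g p d b * ∑ e, logGrad u g e p * logd u e p := by
      simp only [confDiff, Matrix.of_apply, mul_sub, mul_add,
        Finset.sum_sub_distrib, Finset.sum_add_distrib, Matrix.one_apply, Finset.mul_sum]
      congr 1
      · simp; ring
      · exact Finset.sum_congr rfl fun e _ => by ring
    have h3 : ∑ e, (1 : Matrix (Fin 4) (Fin 4) ℝ) a e * confDiff u g d p e b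
        = confDiff u g d p a b := by rw [← Matrix.mul_apply, Matrix.one_mul]
    rw [← h1, ← h2, ← h3, Matrix.mul_apply]
    simp only [Finset.mul_sum, ← Finset.sum_add_distrib, ← Finset.sum_sub_distrib]
    refine Finset.sum_congr rfl fun e _ => ?_
    conv_lhs => rw [confDiff, Matrix.of_apply]
    ring
  have h := congrFun (congrFun (curv_conf hg hu hu0 hp c d) a) b
  simp only [Matrix.add_apply, Matrix.sub_apply, hmpd, hGC, hCG, hCC, curv_apply] at h
  rw [h, sum_inv_confSchouten hg hu hu0 hp, sum_inv_confSchouten hg hu hu0 hp,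
    pd_logd_symm hU hu hu0 hp d c, hg.christoffel_symm hp a d c]
  have hsym : (g p * gam g c p) b d = (g p * gam g d p) b c := by
    simp only [Matrix.mul_apply, gam_apply]
    exact Finset.sum_congr rfl fun e _ => by rw [hg.christoffel_symm hp]
  rw [hsym, hg.symm_apply hp d c]
  simp only [confSchouten, confHess, confDiff, Matrix.of_apply]
  ring

theorem sum_confSchouten_up (hg : IsMetricOn U g) (hp : p ∈ U) (a c : Fin 4) :
    ∑ e, g p a e * (∑ f, (g p)⁻¹ e f * confSchouten u g c f p) = confSchouten u g c a p := by
  have h : (g p *ᵥ ((g p)⁻¹ *ᵥ fun b => confSchouten u g c b p)) a = confSchouten u g c a p := by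
    rw [Matrix.mulVec_mulVec, hg.mul_inv hp, Matrix.one_mulVec]
  exact h

/-- The trace of `confSchouten`. -/
def confTrace (u : Pt → ℝ) (g : MatField) (p : Pt) : ℝ :=
  ∑ a, ∑ e, (g p)⁻¹ a e * confSchouten u g a e p

theorem riemann_conf (hg : IsMetricOn U g) (hu : ContDiffOn ℝ ∞ u U) (hu0 : ∀ q ∈ U, u q ≠ 0)
    (hp : p ∈ U) (a b c d : Fin 4) : riemann (conf u g) p a b c d = u p ^ 2 *
      (riemann g p a b c d + g p a d * confSchouten u g c b p - g p a c * confSchouten u g d b p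
      - g p d b * confSchouten u g c a p + g p c b * confSchouten u g d a p) := by
  have h1 : ∀ d, ∑ e, g p a e * (1 : Matrix (Fin 4) (Fin 4) ℝ) e d = g p a d := fun d => by
    rw [← Matrix.mul_apply, Matrix.mul_one]
  rw [← sum_confSchouten_up hg hp a c, ← sum_confSchouten_up hg hp a d, ← h1 d, ← h1 c]
  simp only [riemann, riemannUp_conf hg hu hu0 hp, conf, Matrix.smul_apply, smul_eq_mul]
  generalize confSchouten u g c b p = x
  generalize confSchouten u g d b p = y
  rw [Finset.sum_mul, Finset.sum_mul, Finset.mul_sum (a := g p d b), Finset.mul_sum (a := g p c b),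
    ← Finset.sum_add_distrib, ← Finset.sum_sub_distrib, ← Finset.sum_sub_distrib,
    ← Finset.sum_add_distrib, Finset.mul_sum]
  exact Finset.sum_congr rfl fun e _ => by ring

theorem ricci_conf (hg : IsMetricOn U g) (hu : ContDiffOn ℝ ∞ u U) (hu0 : ∀ q ∈ U, u q ≠ 0)
    (hp : p ∈ U) (b d : Fin 4) : ricci (conf u g) p b d
      = ricci g p b d - 2 * confSchouten u g d b p - g p b d * confTrace u g p := by
  have h1 : ∑ a, (1 : Matrix (Fin 4) (Fin 4) ℝ) a d * confSchouten u g a b p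
      = confSchouten u g d b p := by simp [Matrix.one_apply]
  have h2 : ∑ a, g p a b * (∑ e, (g p)⁻¹ a e * confSchouten u g d e p)
      = confSchouten u g d b p := by
    rw [← sum_confSchouten_up hg hp]
    exact Finset.sum_congr rfl fun e _ => by rw [hg.symm_apply hp]
  have h3 : ∑ a : Fin 4, (1 : Matrix (Fin 4) (Fin 4) ℝ) a a * confSchouten u g d b p
      = 4 * confSchouten u g d b p := by simp
  simp only [ricci, riemannUp_conf hg hu hu0 hp, Finset.sum_add_distrib, Finset.sum_sub_distrib, h1,
    h2, h3, ← Finset.mul_sum]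
  rw [confTrace, hg.symm_apply hp d b]
  ring

theorem scal_conf (hg : IsMetricOn U g) (hu : ContDiffOn ℝ ∞ u U) (hu0 : ∀ q ∈ U, u q ≠ 0)
    (hp : p ∈ U) : u p ^ 2 * scal (conf u g) p = scal g p - 6 * confTrace u g p := by
  have h0 := hu0 p hp
  have h1 : ∑ b, ∑ d, (g p)⁻¹ b d * g p b d = 4 := by
    have h2 : ∀ b, ∑ d, (g p)⁻¹ b d * g p b d = 1 := fun b => by
      have := sum_inv_mul hg hp b b
      rw [Matrix.one_apply_eq] at this
      rw [← this]
      exact Finset.sum_congr rfl fun d _ => by rw [hg.symm_apply hp]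
    simp [h2]
  have h2 : ∑ b, ∑ d, (g p)⁻¹ b d * confSchouten u g d b p = confTrace u g p := by
    rw [confTrace]
    exact Finset.sum_congr rfl fun b _ => Finset.sum_congr rfl fun d _ => by
      rw [confSchouten_symm hg hu hu0 hp]
  have h3 : u p ^ 2 * scal (conf u g) p = scal g p
      - 2 * (∑ b, ∑ d, (g p)⁻¹ b d * confSchouten u g d b p)
      - (∑ b, ∑ d, (g p)⁻¹ b d * g p b d) * confTrace u g p := by
    simp only [scal, ricci_conf hg hu hu0 hp, conf_inv hg hp h0, Matrix.smul_apply, smul_eq_mul,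
      Finset.mul_sum, Finset.sum_mul, ← Finset.sum_sub_distrib]
    refine Finset.sum_congr rfl fun b _ => Finset.sum_congr rfl fun d _ => ?_
    field_simp
  rw [h3, h1, h2]
  ring

/-- The Weyl tensor is conformally covariant. -/
theorem weyl_conf (hg : IsMetricOn U g) (hu : ContDiffOn ℝ ∞ u U) (hu0 : ∀ q ∈ U, u q ≠ 0)
    (hp : p ∈ U) (a b c d : Fin 4) : weyl (conf u g) p a b c d = u p ^ 2 * weyl g p a b c d := by
  have hs := scal_conf hg hu hu0 hp
  simp only [weyl, riemann_conf hg hu hu0 hp, ricci_conf hg hu hu0 hp]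
  simp only [conf, Matrix.smul_apply, smul_eq_mul]
  change _ - _ + scal (conf u g) p / 6 * _ = _
  rw [hg.symm_apply hp d b, hg.symm_apply hp c b]
  -- The `confSchouten` terms of the Riemann and Ricci tensors cancel since `n - 2 = 2`. Only
  -- multiples of its trace remain, and these are what `scal_conf` controls.
  linear_combination (u p ^ 2 / 6 * (g p a c * g p b d - g p a d * g p b c)) * hs

theorem volForm_conf (a b c d : Fin 4) :
    volForm (conf u g) p a b c d = u p ^ 4 * volForm g p a b c d := by
  have h : ((u p ^ 2) ^ 4 : ℝ) = (u p ^ 4) ^ 2 := by ring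
  rw [volForm, volForm, conf, Matrix.det_smul, Fintype.card_fin, h, Real.sqrt_mul (by positivity),
    Real.sqrt_sq (by positivity), mul_assoc]

/-- The Hodge star on 2-forms is conformally invariant in dimension four: the factor `u⁴` of the
volume form cancels the `u⁻⁴` of the two inverse metrics. -/
theorem weylPlus_conf (hg : IsMetricOn U g) (hu : ContDiffOn ℝ ∞ u U) (hu0 : ∀ q ∈ U, u q ≠ 0)
    (hp : p ∈ U) (a b c d : Fin 4) :
    weylPlus (conf u g) p a b c d = u p ^ 2 * weylPlus g p a b c d := by
  have h0 := hu0 p hp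
  have h : ∑ e, ∑ f, ∑ m, ∑ n, volForm (conf u g) p a b m n * (conf u g p)⁻¹ m e
        * (conf u g p)⁻¹ n f * weyl (conf u g) p e f c d
      = u p ^ 2 * ∑ e, ∑ f, ∑ m, ∑ n, volForm g p a b m n * (g p)⁻¹ m e * (g p)⁻¹ n f
        * weyl g p e f c d := by
    simp only [weyl_conf hg hu hu0 hp, volForm_conf, conf_inv hg hp h0, Matrix.smul_apply,
      smul_eq_mul, Finset.mul_sum]
    refine Finset.sum_congr rfl fun e _ => Finset.sum_congr rfl fun f _ =>
      Finset.sum_congr rfl fun m _ => Finset.sum_congr rfl fun n _ => ?_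
    field_simp
  rw [weylPlus, weylPlus, h, weyl_conf hg hu hu0 hp]
  ring

/-- In the square of the norm, four inverse metrics contribute `u⁻⁸` and two Weyl tensors `u⁴`. -/
theorem weylPlusNorm_conf (hg : IsMetricOn U g) (hu : ContDiffOn ℝ ∞ u U) (hu0 : ∀ q ∈ U, u q ≠ 0)
    (hp : p ∈ U) : weylPlusNorm g p = u p ^ 2 * weylPlusNorm (conf u g) p := by
  have h0 := hu0 p hp
  rw [weylPlusNorm, weylPlusNorm]
  conv_rhs => rw [← Real.sqrt_sq (sq_nonneg (u p)), ← Real.sqrt_mul (by positivity)]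
  congr 1
  simp only [weylPlus_conf hg hu hu0 hp, conf_inv hg hp h0, Matrix.smul_apply, smul_eq_mul,
    Finset.mul_sum]
  refine Finset.sum_congr rfl fun a _ => Finset.sum_congr rfl fun b _ =>
    Finset.sum_congr rfl fun c _ => Finset.sum_congr rfl fun d _ =>
    Finset.sum_congr rfl fun a' _ => Finset.sum_congr rfl fun b' _ =>
    Finset.sum_congr rfl fun c' _ => Finset.sum_congr rfl fun d' _ => ?_
  field_simp

end Conformal

end Chart

end

noncomputable section

namespace Chart

open Matrix

/-! ### The derivative of the determinant -/

section Determinant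

variable {U : Set Pt} {p : Pt} {g : MatField} {v : Pt → ℝ}

theorem pd_prod {ι : Type*} [DecidableEq ι] (s : Finset ι) {F : ι → Pt → ℝ} (i : Fin 4)
    (hF : ∀ k ∈ s, DifferentiableAt ℝ (F k) p) :
    pd i (fun q => ∏ k ∈ s, F k q) p = ∑ k ∈ s, (∏ j ∈ s.erase k, F j p) * pd i (F k) p := by
  have h := HasFDerivAt.finsetProd (u := s) (fun k hk => (hF k hk).hasFDerivAt)
  simp [pd, h.fderiv]

/-- Jacobi's formula. -/
theorem pd_det (hU : IsOpen U) (hg : SmoothOn U g) (hp : p ∈ U) (c : Fin 4) :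
    pd c (fun q => (g q).det) p = ((g p).adjugate * mpd c g p).trace := by
  have hd := fun a b => hg.differentiableAt hU hp a b
  -- The determinant with column `i` replaced by its derivative collects the terms of the Leibniz
  -- rule that differentiate column `i`. By Cramer's rule the same determinants are the diagonal
  -- entries of the adjugate times the derivative.
  have hdet : ∀ i : Fin 4, ((g p).updateCol i fun a => mpd c g p a i).det
      = ∑ σ : Equiv.Perm (Fin 4), Equiv.Perm.sign σ •
        ((∏ j ∈ Finset.univ.erase i, g p (σ j) j) * pd c (fun q => g q (σ i) i) p) := by
    intro i
    rw [Matrix.det_apply]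
    refine Finset.sum_congr rfl fun σ _ => ?_
    congr 1
    rw [← Finset.mul_prod_erase _ _ (Finset.mem_univ i), mul_comm]
    congr 1
    · refine Finset.prod_congr rfl fun j hj => ?_
      rw [Matrix.updateCol_ne (Finset.ne_of_mem_erase hj)]
    · rw [Matrix.updateCol_self, mpd_apply]
  have htr : ((g p).adjugate * mpd c g p).trace
      = ∑ i, ((g p).updateCol i fun a => mpd c g p a i).det := by
    refine Finset.sum_congr rfl fun i _ => ?_
    rw [← Matrix.cramer_apply, Matrix.cramer_eq_adjugate_mulVec]
    rfl
  have hprod : ∀ σ : Equiv.Perm (Fin 4), DifferentiableAt ℝ (fun q => ∏ i, g q (σ i) i) p :=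
    fun σ => (HasFDerivAt.finsetProd fun j _ => (hd (σ j) j).hasFDerivAt).differentiableAt
  rw [htr]
  simp only [hdet, Matrix.det_apply]
  rw [Finset.sum_comm, pd_sum]
  · refine Finset.sum_congr rfl fun σ _ => ?_
    simp only [Units.smul_def, zsmul_eq_mul]
    rw [pd_const_mul _ _ (hprod σ),
      pd_prod _ _ fun j _ => hd _ _, Finset.mul_sum]
  · intro σ _
    exact (hprod σ).fun_const_smul _

/-- The trace of the connection matrix is the logarithmic derivative of the volume density. -/
theorem IsMetricOn.mul_trace_gam (hg : IsMetricOn U g) (hv : ContDiffOn ℝ ∞ v U)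
    (hvdet : ∀ q ∈ U, (g q).det = v q ^ 2) (hp : p ∈ U) (c : Fin 4) :
    v p * (gam g c p).trace = pd c v p := by
  have hv0 : v p ≠ 0 := fun h => hg.det p hp (by rw [hvdet p hp, h]; ring)
  have hvd := differentiableAt_of_contDiffOn hg.isOpen hv hp
  -- Metric compatibility turns Jacobi's formula into `∂_c (v²) = 2 v² tr Γ_c`. One factor `2 v` is
  -- then cancelled, whatever the sign of `v`.
  have h1 := pd_det hg.isOpen hg.smooth hp c
  rw [pd_congr hg.isOpen (h := fun q => v q * v q) (fun q hq => by rw [hvdet q hq]; ring) hp,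
    pd_mul c hvd hvd, hg.mpd_metric hp, Matrix.mul_add, ← Matrix.mul_assoc, Matrix.adjugate_mul,
    Matrix.trace_add, Matrix.smul_mul, Matrix.one_mul, ← Matrix.mul_assoc, Matrix.trace_mul_comm,
    ← Matrix.mul_assoc, Matrix.mul_adjugate, Matrix.smul_mul, Matrix.one_mul, Matrix.trace_smul,
    Matrix.trace_smul, Matrix.trace_transpose, hvdet p hp] at h1
  simp only [smul_eq_mul] at h1
  refine mul_left_cancel₀ (mul_ne_zero two_ne_zero hv0) ?_
  linarith

end Determinant

/-! ### Kähler metrics -/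

/-- The vanishing of `∇ω` for a closed form `ω` and an integrable complex structure. -/
theorem eq_zero_of_closed_of_integrable {J : Matrix (Fin 4) (Fin 4) ℝ}
    {D : Fin 4 → Matrix (Fin 4) (Fin 4) ℝ} (hJ : J * J = -1) (hD : ∀ a, (D a)ᵀ = -D a)
    (hJD : ∀ a, J * D a = D a * Jᵀ) (hcyc : ∀ a b c, D a b c + D b c a + D c a b = 0)
    (hN : ∀ a b c, ∑ d, J a d * D d b c - ∑ d, J b d * D d a c + (D a * Jᵀ) b c
      - (D b * Jᵀ) a c = 0) (a : Fin 4) : D a = 0 := by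
  have hJt : Jᵀ * Jᵀ = -1 := by rw [← Matrix.transpose_mul, hJ]; simp
  have hanti : ∀ a b c, (D a * Jᵀ) b c = -(D a * Jᵀ) c b := fun a b c => by
    have : (D a * Jᵀ)ᵀ = -(D a * Jᵀ) := by
      rw [Matrix.transpose_mul, hD, Matrix.transpose_transpose, Matrix.mul_neg, hJD]
    have := congrFun (congrFun this c) b
    exact this
  have hDa : ∀ a b c, D a b c = -D a c b := fun a b c => congrFun (congrFun (hD a) c) b
  -- This expression is symmetric in `a, b` by the Nijenhuis hypothesis and antisymmetric in `b, c`.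
  -- A 3-tensor with both symmetries vanishes, as in the uniqueness of the Levi-Civita connection.
  have hA : ∀ a b c, ∑ d, J a d * D d b c + (D a * Jᵀ) b c = 0 := by
    have hs : ∀ a b c, ∑ d, J a d * D d b c + (D a * Jᵀ) b c
        = ∑ d, J b d * D d a c + (D b * Jᵀ) a c := fun a b c => by linarith [hN a b c]
    have ha : ∀ a b c, ∑ d, J a d * D d b c + (D a * Jᵀ) b c
        = -(∑ d, J a d * D d c b + (D a * Jᵀ) c b) := fun a b c => by
      rw [hanti a b c, neg_add, ← Finset.sum_neg_distrib]
      congr 1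
      exact Finset.sum_congr rfl fun d _ => by rw [hDa d b c]; ring
    intro a b c
    linarith [ha a b c, hs a c b, ha c a b, hs c b a, ha b c a, hs b a c]
  have hA' : ∀ a b c, ∑ d, J a d * D d b c = -(D a * Jᵀ) b c := fun a b c => by
    linarith [hA a b c]
  have h1 : ∀ a b c, ∑ e, ∑ f, J b e * J c f * D a e f = -D a b c := fun a b c => by
    have : J * D a * Jᵀ = -D a := by rw [hJD, Matrix.mul_assoc, hJt]; simp
    rw [← Matrix.neg_apply, ← this]
    simp only [Matrix.mul_apply, Finset.sum_mul, Matrix.transpose_apply]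
    rw [Finset.sum_comm]
    exact Finset.sum_congr rfl fun e _ => Finset.sum_congr rfl fun f _ => by ring
  have h2 : ∀ a b c, ∑ e, ∑ f, J b e * J c f * D e f a = D b c a := fun a b c => by
    have h : ∀ f, ∑ e, J b e * J c f * D e f a = J c f * -(D b * Jᵀ) f a := fun f => by
      rw [← hA', Finset.mul_sum]
      exact Finset.sum_congr rfl fun e _ => by ring
    have h' : J * -(D b * Jᵀ) = D b := by
      rw [Matrix.mul_neg, ← Matrix.mul_assoc, hJD, Matrix.mul_assoc, hJt]; simp
    rw [Finset.sum_comm]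
    simp only [h]
    conv_rhs => rw [← h']
    rfl
  have h3 : ∀ a b c, ∑ e, ∑ f, J b e * J c f * D f a e = D c a b := fun a b c => by
    have h : ∀ e, ∑ f, J b e * J c f * D f a e = J b e * -(D c * Jᵀ) a e := fun e => by
      rw [← hA', Finset.mul_sum]
      exact Finset.sum_congr rfl fun f _ => by ring
    have h' : -(D c * Jᵀ) * Jᵀ = D c := by
      rw [Matrix.neg_mul, Matrix.mul_assoc, hJt]; simp
    simp only [h]
    conv_rhs => rw [← h']
    rw [Matrix.mul_apply]
    exact Finset.sum_congr rfl fun e _ => by rw [Matrix.transpose_apply, mul_comm]; rfl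
  ext b c
  -- Applying `J` to two slots of the cyclic identity flips the sign of one of its three terms only.
  -- Subtracting the result from the original identity isolates `2 D a b c = 0`.
  have h : ∑ e, ∑ f, J b e * J c f * (D a e f + D e f a + D f a e) = 0 := by simp [hcyc]
  simp only [mul_add, Finset.sum_add_distrib, h1, h2, h3] at h
  have := hcyc a b c
  simp only [Matrix.zero_apply]
  linarith

namespace IsKahlerOn

variable {U : Set Pt} {p : Pt} {J g : MatField}

theorem isMetricOn (hk : IsKahlerOn U J g) (hU : IsOpen U) : IsMetricOn U g where
  isOpen := hU
  smooth := hk.smooth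
  symm p hp := by simpa using (hk.posDef p hp).isHermitian.eq
  det p hp := (hk.posDef p hp).det_pos.ne'

theorem sq (hk : IsKahlerOn U J g) (hp : p ∈ U) : J p * J p = -1 := hk.complexStructure.sq p hp

theorem sq_transpose (hk : IsKahlerOn U J g) (hp : p ∈ U) : (J p)ᵀ * (J p)ᵀ = -1 := by
  rw [← Matrix.transpose_mul, hk.sq hp]; simp

theorem metric_mul_transpose (hk : IsKahlerOn U J g) (hp : p ∈ U) :
    g p * (J p)ᵀ = -(J p * g p) := by
  have h : J p * g p * (J p)ᵀ = g p := by
    ext a b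
    rw [← hk.hermitian p hp a b]
    simp only [Matrix.mul_apply, Finset.sum_mul, Matrix.transpose_apply]
    rw [Finset.sum_comm]
    exact Finset.sum_congr rfl fun c _ => Finset.sum_congr rfl fun d _ => by ring
  conv_rhs => rw [← h, ← Matrix.mul_assoc, ← Matrix.mul_assoc, hk.sq hp]
  simp

theorem kahlerForm_transpose (hk : IsKahlerOn U J g) (hU : IsOpen U) (hp : p ∈ U) :
    (kahlerForm J g p)ᵀ = -kahlerForm J g p := by
  rw [kahlerForm, Matrix.transpose_mul, (hk.isMetricOn hU).symm p hp, hk.metric_mul_transpose hp]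

theorem inv_mul_transpose (hk : IsKahlerOn U J g) (hU : IsOpen U) (hp : p ∈ U) :
    (J p)ᵀ * (g p)⁻¹ = -((g p)⁻¹ * J p) := by
  have hg := hk.isMetricOn hU
  have h : (J p)ᵀ * (g p)⁻¹ = (g p)⁻¹ * (g p * (J p)ᵀ) * (g p)⁻¹ := by
    rw [← Matrix.mul_assoc, hg.inv_mul hp, Matrix.one_mul]
  rw [h, hk.metric_mul_transpose hp, Matrix.mul_neg, Matrix.neg_mul, Matrix.mul_assoc,
    Matrix.mul_assoc, hg.mul_inv hp, Matrix.mul_one]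

/-- The covariant derivative of `J`. -/
def nablaJ (J g : MatField) (c : Fin 4) (p : Pt) : Matrix (Fin 4) (Fin 4) ℝ :=
  mpd c J p - (gam g c p)ᵀ * J p + J p * (gam g c p)ᵀ

/-- Covariant differentiation of `J² = -1`. -/
theorem mul_nablaJ (hk : IsKahlerOn U J g) (hU : IsOpen U) (hp : p ∈ U) (c : Fin 4) :
    J p * nablaJ J g c p = -(nablaJ J g c p * J p) := by
  have hs := hk.complexStructure.smooth
  have h := mpd_mul hU hs hs hp c
  rw [mpd_congr hU (fun q hq => hk.sq hq) hp, mpd_const] at h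
  have h2 : J p * nablaJ J g c p + nablaJ J g c p * J p = (mpd c J p * J p + J p * mpd c J p)
      - (gam g c p)ᵀ * (J p * J p) + J p * J p * (gam g c p)ᵀ := by
    rw [nablaJ]; noncomm_ring
  rw [← h, hk.sq hp] at h2
  rw [eq_neg_iff_add_eq_zero, h2]
  simp

theorem nablaJ_mul_metric (hk : IsKahlerOn U J g) (hU : IsOpen U) (hp : p ∈ U) (c : Fin 4) :
    nablaJ J g c p * g p = mpd c (kahlerForm J g) p - (gam g c p)ᵀ * kahlerForm J g p
      - kahlerForm J g p * gam g c p := by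
  have h : mpd c (kahlerForm J g) p = mpd c J p * g p + J p * mpd c g p :=
    mpd_mul hU hk.complexStructure.smooth hk.smooth hp c
  rw [h, (hk.isMetricOn hU).mpd_metric hp, nablaJ, kahlerForm]
  noncomm_ring

/-- The connection is torsion free, so partial derivatives in the Nijenhuis tensor may be replaced
by covariant ones: all Christoffel terms cancel in pairs. -/
theorem nijenhuis_eq (hk : IsKahlerOn U J g) (hU : IsOpen U) (hp : p ∈ U) (a b c : Fin 4) :
    nijenhuis J p a b c = ∑ d, J p a d * nablaJ J g d p b c - ∑ d, J p b d * nablaJ J g d p a c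
      - (nablaJ J g a p * J p) b c + (nablaJ J g b p * J p) a c := by
  have hg := hk.isMetricOn hU
  have h1 : nijenhuis J p a b c = ∑ d, J p a d * mpd d J p b c - ∑ d, J p b d * mpd d J p a c
      - (mpd a J p * J p) b c + (mpd b J p * J p) a c := by
    simp only [nijenhuis, Matrix.mul_apply, mpd_apply, ← Finset.sum_sub_distrib,
      ← Finset.sum_add_distrib]
    exact Finset.sum_congr rfl fun d _ => by ring
  have h2 : ∀ a b, ∑ d, J p a d * nablaJ J g d p b c = ∑ d, J p a d * mpd d J p b c
      - ∑ d, ∑ e, J p a d * christoffel g p e d b * J p e c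
      + ∑ d, ∑ e, J p a d * J p b e * christoffel g p c d e := fun a b => by
    simp only [nablaJ, Matrix.add_apply, Matrix.sub_apply, Matrix.mul_apply,
      Matrix.transpose_apply, gam_apply, mul_sub, mul_add, Finset.mul_sum,
      Finset.sum_add_distrib, Finset.sum_sub_distrib, mul_assoc]
  have h3 : ∀ a b, (nablaJ J g a p * J p) b c = (mpd a J p * J p) b c + christoffel g p c a b
      + ∑ d, ∑ e, J p b d * christoffel g p e a d * J p e c := fun a b => by
    have : nablaJ J g a p * J p = mpd a J p * J p - (gam g a p)ᵀ * (J p * J p)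
        + J p * (gam g a p)ᵀ * J p := by rw [nablaJ]; noncomm_ring
    rw [this, hk.sq hp]
    simp only [Matrix.add_apply, Matrix.mul_neg, Matrix.mul_one, sub_neg_eq_add]
    congr 1
    rw [Matrix.mul_assoc, Matrix.mul_apply]
    simp only [Matrix.mul_apply, Finset.mul_sum, Matrix.transpose_apply, gam_apply, mul_assoc]
  rw [h1, h2, h2, h3, h3]
  have h4 : ∑ d, ∑ e, J p a d * J p b e * christoffel g p c d e
      = ∑ d, ∑ e, J p b d * J p a e * christoffel g p c d e := by
    rw [Finset.sum_comm]
    exact Finset.sum_congr rfl fun d _ => Finset.sum_congr rfl fun e _ => by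
      rw [hg.christoffel_symm hp]; ring
  have h5 : ∀ a b, ∑ d, ∑ e, J p a d * christoffel g p e d b * J p e c
      = ∑ d, ∑ e, J p a d * christoffel g p e b d * J p e c := fun a b =>
    Finset.sum_congr rfl fun d _ => Finset.sum_congr rfl fun e _ => by
      rw [hg.christoffel_symm hp]
  rw [h4, h5 a b, h5 b a, hg.christoffel_symm hp c a b]
  ring

/-- The complex structure of a Kähler metric is parallel. -/
theorem nablaJ_eq_zero (hk : IsKahlerOn U J g) (hU : IsOpen U) (hp : p ∈ U) (c : Fin 4) :
    nablaJ J g c p = 0 := by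
  have hg := hk.isMetricOn hU
  have hw := hk.kahlerForm_transpose hU hp
  have hwa : ∀ a b, kahlerForm J g p a b = -kahlerForm J g p b a := fun a b =>
    congrFun (congrFun hw b) a
  have hJD : ∀ a, J p * (nablaJ J g a p * g p) = nablaJ J g a p * g p * (J p)ᵀ := fun a => by
    rw [← Matrix.mul_assoc, hk.mul_nablaJ hU hp, Matrix.mul_assoc _ (g p), hk.metric_mul_transpose hp]
    noncomm_ring
  have hmw : ∀ a, (mpd a (kahlerForm J g) p)ᵀ = -mpd a (kahlerForm J g) p := fun a => by
    rw [← mpd_transpose, mpd_congr hU (fun q hq => hk.kahlerForm_transpose hU hq) hp]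
    ext x y
    exact pd_neg a
  -- The algebraic lemma is applied to `D_a = ∇_a ω = (∇_a J) g`. Its cyclic sum is `dω`, and the
  -- remaining hypothesis is the Nijenhuis tensor with its upper index lowered.
  have hDz : ∀ a, nablaJ J g a p * g p = 0 := by
    refine eq_zero_of_closed_of_integrable (hk.sq hp) (fun a => ?_) hJD (fun a b c => ?_)
      fun a b c => ?_
    · rw [hk.nablaJ_mul_metric hU hp]
      simp only [Matrix.transpose_sub, Matrix.transpose_mul, hw, hmw, Matrix.transpose_transpose]
      noncomm_ring
    · have h1 : ∀ a b c, (nablaJ J g a p * g p) b c = pd a (fun q => kahlerForm J g q b c) p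
          - ∑ e, christoffel g p e a b * kahlerForm J g p e c
          + ∑ e, christoffel g p e a c * kahlerForm J g p e b := fun a b c => by
        rw [hk.nablaJ_mul_metric hU hp]
        simp only [Matrix.sub_apply, Matrix.mul_apply, mpd_apply, Matrix.transpose_apply,
          gam_apply]
        rw [sub_eq_add_neg, ← Finset.sum_neg_distrib]
        congr 1
        exact Finset.sum_congr rfl fun e _ => by rw [hwa b e]; ring
      have h2 : ∀ a b c, ∑ e, christoffel g p e a b * kahlerForm J g p e c
          = ∑ e, christoffel g p e b a * kahlerForm J g p e c := fun a b c =>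
        Finset.sum_congr rfl fun e _ => by rw [hg.christoffel_symm hp]
      rw [h1, h1, h1, h2 b a c, h2 c a b, h2 c b a]
      linarith [hk.closed p hp a b c]
    · have h1 : ∀ a b, ∑ d, J p a d * (nablaJ J g d p * g p) b c
          = ∑ e, (∑ d, J p a d * nablaJ J g d p b e) * g p e c := fun a b => by
        simp only [Matrix.mul_apply, Finset.mul_sum, Finset.sum_mul]
        rw [Finset.sum_comm]
        exact Finset.sum_congr rfl fun d _ => Finset.sum_congr rfl fun e _ => by ring
      have h2 : ∀ a b, (nablaJ J g a p * g p * (J p)ᵀ) b c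
          = ∑ e, -(nablaJ J g a p * J p) b e * g p e c := fun a b => by
        rw [Matrix.mul_assoc, hk.metric_mul_transpose hp, Matrix.mul_neg, ← Matrix.mul_assoc,
          Matrix.neg_apply, Matrix.mul_apply, ← Finset.sum_neg_distrib]
        exact Finset.sum_congr rfl fun e _ => by ring
      have h3 : ∑ e, nijenhuis J p a b e * g p e c = 0 := by
        simp [hk.complexStructure.integrable p hp]
      rw [h1, h1, h2, h2, ← h3]
      rw [← Finset.sum_sub_distrib, ← Finset.sum_add_distrib, ← Finset.sum_sub_distrib]
      exact Finset.sum_congr rfl fun e _ => by rw [hk.nijenhuis_eq hU hp]; ring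
  have h := congrArg (· * (g p)⁻¹) (hDz c)
  simpa [Matrix.mul_assoc, hg.mul_inv hp] using h

theorem mpd_J (hk : IsKahlerOn U J g) (hU : IsOpen U) (hp : p ∈ U) (c : Fin 4) :
    mpd c J p = (gam g c p)ᵀ * J p - J p * (gam g c p)ᵀ := by
  have h := hk.nablaJ_eq_zero hU hp c
  rw [nablaJ] at h
  rw [← sub_eq_zero, ← h]
  abel

theorem mpd_J_transpose (hk : IsKahlerOn U J g) (hU : IsOpen U) (hp : p ∈ U) (c : Fin 4) :
    mpd c (fun q => (J q)ᵀ) p = (J p)ᵀ * gam g c p - gam g c p * (J p)ᵀ := by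
  rw [mpd_transpose, hk.mpd_J hU hp]
  simp

/-- The curvature of a Kähler metric commutes with the complex structure. -/
theorem curv_comm (hk : IsKahlerOn U J g) (hU : IsOpen U) (hp : p ∈ U) (c d : Fin 4) :
    curv g c d p * (J p)ᵀ = (J p)ᵀ * curv g c d p := by
  have hg := hk.isMetricOn hU
  have hs : SmoothOn U fun q => (J q)ᵀ := hk.complexStructure.smooth.transpose
  -- Second derivatives of `J` are expanded with `∇J = 0`. Their symmetry is the integrability
  -- condition that `J` commutes with the curvature.
  have key : ∀ c d : Fin 4, mpd c (mpd d fun q => (J q)ᵀ) p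
      = ((J p)ᵀ * gam g c p - gam g c p * (J p)ᵀ) * gam g d p + (J p)ᵀ * mpd c (gam g d) p
        - (mpd c (gam g d) p * (J p)ᵀ
          + gam g d p * ((J p)ᵀ * gam g c p - gam g c p * (J p)ᵀ)) := by
    intro c d
    have hd := hg.smooth_gam d
    rw [mpd_congr hU (fun q hq => hk.mpd_J_transpose hU hq d) hp,
      mpd_sub hU (hs.mul hd) (hd.mul hs) hp, mpd_mul hU hs hd hp, mpd_mul hU hd hs hp,
      hk.mpd_J_transpose hU hp]
  have h := mpd_comm hU hs hp c d
  rw [key c d, key d c, ← sub_eq_zero] at h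
  rw [curv_eq, ← sub_eq_zero, ← neg_eq_zero, ← h]
  noncomm_ring

end IsKahlerOn

end Chart

end

/-! ### The Ricci form and the scalar curvature of a Kähler metric -/

noncomputable section

namespace Chart

open Matrix

/-- The Ricci tensor as a matrix. -/
def ricciMat (g : MatField) (p : Pt) : Matrix (Fin 4) (Fin 4) ℝ := Matrix.of fun b d => ricci g p b d

namespace IsKahlerOn

variable {U : Set Pt} {p : Pt} {J g : MatField}

theorem J_mul_lower_curv (hk : IsKahlerOn U J g) (hU : IsOpen U) (hp : p ∈ U) (c d : Fin 4) :
    J p * (g p * curv g c d p) = -(g p * curv g c d p * (J p)ᵀ) := by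
  rw [← Matrix.mul_assoc, ← neg_eq_iff_eq_neg.2 (hk.metric_mul_transpose hp).symm.symm,
    Matrix.neg_mul, Matrix.mul_assoc, ← hk.curv_comm hU hp, Matrix.mul_assoc]

theorem sum_J_riemann_left (hk : IsKahlerOn U J g) (hU : IsOpen U) (hp : p ∈ U)
    (a b c d : Fin 4) :
    ∑ e, J p a e * riemann g p e b c d = -∑ e, J p b e * riemann g p a e c d := by
  have h := congrFun (congrFun (hk.J_mul_lower_curv hU hp c d) a) b
  rw [Matrix.neg_apply, Matrix.mul_apply, Matrix.mul_apply] at h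
  simp only [IsMetricOn.riemann_eq, h, Matrix.transpose_apply, mul_comm (J p b _)]

theorem sum_J_riemann_right (hk : IsKahlerOn U J g) (hU : IsOpen U) (hp : p ∈ U)
    (a b c d : Fin 4) :
    ∑ e, J p c e * riemann g p a b e d = -∑ e, J p d e * riemann g p a b c e := by
  have hg := hk.isMetricOn hU
  have h := hk.sum_J_riemann_left hU hp c d a b
  simpa only [hg.riemann_pair_symm hp _ _ a b] using h

/-- The Ricci tensor is `J`-invariant: `J` moves between the two slots of a curvature pair with a
sign, and passes through the contraction because `g⁻¹ J` is antisymmetric. -/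
theorem J_mul_ricci (hk : IsKahlerOn U J g) (hU : IsOpen U) (hp : p ∈ U) :
    J p * ricciMat g p = -(ricciMat g p * (J p)ᵀ) := by
  have hg := hk.isMetricOn hU
  have hO : ∀ c e, ∑ a, (g p)⁻¹ c a * J p a e = -∑ a, (g p)⁻¹ e a * J p a c := fun c e => by
    have h := congrFun (congrFun (hk.inv_mul_transpose hU hp) e) c
    rw [Matrix.neg_apply, Matrix.mul_apply, Matrix.mul_apply] at h
    rw [← h]
    exact Finset.sum_congr rfl fun a _ => by
      rw [Matrix.transpose_apply, hg.inv_symm_apply hp, mul_comm]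
  have h1 : ∀ b d, (J p * ricciMat g p) b d
      = -∑ c, ∑ e, (∑ a, (g p)⁻¹ c a * J p a e) * riemann g p e b c d := fun b d => by
    have h2 : ∀ a c, ∑ e, J p b e * riemann g p a e c d = -∑ e, J p a e * riemann g p e b c d :=
      fun a c => by rw [hk.sum_J_riemann_left hU hp, neg_neg]
    have h3 : (J p * ricciMat g p) b d
        = ∑ a, ∑ c, (g p)⁻¹ a c * ∑ e, J p b e * riemann g p a e c d := by
      simp only [Matrix.mul_apply, ricciMat, Matrix.of_apply, hg.ricci_eq hp, Finset.mul_sum]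
      rw [Finset.sum_comm]
      refine Finset.sum_congr rfl fun a _ => ?_
      rw [Finset.sum_comm]
      exact Finset.sum_congr rfl fun c _ => Finset.sum_congr rfl fun e _ => by ring
    rw [h3]
    simp only [h2, Finset.mul_sum, Finset.sum_mul, ← Finset.sum_neg_distrib]
    rw [Finset.sum_comm]
    refine Finset.sum_congr rfl fun c _ => ?_
    rw [Finset.sum_comm]
    exact Finset.sum_congr rfl fun e _ => Finset.sum_congr rfl fun a _ => by
      rw [hg.inv_symm_apply hp]; ring
  have h4 : ∀ b d, (ricciMat g p * (J p)ᵀ) b d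
      = -∑ c, ∑ e, (∑ a, (g p)⁻¹ c a * J p a e) * riemann g p c b e d := fun b d => by
    have h2 : ∀ a c, ∑ e, J p d e * riemann g p a b c e = -∑ e, J p c e * riemann g p a b e d :=
      fun a c => by rw [hk.sum_J_riemann_right hU hp, neg_neg]
    have h3 : (ricciMat g p * (J p)ᵀ) b d
        = ∑ a, ∑ c, (g p)⁻¹ a c * ∑ e, J p d e * riemann g p a b c e := by
      simp only [Matrix.mul_apply, ricciMat, Matrix.of_apply, hg.ricci_eq hp, Finset.mul_sum,
        Finset.sum_mul]
      rw [Finset.sum_comm]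
      refine Finset.sum_congr rfl fun a _ => ?_
      rw [Finset.sum_comm]
      exact Finset.sum_congr rfl fun c _ => Finset.sum_congr rfl fun e _ => by
        rw [Matrix.transpose_apply]; ring
    rw [h3]
    simp only [h2, Finset.mul_sum, Finset.sum_mul, ← Finset.sum_neg_distrib]
    refine Finset.sum_congr rfl fun c _ => ?_
    rw [Finset.sum_comm]
    exact Finset.sum_congr rfl fun e _ => Finset.sum_congr rfl fun a _ => by ring
  ext b d
  rw [Matrix.neg_apply, h1, h4, neg_neg, Finset.sum_comm, ← Finset.sum_neg_distrib]
  refine Finset.sum_congr rfl fun c _ => ?_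
  rw [← Finset.sum_neg_distrib]
  exact Finset.sum_congr rfl fun e _ => by rw [hO c e]; ring

theorem ricciMat_transpose (hg : IsMetricOn U g) (hp : p ∈ U) :
    (ricciMat g p)ᵀ = ricciMat g p := by
  ext b d
  exact hg.ricci_symm hp d b

/-- The contraction of the curvature with `J` in the first two slots is twice the Ricci form. -/
theorem trace_J_curv (hk : IsKahlerOn U J g) (hU : IsOpen U) (hp : p ∈ U) (c d : Fin 4) :
    ((J p)ᵀ * curv g c d p).trace = 2 * (J p * ricciMat g p) c d := by
  have hg := hk.isMetricOn hU
  -- The first Bianchi identity trades the trace over the endomorphism slots for two traces that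
  -- pair an endomorphism slot with a form slot. In each of those `J` is commuted past the
  -- curvature, leaving a Ricci contraction.
  have h1 : ((J p)ᵀ * curv g c d p).trace
      = -∑ b, ((J p)ᵀ * curv g d b p) b c - ∑ b, ((J p)ᵀ * curv g b c p) b d := by
    simp only [Matrix.trace, Matrix.diag, Matrix.mul_apply, curv_apply, ← Finset.sum_sub_distrib,
      ← Finset.sum_neg_distrib]
    refine Finset.sum_congr rfl fun b _ => Finset.sum_congr rfl fun a _ => ?_
    linear_combination (J p)ᵀ b a * hg.riemannUp_bianchi hp a b c d
  have h2 : ∀ c d, ∑ b, ((J p)ᵀ * curv g b c p) b d = (J p * ricciMat g p) d c := fun c d => by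
    have hcomm : ∀ b, (J p)ᵀ * curv g b c p = curv g b c p * (J p)ᵀ :=
      fun b => (hk.curv_comm hU hp b c).symm
    simp only [hcomm]
    simp only [Matrix.mul_apply, curv_apply, ricciMat, Matrix.of_apply, ricci,
      Matrix.transpose_apply, Finset.mul_sum]
    rw [Finset.sum_comm]
    exact Finset.sum_congr rfl fun e _ => Finset.sum_congr rfl fun b _ => by ring
  have h3 : ∑ b, ((J p)ᵀ * curv g d b p) b c = -∑ b, ((J p)ᵀ * curv g b d p) b c := by
    simp only [Matrix.mul_apply, curv_apply, ← Finset.sum_neg_distrib]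
    exact Finset.sum_congr rfl fun e _ => Finset.sum_congr rfl fun b _ => by
      rw [IsMetricOn.riemannUp_antisymm]; ring
  have h4 : (J p * ricciMat g p) d c = -(J p * ricciMat g p) c d := by
    have : (J p * ricciMat g p)ᵀ = -(J p * ricciMat g p) := by
      rw [Matrix.transpose_mul, ricciMat_transpose hg hp, hk.J_mul_ricci hU hp, neg_neg]
    exact congrFun (congrFun this c) d
  rw [h1, h3, h2, h2, h4]
  ring

/-- Contracting the Ricci form with `g⁻¹ J` undoes its factor `J`, by `J² = -1`, and returns the
trace of the Ricci tensor. -/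
theorem scal_eq_trace (hk : IsKahlerOn U J g) (hU : IsOpen U) (hp : p ∈ U) :
    scal g p = -(1 / 2) * ∑ d, ∑ c, ((g p)⁻¹ * J p) d c * ((J p)ᵀ * curv g c d p).trace := by
  have hg := hk.isMetricOn hU
  have h : ∑ d, ∑ c, ((g p)⁻¹ * J p) d c * ((J p)ᵀ * curv g c d p).trace
      = 2 * ((g p)⁻¹ * J p * (J p * ricciMat g p)).trace := by
    simp only [hk.trace_J_curv hU hp]
    simp only [Matrix.trace, Matrix.diag]
    rw [Finset.mul_sum]
    refine Finset.sum_congr rfl fun d _ => ?_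
    rw [Matrix.mul_apply, Finset.mul_sum]
    exact Finset.sum_congr rfl fun c _ => by ring
  have h2 : (g p)⁻¹ * J p * (J p * ricciMat g p) = -((g p)⁻¹ * ricciMat g p) := by
    rw [Matrix.mul_assoc, ← Matrix.mul_assoc (J p), hk.sq hp]
    simp
  rw [h, h2, Matrix.trace_neg, scal]
  simp only [Matrix.trace, Matrix.diag, Matrix.mul_apply]
  rw [mul_neg, mul_neg, neg_mul, neg_neg, ← mul_assoc]
  norm_num
  exact Finset.sum_congr rfl fun b _ => Finset.sum_congr rfl fun d _ => by
    rw [ricciMat, Matrix.of_apply, hg.ricci_symm hp]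

/-- The trace of `J` against the connection matrices. -/
def traceJGam (J g : MatField) (d : Fin 4) (p : Pt) : ℝ := ((J p)ᵀ * gam g d p).trace

theorem pd_trace (hU : IsOpen U) {M : MatField} (hM : SmoothOn U M) (hp : p ∈ U) (c : Fin 4) :
    pd c (fun q => (M q).trace) p = (mpd c M p).trace := by
  simp only [Matrix.trace, Matrix.diag]
  exact pd_sum _ _ fun a _ => hM.differentiableAt hU hp a a

theorem pd_traceJGam (hk : IsKahlerOn U J g) (hU : IsOpen U) (hp : p ∈ U) (c d : Fin 4) :
    pd c (traceJGam J g d) p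
      = (((J p)ᵀ * gam g c p - gam g c p * (J p)ᵀ) * gam g d p + (J p)ᵀ * mpd c (gam g d) p).trace := by
  have hg := hk.isMetricOn hU
  have hs : SmoothOn U fun q => (J q)ᵀ := hk.complexStructure.smooth.transpose
  unfold traceJGam
  rw [pd_trace hU (hs.mul (hg.smooth_gam d)) hp, mpd_mul hU hs (hg.smooth_gam d) hp,
    hk.mpd_J_transpose hU hp]

/-- In a real coordinate frame `tr (J R)` and the exterior derivative of `tr (J Γ)` differ by `tr (J
[Γ_c, Γ_d])`. If `J` is constant along one of the two directions it commutes with that connection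
matrix, and cyclicity of the trace removes this term. -/
theorem trace_J_curv_eq_pd (hk : IsKahlerOn U J g) (hU : IsOpen U) (hp : p ∈ U) (c d : Fin 4)
    (hd : mpd c J p = 0 ∨ mpd d J p = 0) : ((J p)ᵀ * curv g c d p).trace
      = pd c (traceJGam J g d) p - pd d (traceJGam J g c) p := by
  rw [hk.pd_traceJGam hU hp, hk.pd_traceJGam hU hp, curv_eq]
  have hz : ∀ d, mpd d J p = 0 → (J p)ᵀ * gam g d p = gam g d p * (J p)ᵀ := fun d h => by
    rw [← sub_eq_zero, ← hk.mpd_J_transpose hU hp, mpd_transpose, h, Matrix.transpose_zero]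
  have hd' : (J p)ᵀ * gam g c p = gam g c p * (J p)ᵀ ∨ (J p)ᵀ * gam g d p = gam g d p * (J p)ᵀ :=
    hd.imp (hz c) (hz d)
  clear hz hd
  generalize (J p)ᵀ = j at *
  generalize gam g c p = A at *
  generalize gam g d p = B at *
  have h2 : (A * j * B).trace = (j * B * A).trace := by
    rw [Matrix.mul_assoc, Matrix.trace_mul_comm]
  have h3 : (B * j * A).trace = (j * A * B).trace := by
    rw [Matrix.mul_assoc, Matrix.trace_mul_comm]
  have hτ : (j * A * B).trace = (j * B * A).trace := by
    rcases hd' with h | h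
    · rw [h, h2]
    · rw [h, h3]
  simp only [Matrix.mul_add, Matrix.mul_sub, Matrix.sub_mul, Matrix.trace_add, Matrix.trace_sub,
    ← Matrix.mul_assoc, h2, h3, hτ]
  ring

/-- `tr (J Γ_d)` is the divergence of `J ∂_d`. -/
theorem traceJGam_eq (hk : IsKahlerOn U J g) (hU : IsOpen U) {v : Pt → ℝ}
    (hv : ContDiffOn ℝ ∞ v U) (hvdet : ∀ q ∈ U, (g q).det = v q ^ 2) (hp : p ∈ U) (d : Fin 4) :
    v p * traceJGam J g d p = ∑ c, pd c (fun q => v q * J q d c) p := by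
  have hg := hk.isMetricOn hU
  have h1 : ∀ c, pd c (fun q => v q * J q d c) p = pd c v p * J p d c + v p * mpd c J p d c :=
    fun c => pd_mul c (differentiableAt_of_contDiffOn hU hv hp)
      (hk.complexStructure.smooth.differentiableAt hU hp d c)
  have h2 : ∑ c, mpd c J p d c = traceJGam J g d p - ∑ e, J p d e * (gam g e p).trace := by
    simp only [hk.mpd_J hU hp, Matrix.sub_apply, Finset.sum_sub_distrib, Matrix.mul_apply,
      traceJGam, Matrix.trace, Matrix.diag, Matrix.transpose_apply, Finset.mul_sum, gam_apply]
    congr 1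
    · refine Finset.sum_congr rfl fun c _ => Finset.sum_congr rfl fun e _ => ?_
      rw [hg.christoffel_symm hp]; ring
    · rw [Finset.sum_comm]
      refine Finset.sum_congr rfl fun c _ => Finset.sum_congr rfl fun e _ => ?_
      rw [hg.christoffel_symm hp]
  simp only [h1, Finset.sum_add_distrib, ← Finset.mul_sum, h2,
    ← hg.mul_trace_gam hv hvdet hp, mul_sub, mul_assoc]
  have h3 : ∑ c, (gam g c p).trace * J p d c = ∑ e, J p d e * (gam g e p).trace :=
    Finset.sum_congr rfl fun c _ => mul_comm _ _
  rw [h3]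
  ring

/-- If the divergence of `J ∂_d` is `η (J ∂_d)` for all `d`, then the scalar curvature is minus the
divergence of the vector field dual to `η`. -/
theorem mul_scal_eq (hk : IsKahlerOn U J g) (hU : IsOpen U) {v : Pt → ℝ} {η : Fin 4 → Pt → ℝ}
    (hv : ContDiffOn ℝ ∞ v U) (hvdet : ∀ q ∈ U, (g q).det = v q ^ 2)
    (hη : ∀ b, ContDiffOn ℝ ∞ (η b) U)
    (hdiv : ∀ q ∈ U, ∀ d, ∑ c, pd c (fun r => v r * J r d c) q = v q * ∑ b, J q d b * η b q)
    (hinv : ∀ q ∈ U, ∀ c d, ((g q)⁻¹ * J q) d c ≠ 0 → mpd c J q = 0 ∨ mpd d J q = 0)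
    (hp : p ∈ U) :
    v p * scal g p = -∑ c, pd c (fun q => ∑ b, v q * (g q)⁻¹ c b * η b q) p := by
  have hg := hk.isMetricOn hU
  have hv0 : ∀ q ∈ U, v q ≠ 0 := fun q hq h => hg.det q hq (by rw [hvdet q hq, h]; ring)
  have hT : ∀ q ∈ U, ∀ d, traceJGam J g d q = ∑ b, J q d b * η b q := fun q hq d => by
    have h := hk.traceJGam_eq hU hv hvdet hq d
    rw [hdiv q hq d] at h
    exact mul_left_cancel₀ (hv0 q hq) h
  have hηd := fun b => differentiableAt_of_contDiffOn hU (hη b) hp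
  have hJd := fun a b => hk.complexStructure.smooth.differentiableAt hU hp a b
  have hpdT : ∀ c d, pd c (traceJGam J g d) p
      = ∑ b, (mpd c J p d b * η b p + J p d b * pd c (η b) p) := fun c d => by
    rw [pd_congr hU (fun q hq => hT q hq d) hp, pd_sum _ _ fun b _ => (hJd d b).fun_mul (hηd b)]
    exact Finset.sum_congr rfl fun b _ => pd_mul c (hJd d b) (hηd b)
  set O := (g p)⁻¹ * J p with hO
  have hOt : ∀ c d, O c d = -O d c := fun c d => by
    have h := congrFun (congrFun (hk.inv_mul_transpose hU hp) c) d
    have h' : (J p)ᵀ * (g p)⁻¹ = Oᵀ := by rw [hO, Matrix.transpose_mul, hg.inv_transpose hp]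
    rw [h', Matrix.transpose_apply, Matrix.neg_apply, ← hO] at h
    linarith
  -- Pairs `c, d` for which the derivative formula for `tr (J R)` could fail carry a zero
  -- coefficient `O d c`, by `hinv`. Antisymmetry of `O` merges the two derivative terms and absorbs
  -- the factor `1/2`.
  have hscal : scal g p = -∑ d, ∑ c, O d c * pd c (traceJGam J g d) p := by
    rw [hk.scal_eq_trace hU hp, ← hO]
    have h1 : ∀ d c, O d c * ((J p)ᵀ * curv g c d p).trace
        = O d c * pd c (traceJGam J g d) p + O c d * pd d (traceJGam J g c) p := fun d c => by
      by_cases h : O d c = 0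
      · rw [hOt c d, h]; ring
      · rw [hk.trace_J_curv_eq_pd hU hp c d (hinv p hp c d h), hOt c d]; ring
    simp only [h1, Finset.sum_add_distrib]
    rw [Finset.sum_comm (f := fun d c => O c d * pd d (traceJGam J g c) p)]
    ring
  have hOJ : (Oᵀ * J p) = (g p)⁻¹ := by
    have : Oᵀ = -O := by ext c d; exact hOt d c
    rw [this, hO, Matrix.neg_mul, Matrix.mul_assoc, hk.sq hp]; simp
  have hA : ∑ d, ∑ c, O d c * ∑ b, J p d b * pd c (η b) p
      = ∑ c, ∑ b, (g p)⁻¹ c b * pd c (η b) p := by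
    simp only [← hOJ, Matrix.mul_apply, Finset.mul_sum, Finset.sum_mul, Matrix.transpose_apply]
    rw [Finset.sum_comm]
    refine Finset.sum_congr rfl fun c _ => ?_
    rw [Finset.sum_comm]
    exact Finset.sum_congr rfl fun b _ => Finset.sum_congr rfl fun d _ => by ring
  -- Of the two terms of `∂J = Γᵀ J - J Γᵀ`, the first dies because `O` is antisymmetric while the
  -- Christoffel symbols are symmetric; in the second, `Oᵀ J = g⁻¹`.
  have hB : ∀ b, ∑ d, ∑ c, O d c * mpd c J p d b = -∑ c, ((g p)⁻¹ * (gam g c p)ᵀ) c b := by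
    intro b
    have h1 : ∑ d, ∑ c, O d c * ((gam g c p)ᵀ * J p) d b = 0 := by
      have h : ∑ d, ∑ c, O d c * ((gam g c p)ᵀ * J p) d b
          = -∑ d, ∑ c, O d c * ((gam g c p)ᵀ * J p) d b := by
        conv_lhs => rw [Finset.sum_comm]
        rw [← Finset.sum_neg_distrib]
        refine Finset.sum_congr rfl fun d _ => ?_
        rw [← Finset.sum_neg_distrib]
        refine Finset.sum_congr rfl fun c _ => ?_
        rw [hOt c d, neg_mul]
        simp only [Matrix.mul_apply, Matrix.transpose_apply, gam_apply]
        congr 2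
        exact Finset.sum_congr rfl fun e _ => by rw [hg.christoffel_symm hp]
      linarith
    have h2 : ∑ d, ∑ c, O d c * (J p * (gam g c p)ᵀ) d b
        = ∑ c, ((g p)⁻¹ * (gam g c p)ᵀ) c b := by
      rw [Finset.sum_comm]
      refine Finset.sum_congr rfl fun c _ => ?_
      rw [← hOJ, Matrix.mul_assoc Oᵀ, Matrix.mul_apply]
      rfl
    simp only [hk.mpd_J hU hp, Matrix.sub_apply, mul_sub, Finset.sum_sub_distrib, h1, h2]
    ring
  have hS : scal g p = ∑ b, (∑ c, ((g p)⁻¹ * (gam g c p)ᵀ) c b) * η b p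
      - ∑ c, ∑ b, (g p)⁻¹ c b * pd c (η b) p := by
    have h3 : ∑ d, ∑ c, O d c * ∑ b, mpd c J p d b * η b p
        = ∑ b, (∑ d, ∑ c, O d c * mpd c J p d b) * η b p := by
      simp only [Finset.mul_sum, Finset.sum_mul]
      rw [Finset.sum_comm' (t' := Finset.univ) (s' := fun _ => Finset.univ) (by simp)]
      rw [Finset.sum_comm]
      conv_rhs => rw [Finset.sum_comm]
      refine Finset.sum_congr rfl fun d _ => ?_
      rw [Finset.sum_comm]
      exact Finset.sum_congr rfl fun b _ => Finset.sum_congr rfl fun c _ => by ring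
    rw [hscal]
    simp only [hpdT, Finset.sum_add_distrib, mul_add]
    rw [hA, h3]
    simp only [hB, neg_mul, Finset.sum_neg_distrib]
    ring
  have hvd := differentiableAt_of_contDiffOn hU hv hp
  have hid := fun a b => hg.smooth_inv.differentiableAt hU hp a b
  have hR : ∀ c b, pd c (fun q => v q * (g q)⁻¹ c b * η b q) p
      = v p * ((gam g c p).trace * (g p)⁻¹ c b * η b p
        + mpd c (fun q => (g q)⁻¹) p c b * η b p + (g p)⁻¹ c b * pd c (η b) p) := fun c b => by
    rw [pd_mul c (hvd.fun_mul (hid c b)) (hηd b), pd_mul c hvd (hid c b),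
      ← hg.mul_trace_gam hv hvdet hp, mpd_apply]
    ring
  have hR' : ∀ c, pd c (fun q => ∑ b, v q * (g q)⁻¹ c b * η b q) p
      = ∑ b, pd c (fun q => v q * (g q)⁻¹ c b * η b q) p := fun c =>
    pd_sum _ _ fun b _ => (hvd.fun_mul (hid c b)).fun_mul (hηd b)
  have hG : ∀ b, ∑ c, (gam g c p * (g p)⁻¹) c b = ∑ c, (gam g c p).trace * (g p)⁻¹ c b := fun b => by
    simp only [Matrix.mul_apply, Matrix.trace, Matrix.diag, Finset.sum_mul, gam_apply]
    rw [Finset.sum_comm]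
    exact Finset.sum_congr rfl fun c _ => Finset.sum_congr rfl fun e _ => by
      rw [hg.christoffel_symm hp]
  -- The divergence of the density `v g⁻¹`: the trace of `Γ` cancels one of the two terms in the
  -- derivative of `g⁻¹`, and the other matches the Christoffel term in `hS`.
  have hfin : ∑ c, ∑ b, ((gam g c p).trace * (g p)⁻¹ c b * η b p
        + mpd c (fun q => (g q)⁻¹) p c b * η b p)
      = -∑ b, (∑ c, ((g p)⁻¹ * (gam g c p)ᵀ) c b) * η b p := by
    rw [Finset.sum_comm, ← Finset.sum_neg_distrib]
    refine Finset.sum_congr rfl fun b _ => ?_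
    simp only [hg.mpd_inv hp, Matrix.sub_apply, Matrix.neg_apply, ← add_mul]
    rw [← Finset.sum_mul, Finset.sum_add_distrib, ← hG, Finset.sum_sub_distrib,
      Finset.sum_neg_distrib]
    ring
  simp only [hR', hR, ← Finset.mul_sum]
  rw [hS, ← mul_neg]
  congr 1
  simp only [Finset.sum_add_distrib] at hfin ⊢
  linarith
end IsKahlerOn

end Chart

end

noncomputable section

namespace Chart

open Matrix

/-! ### Alternating tensors in dimension four -/

/-- A totally antisymmetric tensor in dimension four is determined by one component. -/
theorem eq_zero_of_alternating {T : Fin 4 → Fin 4 → Fin 4 → Fin 4 → ℝ}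
    (h1 : ∀ a b c d, T a b c d = -T b a c d) (h2 : ∀ a b c d, T a b c d = -T a c b d)
    (h3 : ∀ a b c d, T a b c d = -T a b d c) (h0 : T 0 1 2 3 = 0) (a b c d : Fin 4) :
    T a b c d = 0 := by
  have z1 : ∀ a c d, T a a c d = 0 := fun a c d => by linarith [h1 a a c d]
  have z2 : ∀ a b d, T a b b d = 0 := fun a b d => by linarith [h2 a b b d]
  have z3 : ∀ a b c, T a b c c = 0 := fun a b c => by linarith [h3 a b c c]
  have z4 : ∀ a b d, T a b a d = 0 := fun a b d => by rw [h2, z1, neg_zero]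
  have z5 : ∀ a b c, T a b c b = 0 := fun a b c => by rw [h3, z2, neg_zero]
  have z6 : ∀ a b c, T a b c a = 0 := fun a b c => by rw [h3, z4, neg_zero]
  have A1 : ∀ c d, T 0 1 c d = 0 := fun c d => by
    have : ∀ c d : Fin 4, 0 = c ∨ 1 = c ∨ 0 = d ∨ 1 = d ∨ c = d ∨ (c = 2 ∧ d = 3)
      ∨ (c = 3 ∧ d = 2) := by decide
    rcases this c d with h | h | h | h | h | ⟨h, h'⟩ | ⟨h, h'⟩ <;> subst h
    · exact z4 _ _ _
    · exact z2 _ _ _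
    · exact z6 _ _ _
    · exact z5 _ _ _
    · exact z3 _ _ _
    · rw [h', h0]
    · rw [h', h3, h0, neg_zero]
  have A2 : ∀ b d, T 0 b 1 d = 0 := fun b d => by rw [h2, A1, neg_zero]
  have A3 : ∀ b c, T 0 b c 1 = 0 := fun b c => by rw [h3, A2, neg_zero]
  have B1 : ∀ b c d, T 0 b c d = 0 := fun b c d => by
    have : ∀ b c d : Fin 4, 1 = b ∨ 1 = c ∨ 1 = d ∨ 0 = b ∨ 0 = c ∨ 0 = d ∨ b = c ∨ b = d ∨ c = d := by
      decide
    rcases this b c d with h | h | h | h | h | h | h | h | h <;> subst h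
    exacts [A1 _ _, A2 _ _, A3 _ _, z1 _ _ _, z4 _ _ _, z6 _ _ _, z2 _ _ _, z5 _ _ _, z3 _ _ _]
  have B2 : ∀ a c d, T a 0 c d = 0 := fun a c d => by rw [h1, B1, neg_zero]
  have B3 : ∀ a b d, T a b 0 d = 0 := fun a c d => by rw [h2, B2, neg_zero]
  have B4 : ∀ a b c, T a b c 0 = 0 := fun a c d => by rw [h3, B3, neg_zero]
  have : ∀ a b c d : Fin 4, 0 = a ∨ 0 = b ∨ 0 = c ∨ 0 = d ∨ a = b ∨ a = c ∨ a = d ∨ b = c ∨ b = d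
    ∨ c = d := by decide
  rcases this a b c d with h | h | h | h | h | h | h | h | h | h <;> subst h
  exacts [B1 _ _ _, B2 _ _ _, B3 _ _ _, B4 _ _ _, z1 _ _ _, z4 _ _ _, z6 _ _ _, z2 _ _ _, z5 _ _ _,
    z3 _ _ _]

theorem leviCivita_self : leviCivita 0 1 2 3 = 1 := by
  have : (Matrix.of fun i j : Fin 4 => if ![(0 : Fin 4), 1, 2, 3] i = j then (1 : ℝ) else 0) = 1 := by
    ext i j
    have : ![(0 : Fin 4), 1, 2, 3] i = i := by fin_cases i <;> rfl
    simp only [Matrix.of_apply, this, Matrix.one_apply]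
  rw [leviCivita, this, Matrix.det_one]

theorem leviCivita_comp (a b c d : Fin 4) (σ : Equiv.Perm (Fin 4)) :
    leviCivita (![a, b, c, d] (σ 0)) (![a, b, c, d] (σ 1)) (![a, b, c, d] (σ 2))
      (![a, b, c, d] (σ 3)) = Equiv.Perm.sign σ * leviCivita a b c d := by
  rw [leviCivita, leviCivita, ← Matrix.det_permute]
  congr 1
  ext i j
  simp only [Matrix.of_apply, Matrix.submatrix_apply, id]
  fin_cases i <;> rfl

theorem leviCivita_swap₁ (a b c d : Fin 4) : leviCivita a b c d = -leviCivita b a c d := by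
  have h := leviCivita_comp a b c d (Equiv.swap 0 1)
  rw [Equiv.Perm.sign_swap (by decide)] at h
  have h' : leviCivita b a c d = _ := h
  rw [h']; simp

theorem leviCivita_swap₂ (a b c d : Fin 4) : leviCivita a b c d = -leviCivita a c b d := by
  have h := leviCivita_comp a b c d (Equiv.swap 1 2)
  rw [Equiv.Perm.sign_swap (by decide)] at h
  have h' : leviCivita a c b d = _ := h
  rw [h']; simp

theorem leviCivita_swap₃ (a b c d : Fin 4) : leviCivita a b c d = -leviCivita a b d c := by
  have h := leviCivita_comp a b c d (Equiv.swap 2 3)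
  rw [Equiv.Perm.sign_swap (by decide)] at h
  have h' : leviCivita a b d c = _ := h
  rw [h']; simp

/-- The Pfaffian of an antisymmetric matrix. -/
def pfaffian (w : Matrix (Fin 4) (Fin 4) ℝ) : ℝ := w 0 1 * w 2 3 - w 0 2 * w 1 3 + w 0 3 * w 1 2

/-- This is the Pfaffian as the coefficient of `w ∧ w / 2`. Both sides are alternating, so one
component decides. -/
theorem pfaffian_mul_leviCivita {w : Matrix (Fin 4) (Fin 4) ℝ} (hw : ∀ a b, w a b = -w b a)
    (a b c d : Fin 4) : pfaffian w * leviCivita a b c d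
      = w a b * w c d - w a c * w b d + w a d * w b c := by
  rw [← sub_eq_zero]
  refine eq_zero_of_alternating (T := fun a b c d => pfaffian w * leviCivita a b c d
    - (w a b * w c d - w a c * w b d + w a d * w b c)) (fun a b c d => ?_) (fun a b c d => ?_)
    (fun a b c d => ?_) ?_ a b c d
  · rw [leviCivita_swap₁, hw a b]; ring
  · rw [leviCivita_swap₂, hw b c]; ring
  · rw [leviCivita_swap₃, hw c d]; ring
  · rw [leviCivita_self, pfaffian]; ring

/-- A 2-form with vanishing `w`-trace is orthogonal to `w` for the wedge product. -/
theorem wedge_eq_zero {w r O : Matrix (Fin 4) (Fin 4) ℝ} (hw : ∀ a b, w a b = -w b a)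
    (hr : ∀ a b, r a b = -r b a) (hO : O * w = -1) (htr : (O * r).trace = 0) (a b c d : Fin 4) :
    w a b * r c d + w c d * r a b - w a c * r b d - w b d * r a c + w a d * r b c + w b c * r a d
      = 0 := by
  refine eq_zero_of_alternating (T := fun a b c d => w a b * r c d + w c d * r a b - w a c * r b d
    - w b d * r a c + w a d * r b c + w b c * r a d) (fun a b c d => ?_) (fun a b c d => ?_)
    (fun a b c d => ?_) ?_ a b c d
  · linear_combination r c d * hw a b + w c d * hr a b
  · linear_combination r a d * hw c b + w a d * hr c b
  · linear_combination r a b * hw c d + w a b * hr c d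
  have w00 : ∀ a, w a a = 0 := fun a => by linarith [hw a a]
  have r00 : ∀ a, r a a = 0 := fun a => by linarith [hr a a]
  -- The Pfaffian adjugate of `w`: the product `w s` is minus the Pfaffian times the identity, so
  -- `s` is the Pfaffian times `O`. The trace of `s r` is, up to a factor, the `0123` component of
  -- `w ∧ r`.
  set s : Matrix (Fin 4) (Fin 4) ℝ := !![0, w 2 3, -w 1 3, w 1 2; -w 2 3, 0, w 0 3, -w 0 2;
    w 1 3, -w 0 3, 0, w 0 1; -w 1 2, w 0 2, -w 0 1, 0] with hs
  have hws : w * s = -pfaffian w • (1 : Matrix (Fin 4) (Fin 4) ℝ) := by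
    ext i j
    fin_cases i <;> fin_cases j <;>
    simp [Matrix.mul_apply, Fin.sum_univ_four, hs, pfaffian, w00, hw 1 0, hw 2 0, hw 3 0, hw 2 1,
      hw 3 1, hw 3 2, mul_comm] <;> ring
  have hOs : pfaffian w • O = s := by
    have h : O * (w * s) = -s := by rw [← Matrix.mul_assoc, hO]; simp
    rw [hws] at h
    simpa using h
  have h : (s * r).trace = 0 := by rw [← hOs, Matrix.smul_mul, Matrix.trace_smul, htr, smul_zero]
  simp only [Matrix.trace, Matrix.diag, Matrix.mul_apply, Fin.sum_univ_four] at h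
  simp [hs, r00, hr 1 0, hr 2 0, hr 3 0, hr 2 1,
      hr 3 1, hr 3 2] at h
  linarith

/-! ### Raising indices of 4-tensors -/

section Contractions

variable (h A B : Matrix (Fin 4) (Fin 4) ℝ) (a b c d : Fin 4)

theorem mul_mul_transpose_apply : (h * A * hᵀ) a b = ∑ a', ∑ b', h a a' * h b b' * A a' b' := by
  simp only [Matrix.mul_apply, Finset.sum_mul, Matrix.transpose_apply]
  rw [Finset.sum_comm]
  exact Finset.sum_congr rfl fun a' _ => Finset.sum_congr rfl fun b' _ => by ring

theorem raise_prod₁ : ∑ a', ∑ b', ∑ c', ∑ d', h a a' * h b b' * h c c' * h d d'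
    * (A a' b' * B c' d') = (h * A * hᵀ) a b * (h * B * hᵀ) c d := by
  simp only [mul_mul_transpose_apply]
  rw [Finset.sum_mul]
  refine Finset.sum_congr rfl fun a' _ => ?_
  rw [Finset.sum_mul]
  refine Finset.sum_congr rfl fun b' _ => ?_
  simp only [Finset.mul_sum]
  exact Finset.sum_congr rfl fun c' _ => Finset.sum_congr rfl fun d' _ => by ring

theorem raise_prod₂ : ∑ a', ∑ b', ∑ c', ∑ d', h a a' * h b b' * h c c' * h d d'
    * (A a' c' * B b' d') = (h * A * hᵀ) a c * (h * B * hᵀ) b d := by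
  rw [← raise_prod₁]
  refine Finset.sum_congr rfl fun a' _ => ?_
  rw [Finset.sum_comm]
  exact Finset.sum_congr rfl fun b' _ => Finset.sum_congr rfl fun c' _ =>
    Finset.sum_congr rfl fun d' _ => by ring

theorem raise_prod₃ : ∑ a', ∑ b', ∑ c', ∑ d', h a a' * h b b' * h c c' * h d d'
    * (A a' d' * B b' c') = (h * A * hᵀ) a d * (h * B * hᵀ) b c := by
  rw [← raise_prod₂]
  refine Finset.sum_congr rfl fun a' _ => Finset.sum_congr rfl fun b' _ => ?_
  rw [Finset.sum_comm]
  exact Finset.sum_congr rfl fun c' _ => Finset.sum_congr rfl fun d' _ => by ring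

end Contractions

/-- The algebraic curvature tensor `2 w ⊗ w - g ∧ g + w ∧ w` of the self dual Weyl tensor of a
Kähler metric. -/
def kahlerWeyl (w g : Matrix (Fin 4) (Fin 4) ℝ) (a b c d : Fin 4) : ℝ :=
  2 * (w a b * w c d) - (g a c * g b d - g a d * g b c) + (w a c * w b d - w a d * w b c)

theorem raise_kahlerWeyl (h w g : Matrix (Fin 4) (Fin 4) ℝ) (a b c d : Fin 4) :
    ∑ a', ∑ b', ∑ c', ∑ d', h a a' * h b b' * h c c' * h d d' * kahlerWeyl w g a' b' c' d'
      = kahlerWeyl (h * w * hᵀ) (h * g * hᵀ) a b c d := by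
  unfold kahlerWeyl
  rw [← raise_prod₁ h w w a b c d, ← raise_prod₂ h g g a b c d, ← raise_prod₃ h g g a b c d,
    ← raise_prod₂ h w w a b c d, ← raise_prod₃ h w w a b c d]
  simp only [Finset.mul_sum, ← Finset.sum_add_distrib, ← Finset.sum_sub_distrib]
  exact Finset.sum_congr rfl fun a' _ => Finset.sum_congr rfl fun b' _ =>
    Finset.sum_congr rfl fun c' _ => Finset.sum_congr rfl fun d' _ => by ring

theorem sum_contract (A B : Matrix (Fin 4) (Fin 4) ℝ) :
    ∑ a, ∑ b, A a b * B a b = (A * Bᵀ).trace := by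
  simp only [Matrix.trace, Matrix.diag, Matrix.mul_apply, Matrix.transpose_apply]

/-- Every full contraction of products of matrices is either a product of two traces or the trace of
one chain, and the chains collapse through `g h = 1` and `O w = -1`. The total is `2 · 32 + 2 · 0 +
2 · 16`. -/
theorem kahlerWeyl_norm {w g h O : Matrix (Fin 4) (Fin 4) ℝ} (hgt : gᵀ = g) (hht : hᵀ = h)
    (hwt : wᵀ = -w) (hOt : Oᵀ = -O) (hgh : g * h = 1) (hOw : O * w = -1) (hgO : g * O * g = w) :
    ∑ a, ∑ b, ∑ c, ∑ d, kahlerWeyl w g a b c d * kahlerWeyl O h a b c d = 96 := by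
  have hwO : w * O = -1 := by
    have := mul_eq_one_comm.1 (show (-O) * w = 1 by rw [Matrix.neg_mul, hOw, neg_neg])
    rw [Matrix.mul_neg, neg_eq_iff_eq_neg] at this
    exact this
  have hhg : h * g = 1 := mul_eq_one_comm.1 hgh
  have hhw : h * w * h = O := by
    rw [← hgO]
    calc h * (g * O * g) * h = h * g * O * (g * h) := by noncomm_ring
      _ = O := by rw [hhg, hgh]; simp
  have e : ∀ A B C D : Matrix (Fin 4) (Fin 4) ℝ,
      ∑ a, ∑ b, ∑ c, ∑ d, A a b * B c d * (C a c * D b d) = (A * (C * B * Dᵀ)ᵀ).trace := by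
    intro A B C D
    rw [← sum_contract]
    refine Finset.sum_congr rfl fun a _ => Finset.sum_congr rfl fun b _ => ?_
    simp only [Matrix.mul_apply, Finset.mul_sum, Finset.sum_mul, Matrix.transpose_apply]
    rw [Finset.sum_comm]
    exact Finset.sum_congr rfl fun c _ => Finset.sum_congr rfl fun d _ => by ring
  have e1 : ∀ A B C D : Matrix (Fin 4) (Fin 4) ℝ,
      ∑ a, ∑ b, ∑ c, ∑ d, A a b * B c d * (C a b * D c d)
        = (A * Cᵀ).trace * (B * Dᵀ).trace := by
    intro A B C D
    rw [← sum_contract, ← sum_contract]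
    rw [Finset.sum_mul]
    refine Finset.sum_congr rfl fun a _ => ?_
    rw [Finset.sum_mul]
    refine Finset.sum_congr rfl fun b _ => ?_
    simp only [Finset.mul_sum]
    exact Finset.sum_congr rfl fun c _ => Finset.sum_congr rfl fun d _ => by ring
  have swap23 : ∀ f : Fin 4 → Fin 4 → Fin 4 → Fin 4 → ℝ,
      ∑ a, ∑ b, ∑ c, ∑ d, f a b c d = ∑ a, ∑ b, ∑ c, ∑ d, f a c b d := fun f =>
    Finset.sum_congr rfl fun a _ => Finset.sum_comm
  have swap34 : ∀ f : Fin 4 → Fin 4 → Fin 4 → Fin 4 → ℝ,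
      ∑ a, ∑ b, ∑ c, ∑ d, f a b c d = ∑ a, ∑ b, ∑ c, ∑ d, f a b d c := fun f =>
    Finset.sum_congr rfl fun a _ => Finset.sum_congr rfl fun b _ => Finset.sum_comm
  have e2 : ∀ A B C D : Matrix (Fin 4) (Fin 4) ℝ,
      ∑ a, ∑ b, ∑ c, ∑ d, A a d * B b c * (C a c * D b d) = (A * (C * Bᵀ * D)ᵀ).trace := by
    intro A B C D
    have h := e A Bᵀ C Dᵀ
    rw [Matrix.transpose_transpose] at h
    rw [← h, swap34, swap23, swap34]
    exact Finset.sum_congr rfl fun a _ => Finset.sum_congr rfl fun b _ =>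
      Finset.sum_congr rfl fun c _ => Finset.sum_congr rfl fun d _ => by
        simp only [Matrix.transpose_apply]
  have e3 : ∀ A B C D : Matrix (Fin 4) (Fin 4) ℝ,
      ∑ a, ∑ b, ∑ c, ∑ d, A a c * B b d * (C a c * D b d)
        = (A * Cᵀ).trace * (B * Dᵀ).trace := by
    intro A B C D
    rw [← e1, swap23]
  have e4 : ∀ A B C D : Matrix (Fin 4) (Fin 4) ℝ,
      ∑ a, ∑ b, ∑ c, ∑ d, A a c * B b d * (C a b * D c d) = (C * (A * D * Bᵀ)ᵀ).trace := by
    intro A B C D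
    rw [← e]
    exact Finset.sum_congr rfl fun a _ => Finset.sum_congr rfl fun b _ =>
      Finset.sum_congr rfl fun c _ => Finset.sum_congr rfl fun d _ => by ring
  have e5 : ∀ A B C D : Matrix (Fin 4) (Fin 4) ℝ,
      ∑ a, ∑ b, ∑ c, ∑ d, A a d * B b c * (C a b * D c d) = (C * (A * Dᵀ * Bᵀ)ᵀ).trace := by
    intro A B C D
    rw [← e4, swap34]
    rfl
  -- Antisymmetry in the last pair of indices makes each exchanged term minus the direct one, so
  -- only three contractions have to be evaluated.
  have key : ∀ S : Matrix (Fin 4) (Fin 4) ℝ,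
      ∑ a, ∑ b, ∑ c, ∑ d, kahlerWeyl w g a b c d * (S a d * S b c)
        = -∑ a, ∑ b, ∑ c, ∑ d, kahlerWeyl w g a b c d * (S a c * S b d) := by
    intro S
    rw [swap34]
    simp only [← Finset.sum_neg_distrib]
    refine Finset.sum_congr rfl fun a _ => Finset.sum_congr rfl fun b _ =>
      Finset.sum_congr rfl fun c _ => Finset.sum_congr rfl fun d _ => ?_
    have : w d c = -w c d := congrFun (congrFun hwt c) d
    simp only [kahlerWeyl, this]
    ring
  have tr1 : (w * O).trace = -4 := by rw [hwO]; simp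
  have tr2 : (O * w).trace = -4 := by rw [hOw]; simp
  have tr3 : (g * h).trace = 4 := by rw [hgh]; simp
  have tr0 : (w * h).trace = 0 := by
    have : (w * h).trace = -(w * h).trace := by
      conv_lhs => rw [← Matrix.trace_transpose, Matrix.transpose_mul, hht, hwt, Matrix.mul_neg,
        Matrix.trace_neg, Matrix.trace_mul_comm]
    linarith
  have tr0' : (g * O).trace = 0 := by
    have : (g * O).trace = -(g * O).trace := by
      conv_lhs => rw [← Matrix.trace_transpose, Matrix.transpose_mul, hgt, hOt, Matrix.neg_mul,
        Matrix.trace_neg, Matrix.trace_mul_comm]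
    linarith
  have q1 : w * O * w = -w := by rw [hwO]; simp
  have q2 : O * w * O = -O := by rw [hOw]; simp
  have q3 : h * g * h = h := by rw [hhg]; simp
  have q4 : O * g * O = -h := by
    have : O * g * O = h * (g * O * g) * O := by
      calc O * g * O = 1 * O * g * O := by simp
        _ = h * (g * O * g) * O := by rw [← hhg]; noncomm_ring
    rw [this, hgO, Matrix.mul_assoc, hwO]; simp
  have c1 : ∑ a, ∑ b, ∑ c, ∑ d, kahlerWeyl w g a b c d * (O a b * O c d) = 32 := by
    have : ∑ a, ∑ b, ∑ c, ∑ d, kahlerWeyl w g a b c d * (O a b * O c d)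
        = 2 * ∑ a, ∑ b, ∑ c, ∑ d, w a b * w c d * (O a b * O c d)
          - ∑ a, ∑ b, ∑ c, ∑ d, g a c * g b d * (O a b * O c d)
          + ∑ a, ∑ b, ∑ c, ∑ d, g a d * g b c * (O a b * O c d)
          + ∑ a, ∑ b, ∑ c, ∑ d, w a c * w b d * (O a b * O c d)
          - ∑ a, ∑ b, ∑ c, ∑ d, w a d * w b c * (O a b * O c d) := by
      simp only [Finset.mul_sum, ← Finset.sum_add_distrib, ← Finset.sum_sub_distrib]
      exact Finset.sum_congr rfl fun a _ => Finset.sum_congr rfl fun b _ =>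
        Finset.sum_congr rfl fun c _ => Finset.sum_congr rfl fun d _ => by
          rw [kahlerWeyl]; ring
    rw [this, e1, e4, e5, e4, e5]
    simp only [hgt, hwt, hOt, Matrix.mul_neg, Matrix.neg_mul, Matrix.transpose_neg, hgO, q1,
      Matrix.trace_neg, tr1, tr2]
    norm_num
  have c2 : ∑ a, ∑ b, ∑ c, ∑ d, kahlerWeyl w g a b c d * (h a c * h b d) = 0 := by
    have : ∑ a, ∑ b, ∑ c, ∑ d, kahlerWeyl w g a b c d * (h a c * h b d)
        = 2 * ∑ a, ∑ b, ∑ c, ∑ d, w a b * w c d * (h a c * h b d)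
          - ∑ a, ∑ b, ∑ c, ∑ d, g a c * g b d * (h a c * h b d)
          + ∑ a, ∑ b, ∑ c, ∑ d, g a d * g b c * (h a c * h b d)
          + ∑ a, ∑ b, ∑ c, ∑ d, w a c * w b d * (h a c * h b d)
          - ∑ a, ∑ b, ∑ c, ∑ d, w a d * w b c * (h a c * h b d) := by
      simp only [Finset.mul_sum, ← Finset.sum_add_distrib, ← Finset.sum_sub_distrib]
      exact Finset.sum_congr rfl fun a _ => Finset.sum_congr rfl fun b _ =>
        Finset.sum_congr rfl fun c _ => Finset.sum_congr rfl fun d _ => by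
          rw [kahlerWeyl]; ring
    rw [this, e, e3, e2, e3, e2]
    simp only [hgt, hht, hwt, hOt, Matrix.mul_neg, Matrix.neg_mul, Matrix.transpose_neg, hhw, q3,
      Matrix.trace_neg, tr1, tr0, tr3]
    norm_num
  have c3 : ∑ a, ∑ b, ∑ c, ∑ d, kahlerWeyl w g a b c d * (O a c * O b d) = 16 := by
    have : ∑ a, ∑ b, ∑ c, ∑ d, kahlerWeyl w g a b c d * (O a c * O b d)
        = 2 * ∑ a, ∑ b, ∑ c, ∑ d, w a b * w c d * (O a c * O b d)
          - ∑ a, ∑ b, ∑ c, ∑ d, g a c * g b d * (O a c * O b d)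
          + ∑ a, ∑ b, ∑ c, ∑ d, g a d * g b c * (O a c * O b d)
          + ∑ a, ∑ b, ∑ c, ∑ d, w a c * w b d * (O a c * O b d)
          - ∑ a, ∑ b, ∑ c, ∑ d, w a d * w b c * (O a c * O b d) := by
      simp only [Finset.mul_sum, ← Finset.sum_add_distrib, ← Finset.sum_sub_distrib]
      exact Finset.sum_congr rfl fun a _ => Finset.sum_congr rfl fun b _ =>
        Finset.sum_congr rfl fun c _ => Finset.sum_congr rfl fun d _ => by
          rw [kahlerWeyl]; ring
    rw [this, e, e3, e2, e3, e2]
    simp only [hgt, hht, hwt, hOt, Matrix.mul_neg, Matrix.neg_mul, Matrix.transpose_neg, q2, q4,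
      Matrix.trace_neg, tr1, tr0', tr3]
    norm_num
  have : ∑ a, ∑ b, ∑ c, ∑ d, kahlerWeyl w g a b c d * kahlerWeyl O h a b c d
      = 2 * ∑ a, ∑ b, ∑ c, ∑ d, kahlerWeyl w g a b c d * (O a b * O c d)
        - ∑ a, ∑ b, ∑ c, ∑ d, kahlerWeyl w g a b c d * (h a c * h b d)
        + ∑ a, ∑ b, ∑ c, ∑ d, kahlerWeyl w g a b c d * (h a d * h b c)
        + ∑ a, ∑ b, ∑ c, ∑ d, kahlerWeyl w g a b c d * (O a c * O b d)
        - ∑ a, ∑ b, ∑ c, ∑ d, kahlerWeyl w g a b c d * (O a d * O b c) := by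
    simp only [Finset.mul_sum, ← Finset.sum_add_distrib, ← Finset.sum_sub_distrib]
    exact Finset.sum_congr rfl fun a _ => Finset.sum_congr rfl fun b _ =>
      Finset.sum_congr rfl fun c _ => Finset.sum_congr rfl fun d _ => by
        conv_lhs => rw [kahlerWeyl.eq_def O h]
        ring
  rw [this, key, key, c1, c2, c3]
  norm_num

end Chart

end

/-! ### The self dual Weyl tensor of a Kähler surface -/

noncomputable section

namespace Chart

open Matrix

/-- For commuting `J`-invariant symmetric forms the Kulkarni-Nomizu product with the metric of a
trace free Ricci tensor is `J`-invariant. -/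
theorem kulkarni_J_invariant {J g h r : Matrix (Fin 4) (Fin 4) ℝ} (hJ : J * J = -1)
    (hgt : gᵀ = g) (hrt : rᵀ = r) (hhg : h * g = 1) (hgJ : g * Jᵀ = -(J * g))
    (hrJ : r * Jᵀ = -(J * r)) (htr : (h * r).trace = 0) (a b c d : Fin 4) :
    g a c * r b d - g a d * r b c + r a c * g b d - r a d * g b c
      = (J * g) a c * (J * r) b d - (J * g) a d * (J * r) b c + (J * r) a c * (J * g) b d
        - (J * r) a d * (J * g) b c := by
  have hJt : Jᵀ * Jᵀ = -1 := by rw [← Matrix.transpose_mul, hJ]; simp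
  set w := J * g with hw
  set q := J * r with hq
  have hwt : wᵀ = -w := by rw [hw, Matrix.transpose_mul, hgt, hgJ]
  have hqt : qᵀ = -q := by rw [hq, Matrix.transpose_mul, hrt, hrJ]
  have hwa : ∀ a b, w a b = -w b a := fun a b => congrFun (congrFun hwt b) a
  have hqa : ∀ a b, q a b = -q b a := fun a b => congrFun (congrFun hqt b) a
  have hgh : g * h = 1 := mul_eq_one_comm.1 hhg
  have hOw : h * J * w = -1 := by
    rw [hw, ← Matrix.mul_assoc, Matrix.mul_assoc h, hJ]; simp [hhg]
  have hOq : (h * J * q).trace = 0 := by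
    rw [hq, ← Matrix.mul_assoc, Matrix.mul_assoc h, hJ]; simp [htr]
  -- The form `J r` of a trace free, `J`-invariant symmetric `r` is primitive, so its wedge product
  -- with `w` vanishes. This is the only place where dimension four enters.
  have hwedge := wedge_eq_zero hwa hqa hOw hOq
  have hwJt : w * Jᵀ = g := by
    rw [hw, Matrix.mul_assoc, hgJ, Matrix.mul_neg, ← Matrix.mul_assoc, hJ]; simp
  have hqJt : q * Jᵀ = r := by
    rw [hq, Matrix.mul_assoc, hrJ, Matrix.mul_neg, ← Matrix.mul_assoc, hJ]; simp
  have hJw : J * w = -g := by rw [hw, ← Matrix.mul_assoc, hJ]; simp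
  have hJq : J * q = -r := by rw [hq, ← Matrix.mul_assoc, hJ]; simp
  have hJwJ : J * w * Jᵀ = w := by rw [hJw, Matrix.neg_mul, hgJ, neg_neg]
  have hJqJ : J * q * Jᵀ = q := by rw [hJq, Matrix.neg_mul, hrJ, neg_neg]
  have R : ∀ A : Matrix (Fin 4) (Fin 4) ℝ, ∀ a b, ∑ e, J b e * A a e = (A * Jᵀ) a b := fun A a b => by
    rw [Matrix.mul_apply]
    exact Finset.sum_congr rfl fun e _ => by rw [Matrix.transpose_apply, mul_comm]
  have Lc : ∀ A : Matrix (Fin 4) (Fin 4) ℝ, ∀ a b, ∑ e, J a e * A e b = (J * A) a b := fun A a b => rfl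
  have D : ∀ A : Matrix (Fin 4) (Fin 4) ℝ, ∀ b d, ∑ e, ∑ f, J b e * J d f * A e f
      = (J * A * Jᵀ) b d := fun A b d => (mul_mul_transpose_apply J A b d).symm
  have P : ∀ (x y : Fin 4 → ℝ) (b d : Fin 4), ∑ e, ∑ f, J b e * J d f * (x e * y f)
      = (∑ e, J b e * x e) * ∑ f, J d f * y f := fun x y b d => by
    rw [Finset.sum_mul_sum]
    exact Finset.sum_congr rfl fun e _ => Finset.sum_congr rfl fun f _ => by ring
  have I : ∀ a b c d, g a b * r c d + r a b * g c d - w a c * q b d - q a c * w b d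
      - g a d * r b c - r a d * g b c = 0 := by
    -- Contract the second and fourth slots of the wedge identity with `J`. This converts some of
    -- the factors `w, q` back into `g, r`; antisymmetrizing the result in `c, d` gives the claim.
    intro a b c d
    have h0 : ∑ e, ∑ f, J b e * J d f * (w a e * q c f + w c f * q a e - w a c * q e f
        - w e f * q a c + w a f * q e c + w e c * q a f) = 0 := by simp [hwedge]
    have h1 : ∑ e, ∑ f, J b e * J d f * (w a e * q c f + w c f * q a e - w a c * q e f
        - w e f * q a c + w a f * q e c + w e c * q a f)
        = ∑ e, ∑ f, J b e * J d f * (w a e * q c f) + ∑ e, ∑ f, J b e * J d f * (q a e * w c f)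
          - w a c * ∑ e, ∑ f, J b e * J d f * q e f - q a c * ∑ e, ∑ f, J b e * J d f * w e f
          + ∑ e, ∑ f, J b e * J d f * (q e c * w a f) + ∑ e, ∑ f, J b e * J d f * (w e c * q a f) := by
      simp only [Finset.mul_sum, ← Finset.sum_add_distrib, ← Finset.sum_sub_distrib]
      exact Finset.sum_congr rfl fun e _ => Finset.sum_congr rfl fun f _ => by ring
    rw [h1, D, D, hJqJ, hJwJ, P (fun e => w a e) (fun f => q c f), P (fun e => q a e) (fun f => w c f),
      P (fun e => q e c) (fun f => w a f), P (fun e => w e c) (fun f => q a f)] at h0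
    simp only [R, Lc, hwJt, hqJt, hJw, hJq, Matrix.neg_apply] at h0
    linarith
  have hga : ∀ a b, g a b = g b a := fun a b => congrFun (congrFun hgt b) a
  have hra : ∀ a b, r a b = r b a := fun a b => congrFun (congrFun hrt b) a
  linear_combination I a b c d - I a b d c + g a b * hra d c + r a b * hga d c

namespace IsKahlerOn

variable {U : Set Pt} {p : Pt} {J g : MatField}

theorem kahlerForm_mul_inv (hk : IsKahlerOn U J g) (hU : IsOpen U) (hp : p ∈ U) :
    kahlerForm J g p * (g p)⁻¹ = J p := by
  rw [kahlerForm, Matrix.mul_assoc, (hk.isMetricOn hU).mul_inv hp, Matrix.mul_one]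

/-- The hypothesis on the Pfaffian says that the complex orientation is the coordinate orientation,
so the volume form is `ω ∧ ω / 2`. -/
theorem volForm_eq (hk : IsKahlerOn U J g) (hU : IsOpen U) (hp : p ∈ U)
    (hvol : Real.sqrt (g p).det = pfaffian (kahlerForm J g p)) (a b c d : Fin 4) :
    volForm g p a b c d = kahlerForm J g p a b * kahlerForm J g p c d
      - kahlerForm J g p a c * kahlerForm J g p b d
      + kahlerForm J g p a d * kahlerForm J g p b c := by
  have hw : ∀ a b, kahlerForm J g p a b = -kahlerForm J g p b a := fun a b =>
    congrFun (congrFun (hk.kahlerForm_transpose hU hp) b) a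
  rw [volForm, hvol, pfaffian_mul_leviCivita hw]

/-- With the volume form expressed by `ω`, the star needs no Levi-Civita symbol: it is a contraction
with `g⁻¹ J` and the action of `J` on both indices. -/
theorem star_eq (hk : IsKahlerOn U J g) (hU : IsOpen U) (hp : p ∈ U)
    (hvol : Real.sqrt (g p).det = pfaffian (kahlerForm J g p)) {T : Fin 4 → Fin 4 → ℝ}
    (hT : ∀ e f, T e f = -T f e) (a b : Fin 4) :
    ∑ e, ∑ f, ∑ m, ∑ n, volForm g p a b m n * (g p)⁻¹ m e * (g p)⁻¹ n f * T e f
      = kahlerForm J g p a b * (∑ e, ∑ f, ((g p)⁻¹ * J p) e f * T e f)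
        - 2 * ∑ e, ∑ f, J p a e * J p b f * T e f := by
  have hg := hk.isMetricOn hU
  set w := kahlerForm J g p with hw
  have hwh : w * (g p)⁻¹ = J p := hk.kahlerForm_mul_inv hU hp
  have h1 : ∀ a e, ∑ m, w a m * (g p)⁻¹ m e = J p a e := fun a e => by rw [← hwh]; rfl
  have h2 : ∀ e f, ∑ m, ∑ n, w m n * (g p)⁻¹ m e * (g p)⁻¹ n f = ((g p)⁻¹ * J p) e f := by
    intro e f
    rw [Matrix.mul_apply]
    refine Finset.sum_congr rfl fun m _ => ?_
    rw [← h1 m f, Finset.mul_sum]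
    exact Finset.sum_congr rfl fun n _ => by rw [hg.inv_symm_apply hp m e]; ring
  have h3 : ∀ e f, ∑ m, ∑ n, volForm g p a b m n * (g p)⁻¹ m e * (g p)⁻¹ n f * T e f
      = w a b * (((g p)⁻¹ * J p) e f * T e f) - J p a e * J p b f * T e f
        - J p b e * J p a f * T f e := by
    intro e f
    rw [hT f e, ← h2 e f, ← h1 a e, ← h1 b f, ← h1 b e, ← h1 a f, Finset.sum_mul_sum,
      Finset.sum_mul_sum, Finset.sum_mul, Finset.sum_mul, Finset.sum_mul, Finset.mul_sum,
      ← Finset.sum_sub_distrib, ← Finset.sum_sub_distrib]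
    refine Finset.sum_congr rfl fun m _ => ?_
    rw [Finset.sum_mul, Finset.sum_mul, Finset.sum_mul, Finset.mul_sum,
      ← Finset.sum_sub_distrib, ← Finset.sum_sub_distrib]
    refine Finset.sum_congr rfl fun n _ => ?_
    rw [hk.volForm_eq hU hp hvol]
    ring
  have h4 : ∑ e, ∑ f, J p b e * J p a f * T f e = ∑ e, ∑ f, J p a e * J p b f * T e f := by
    rw [Finset.sum_comm]
    exact Finset.sum_congr rfl fun e _ => Finset.sum_congr rfl fun f _ => by ring
  simp only [h3, Finset.sum_sub_distrib, h4, ← Finset.mul_sum]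
  ring

theorem weyl_antisymm (hg : IsMetricOn U g) (hp : p ∈ U) (a b c d : Fin 4) :
    weyl g p a b c d = -weyl g p b a c d := by
  simp only [weyl]
  linear_combination hg.riemann_antisymm_left hp a b c d

/-- The self dual Weyl tensor of a Kähler surface. -/
theorem weylPlus_eq (hk : IsKahlerOn U J g) (hU : IsOpen U) (hp : p ∈ U)
    (hvol : Real.sqrt (g p).det = pfaffian (kahlerForm J g p)) (a b c d : Fin 4) :
    weylPlus g p a b c d = scal g p / 24 * kahlerWeyl (kahlerForm J g p) (g p) a b c d := by
  have hg := hk.isMetricOn hU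
  set r := ricciMat g p with hr
  set w := kahlerForm J g p with hw
  set s := scal g p with hs
  set Rm := g p * curv g c d p with hRm
  have hJ := hk.sq hp
  have hgt := hg.symm p hp
  have hrt : rᵀ = r := ricciMat_transpose hg hp
  have hgJ := hk.metric_mul_transpose hp
  have hrJ : r * (J p)ᵀ = -(J p * r) := by rw [hk.J_mul_ricci hU hp, neg_neg]
  have hwJ : w = J p * g p := rfl
  have hga : ∀ a b, g p a b = g p b a := hg.symm_apply hp
  have hra : ∀ a b, r a b = r b a := fun a b => congrFun (congrFun hrt b) a
  have hW : ∀ e f, weyl g p e f c d = Rm e f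
      - 1 / 2 * (g p e c * r f d - g p e d * r f c + g p f d * r e c - g p f c * r e d)
      + s / 6 * (g p e c * g p f d - g p e d * g p f c) := fun e f => by
    rw [weyl, IsMetricOn.riemann_eq]; rfl
  have hsum : ∀ C : Fin 4 → Fin 4 → ℝ, ∑ e, ∑ f, C e f * weyl g p e f c d
      = ∑ e, ∑ f, C e f * Rm e f
        - 1 / 2 * (∑ e, ∑ f, C e f * (g p e c * r f d) - ∑ e, ∑ f, C e f * (g p e d * r f c)
          + ∑ e, ∑ f, C e f * (r e c * g p f d) - ∑ e, ∑ f, C e f * (r e d * g p f c))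
        + s / 6 * (∑ e, ∑ f, C e f * (g p e c * g p f d)
          - ∑ e, ∑ f, C e f * (g p e d * g p f c)) := fun C => by
    simp only [hW, Finset.mul_sum, ← Finset.sum_add_distrib, ← Finset.sum_sub_distrib]
    exact Finset.sum_congr rfl fun e _ => Finset.sum_congr rfl fun f _ => by ring
  have hJJ : ∀ (x y : Fin 4 → ℝ), ∑ e, ∑ f, J p a e * J p b f * (x e * y f)
      = (∑ e, J p a e * x e) * ∑ f, J p b f * y f := fun x y => by
    rw [Finset.sum_mul_sum]
    exact Finset.sum_congr rfl fun e _ => Finset.sum_congr rfl fun f _ => by ring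
  set O := (g p)⁻¹ * J p with hO
  have hOO : ∀ (A B : Matrix (Fin 4) (Fin 4) ℝ), ∀ c d,
      ∑ e, ∑ f, O e f * (A e c * B f d) = (Aᵀ * O * B) c d := fun A B c d => by
    simp only [Matrix.mul_apply, Finset.sum_mul, Matrix.transpose_apply]
    rw [Finset.sum_comm]
    exact Finset.sum_congr rfl fun e _ => Finset.sum_congr rfl fun f _ => by ring
  have hgO : g p * O = J p := by rw [hO, ← Matrix.mul_assoc, hg.mul_inv hp, Matrix.one_mul]
  have hOg : O * g p = -(J p)ᵀ := by
    have h : -O = (J p)ᵀ * (g p)⁻¹ := (hk.inv_mul_transpose hU hp).symm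
    rw [← neg_neg (O * g p), ← Matrix.neg_mul, h, Matrix.mul_assoc, hg.inv_mul hp, Matrix.mul_one]
  have hrOg : r * O * g p = J p * r := by
    rw [Matrix.mul_assoc, hOg, Matrix.mul_neg, hrJ, neg_neg]
  have hq : ∀ c d, (J p * r) c d = -(J p * r) d c := fun c d => by
    have : (J p * r)ᵀ = -(J p * r) := by rw [Matrix.transpose_mul, hrt, hrJ]
    exact congrFun (congrFun this d) c
  have hwa : ∀ c d, w c d = -w d c := fun c d =>
    congrFun (congrFun (hk.kahlerForm_transpose hU hp) d) c
  have hORm : ∑ e, ∑ f, O e f * Rm e f = 2 * (J p * r) c d := by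
    have h : Oᵀ * g p = (J p)ᵀ := by
      rw [← hgO, Matrix.transpose_mul (g p) O, hgt]
    rw [← hk.trace_J_curv hU hp, sum_contract, ← Matrix.trace_transpose, Matrix.transpose_mul,
      Matrix.transpose_transpose, Matrix.trace_mul_comm, hRm, ← Matrix.mul_assoc, h]
  have hJRm : ∑ e, ∑ f, J p a e * J p b f * Rm e f = Rm a b := by
    rw [← mul_mul_transpose_apply, hk.J_mul_lower_curv hU hp, Matrix.neg_mul, Matrix.mul_assoc,
      hk.sq_transpose hp]
    simp [hRm]
  -- The trace free part of the Ricci tensor has a `J`-invariant Kulkarni–Nomizu product with `g`;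
  -- only its trace part, `s / 4` times `g`, fails to cancel.
  have hKJ : g p a c * r b d - g p a d * r b c + r a c * g p b d - r a d * g p b c
      - (w a c * (J p * r) b d - w a d * (J p * r) b c + (J p * r) a c * w b d
        - (J p * r) a d * w b c)
      = s / 2 * (g p a c * g p b d - g p a d * g p b c - (w a c * w b d - w a d * w b c)) := by
    have htr : ((g p)⁻¹ * r).trace = s := by
      simp only [Matrix.trace, Matrix.diag, Matrix.mul_apply, hs, scal]
      exact Finset.sum_congr rfl fun b _ => Finset.sum_congr rfl fun d _ => by rw [hra]; rfl
    have h := kulkarni_J_invariant (r := r - (s / 4) • g p) hJ hgt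
      (by rw [Matrix.transpose_sub, Matrix.transpose_smul, hgt, hrt]) (hg.inv_mul hp) hgJ
      (by rw [Matrix.sub_mul, Matrix.mul_sub, Matrix.smul_mul, Matrix.mul_smul, hgJ, hrJ, neg_sub,
            smul_neg]; abel)
      (by rw [Matrix.mul_sub, Matrix.mul_smul, hg.inv_mul hp, Matrix.trace_sub, Matrix.trace_smul,
            htr]; simp) a b c d
    simp only [Matrix.mul_sub, Matrix.mul_smul, Matrix.sub_apply, Matrix.smul_apply, smul_eq_mul,
      ← hwJ] at h
    linear_combination h
  rw [weylPlus, hk.star_eq hU hp hvol fun e f => weyl_antisymm hg hp e f c d]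
  rw [← hO, hsum (fun e f => J p a e * J p b f), hsum O, hORm, hJRm, hOO, hOO, hOO, hOO, hOO, hOO, hJJ (fun e => g p e c) (fun f => r f d),
    hJJ (fun e => g p e d) (fun f => r f c), hJJ (fun e => r e c) (fun f => g p f d),
    hJJ (fun e => r e d) (fun f => g p f c), hJJ (fun e => g p e c) (fun f => g p f d),
    hJJ (fun e => g p e d) (fun f => g p f c)]
  simp only [hgt, hrt, hgO, hrOg, ← Matrix.mul_apply, ← hwJ]
  rw [hW, kahlerWeyl, hq d c, hwa d c]
  linear_combination (-1 / 4) * hKJ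

/-- The norm of the self dual Weyl tensor of a Kähler surface. -/
theorem weylPlusNorm_eq (hk : IsKahlerOn U J g) (hU : IsOpen U) (hp : p ∈ U)
    (hvol : Real.sqrt (g p).det = pfaffian (kahlerForm J g p)) :
    weylPlusNorm g p = |scal g p| / Real.sqrt 6 := by
  have hg := hk.isMetricOn hU
  set w := kahlerForm J g p with hw
  set h := (g p)⁻¹ with hh
  have hht : hᵀ = h := hg.inv_transpose hp
  have hwh : w * h = J p := hk.kahlerForm_mul_inv hU hp
  have hR : ∀ a b c d, ∑ a', ∑ b', ∑ c', ∑ d', h a a' * h b b' * h c c' * h d d'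
      * kahlerWeyl w (g p) a' b' c' d' = kahlerWeyl (h * J p) h a b c d := fun a b c d => by
    rw [raise_kahlerWeyl, hht, Matrix.mul_assoc h w, hwh, hg.inv_mul hp, Matrix.one_mul]
  have hOt : (h * J p)ᵀ = -(h * J p) := by
    rw [Matrix.transpose_mul, hht, hk.inv_mul_transpose hU hp]
  have hgO : g p * (h * J p) * g p = w := by
    rw [← Matrix.mul_assoc, hg.mul_inv hp, Matrix.one_mul]; rfl
  have hOw : h * J p * w = -1 := by
    rw [hw, kahlerForm, ← Matrix.mul_assoc, Matrix.mul_assoc h, hk.sq hp]; simp [hh, hg.inv_mul hp]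
  -- The constant comes from `96 / 24² = 1 / 6`.
  have hsum := kahlerWeyl_norm (hg.symm p hp) hht (hk.kahlerForm_transpose hU hp) hOt
    (hg.mul_inv hp) hOw hgO
  have key : ∑ a, ∑ b, ∑ c, ∑ d, ∑ a', ∑ b', ∑ c', ∑ d', h a a' * h b b' * h c c' * h d d' *
      weylPlus g p a b c d * weylPlus g p a' b' c' d' = scal g p ^ 2 / 6 := by
    have h1 : ∀ a b c d, ∑ a', ∑ b', ∑ c', ∑ d', h a a' * h b b' * h c c' * h d d' *
        weylPlus g p a b c d * weylPlus g p a' b' c' d'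
        = (scal g p / 24) ^ 2 * (kahlerWeyl w (g p) a b c d * kahlerWeyl (h * J p) h a b c d) := by
      intro a b c d
      rw [← hR]
      simp only [hk.weylPlus_eq hU hp hvol, Finset.mul_sum]
      exact Finset.sum_congr rfl fun a _ => Finset.sum_congr rfl fun b _ =>
        Finset.sum_congr rfl fun c _ => Finset.sum_congr rfl fun d _ => by ring
    simp only [h1, ← Finset.mul_sum]
    rw [← hw] at hsum
    rw [hsum]
    ring
  rw [weylPlusNorm, key, Real.sqrt_div (sq_nonneg _), Real.sqrt_sq_eq_abs]

end IsKahlerOn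

end Chart

end

noncomputable section

namespace Chart

open Matrix

/-! ### Conformal Killing-Yano forms -/

theorem covDeriv_eq (g T : MatField) (p : Pt) (a b c : Fin 4) : covDeriv g T p a b c
    = (mpd a T p - (gam g a p)ᵀ * T p - T p * gam g a p) b c := by
  simp only [covDeriv, Matrix.sub_apply, Matrix.mul_apply, mpd_apply, gam_apply,
    Matrix.transpose_apply, Finset.sum_add_distrib, sub_sub]
  congr 2
  exact Finset.sum_congr rfl fun e _ => mul_comm _ _

section ConformallyKahler

variable {U : Set Pt} {p : Pt} {J g T : MatField} {u : Pt → ℝ} {t : ℝ}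

theorem kahlerForm_conf (J g : MatField) (u : Pt → ℝ) (q : Pt) :
    kahlerForm J (conf u g) q = u q ^ 2 • (J q * g q) := by
  rw [kahlerForm, conf, Matrix.mul_smul]

theorem transpose_J_mul_metric (hg : IsMetricOn U g) (hk : IsKahlerOn U J (conf u g))
    (hu0 : ∀ q ∈ U, u q ≠ 0) (hp : p ∈ U) : (J p * g p)ᵀ = -(J p * g p) := by
  have h := hk.kahlerForm_transpose hg.isOpen hp
  rw [kahlerForm_conf, Matrix.transpose_smul, ← smul_neg] at h
  exact smul_right_injective _ (pow_ne_zero 2 (hu0 p hp)) h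

/-- Write `T = t u⁻³ ω̄` with `ω̄` parallel for `u² g`. Then `∇T` only contains the difference of
the two connections and the derivative of `u⁻³`, so it is algebraic in `du / u`. -/
theorem covDeriv_confKahler (hg : IsMetricOn U g) (hu : ContDiffOn ℝ ∞ u U)
    (hu0 : ∀ q ∈ U, u q ≠ 0) (hk : IsKahlerOn U J (conf u g))
    (hT : ∀ q ∈ U, T q = (t * (u q)⁻¹) • (J q * g q)) (hp : p ∈ U) (a b c : Fin 4) :
    covDeriv g T p a b c = t * (u p)⁻¹ * (-logd u a p * (J p * g p) b c
      + logd u b p * (J p * g p) a c - logd u c p * (J p * g p) a b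
      - g p a b * (∑ e, logGrad u g e p * (J p * g p) e c)
      + g p a c * (∑ e, logGrad u g e p * (J p * g p) e b)) := by
  have hU := hg.isOpen
  have h0 := hu0 p hp
  set w := J p * g p with hw
  have hwa : ∀ x y, w x y = -w y x := fun x y =>
    congrFun (congrFun (transpose_J_mul_metric hg hk hu0 hp) y) x
  have hpar : mpd a (kahlerForm J (conf u g)) p
      = (gam g a p + confDiff u g a p)ᵀ * (u p ^ 2 • w)
        + (u p ^ 2 • w) * (gam g a p + confDiff u g a p) := by
    have h := hk.nablaJ_mul_metric hU hp a
    rw [hk.nablaJ_eq_zero hU hp, Matrix.zero_mul, gam_conf hg hu hp h0, kahlerForm_conf] at h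
    rw [← sub_eq_zero, h]
    abel
  have hsw : SmoothOn U (kahlerForm J (conf u g)) := hk.complexStructure.smooth.mul hk.smooth
  have hmT : mpd a T p = (t * (u p)⁻¹ ^ 3) • mpd a (kahlerForm J (conf u g)) p
      - (3 * t * (u p)⁻¹ * logd u a p) • w := by
    ext x y
    have hud := differentiableAt_of_contDiffOn hU hu hp
    have hi : ContDiffOn ℝ ∞ (fun q => t * (u q)⁻¹ ^ 3) U := contDiffOn_const.mul ((hu.inv hu0).pow 3)
    have hid := differentiableAt_of_contDiffOn hU hi hp
    have hwd := hsw.differentiableAt hU hp x y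
    have hpi : pd a (fun q => t * (u q)⁻¹ ^ 3) p = -3 * t * (u p)⁻¹ ^ 3 * logd u a p := by
      -- Differentiating the constant `u³ · t u⁻³` with the product rule determines the derivative
      -- of `t u⁻³`.
      have h1 : pd a (fun q => u q * (u q * (u q * (t * (u q)⁻¹ ^ 3)))) p = 0 := by
        rw [pd_congr hU (h := fun _ => t) (fun q hq => by
          have := hu0 q hq
          field_simp) hp, pd_const]
      rw [pd_mul _ hud (hud.fun_mul (hud.fun_mul hid)), pd_mul _ hud (hud.fun_mul hid),
        pd_mul _ hud hid] at h1
      rw [logd]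
      field_simp at h1 ⊢
      linear_combination h1
    have hTe : ∀ q ∈ U, T q x y = (t * (u q)⁻¹ ^ 3) * kahlerForm J (conf u g) q x y := fun q hq => by
      have := hu0 q hq
      rw [hT q hq, kahlerForm_conf]
      simp only [Matrix.smul_apply, smul_eq_mul]
      field_simp
    rw [mpd_apply, pd_congr hU hTe hp, pd_mul _ hid hwd, hpi, kahlerForm_conf, ← mpd_apply]
    simp only [Matrix.sub_apply, Matrix.smul_apply, smul_eq_mul, ← hw]
    field_simp
    ring
  have hmat : mpd a T p - (gam g a p)ᵀ * T p - T p * gam g a p = (t * (u p)⁻¹) •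
      ((confDiff u g a p)ᵀ * w + w * confDiff u g a p - (3 * logd u a p) • w) := by
    have hs : t * (u p)⁻¹ ^ 3 * u p ^ 2 = t * (u p)⁻¹ := by field_simp
    rw [hmT, hpar, hT p hp, ← hw]
    simp only [Matrix.transpose_add, Matrix.add_mul, Matrix.mul_add, Matrix.mul_smul,
      Matrix.smul_mul, smul_add, smul_sub, smul_smul, hs]
    have h3 : 3 * t * (u p)⁻¹ * logd u a p = t * (u p)⁻¹ * (3 * logd u a p) := by ring
    rw [h3]
    abel
  have h1 : ((confDiff u g a p)ᵀ * w) b c = logd u a p * w b c + logd u b p * w a c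
      - g p a b * ∑ e, logGrad u g e p * w e c := by
    simp only [Matrix.mul_apply, confDiff, Matrix.of_apply, Matrix.transpose_apply, sub_mul, add_mul,
      Finset.sum_sub_distrib, Finset.sum_add_distrib, Matrix.one_apply, Finset.mul_sum]
    congr 1
    · simp
    · exact Finset.sum_congr rfl fun e _ => by ring
  have h2 : (w * confDiff u g a p) b c = logd u a p * w b c + logd u c p * w b a
      + g p a c * ∑ e, logGrad u g e p * w e b := by
    have h3 : ∑ e, logGrad u g e p * w e b = -∑ e, w b e * logGrad u g e p := by
      rw [← Finset.sum_neg_distrib]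
      exact Finset.sum_congr rfl fun e _ => by rw [hwa e b]; ring
    rw [h3, mul_neg, ← sub_eq_add_neg]
    simp only [Matrix.mul_apply, confDiff, Matrix.of_apply, mul_sub, mul_add,
      Finset.sum_sub_distrib, Finset.sum_add_distrib, Matrix.one_apply, Finset.mul_sum]
    congr 1
    · simp [mul_comm]
    · exact Finset.sum_congr rfl fun e _ => by ring
  rw [covDeriv_eq, hmat]
  simp only [Matrix.smul_apply, Matrix.sub_apply, Matrix.add_apply, h1, h2, smul_eq_mul]
  rw [hwa b a]
  ring

/-- The coefficient is `-1 + 1 - 4 + 1 = -3`, where the 4 is the trace of the metric. -/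
theorem div_confKahler (hg : IsMetricOn U g) (hu : ContDiffOn ℝ ∞ u U)
    (hu0 : ∀ q ∈ U, u q ≠ 0) (hk : IsKahlerOn U J (conf u g))
    (hT : ∀ q ∈ U, T q = (t * (u q)⁻¹) • (J q * g q)) (hp : p ∈ U) (c : Fin 4) :
    ∑ d, ∑ e, (g p)⁻¹ d e * covDeriv g T p e d c
      = -3 * t * (u p)⁻¹ * ∑ e, logGrad u g e p * (J p * g p) e c := by
  set w := J p * g p with hw
  set κ : Fin 4 → ℝ := fun c => ∑ e, logGrad u g e p * w e c with hκ
  have hwa : ∀ x y, w x y = -w y x := fun x y =>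
    congrFun (congrFun (transpose_J_mul_metric hg hk hu0 hp) y) x
  have hs : ∀ d e, (g p)⁻¹ d e = (g p)⁻¹ e d := hg.inv_symm_apply hp
  have h1 : ∑ d, ∑ e, (g p)⁻¹ d e * (logd u e p * w d c) = κ c := by
    simp only [hκ, logGrad, Finset.sum_mul, mul_assoc]
  have h2 : ∑ d, ∑ e, (g p)⁻¹ d e * (logd u d p * w e c) = κ c := by
    rw [Finset.sum_comm, ← h1]
    exact Finset.sum_congr rfl fun d _ => Finset.sum_congr rfl fun e _ => by rw [hs]
  have h3 : ∑ d, ∑ e, (g p)⁻¹ d e * w e d = 0 := by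
    have h : ∑ d, ∑ e, (g p)⁻¹ d e * w e d = -∑ d, ∑ e, (g p)⁻¹ d e * w e d := by
      conv_lhs => rw [Finset.sum_comm]
      simp only [← Finset.sum_neg_distrib]
      exact Finset.sum_congr rfl fun d _ => Finset.sum_congr rfl fun e _ => by
        rw [hs, hwa]; ring
    linarith
  have h4 : ∑ d, ∑ e, (g p)⁻¹ d e * g p e d = 4 := by
    simp [sum_inv_mul hg hp]
  have h5 : ∑ d, ∑ e, (g p)⁻¹ d e * (g p e c * κ d) = κ c := by
    have : ∀ d, ∑ e, (g p)⁻¹ d e * (g p e c * κ d)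
        = (1 : Matrix (Fin 4) (Fin 4) ℝ) d c * κ d := fun d => by
      rw [← sum_inv_mul hg hp, Finset.sum_mul]
      exact Finset.sum_congr rfl fun e _ => by ring
    simp [this, Matrix.one_apply]
  have h6 : ∑ d, ∑ e, (g p)⁻¹ d e * covDeriv g T p e d c
      = t * (u p)⁻¹ * (-∑ d, ∑ e, (g p)⁻¹ d e * (logd u e p * w d c)
        + ∑ d, ∑ e, (g p)⁻¹ d e * (logd u d p * w e c)
        - logd u c p * ∑ d, ∑ e, (g p)⁻¹ d e * w e d
        - (∑ d, ∑ e, (g p)⁻¹ d e * g p e d) * κ c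
        + ∑ d, ∑ e, (g p)⁻¹ d e * (g p e c * κ d)) := by
    simp only [covDeriv_confKahler hg hu hu0 hk hT hp, ← hw]
    simp only [Finset.mul_sum (a := logd u c p), Finset.sum_mul, ← Finset.sum_add_distrib,
      ← Finset.sum_sub_distrib, ← Finset.sum_neg_distrib, Finset.mul_sum (a := t * (u p)⁻¹)]
    refine Finset.sum_congr rfl fun d _ => Finset.sum_congr rfl fun e _ => ?_
    change _ * (t * (u p)⁻¹ * (_ + _ - _ - _ * κ c + _ * κ d)) = _
    ring
  rw [h6, h1, h2, h3, h4, h5]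
  ring

theorem isConformalKillingYanoOn_confKahler (hg : IsMetricOn U g) (hu : ContDiffOn ℝ ∞ u U)
    (hu0 : ∀ q ∈ U, u q ≠ 0) (hk : IsKahlerOn U J (conf u g))
    (hT : ∀ q ∈ U, T q = (t * (u q)⁻¹) • (J q * g q)) : IsConformalKillingYanoOn U g T where
  smooth := by
    have h : SmoothOn U fun q => (t * (u q)⁻¹) • (J q * g q) := fun a b =>
      (contDiffOn_const.mul (hu.inv hu0)).mul ((hk.complexStructure.smooth.mul hg.smooth) a b)
    exact h.congr hT
  antisymm p hp a b := by
    have h := congrFun (congrFun (transpose_J_mul_metric hg hk hu0 hp) b) a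
    rw [hT p hp]
    simp only [Matrix.smul_apply, smul_eq_mul]
    rw [Matrix.transpose_apply, Matrix.neg_apply] at h
    rw [h]; ring
  eqn p hp a b c := by
    have hwa : ∀ x y, (J p * g p) x y = -(J p * g p) y x := fun x y =>
      congrFun (congrFun (transpose_J_mul_metric hg hk hu0 hp) y) x
    rw [div_confKahler hg hu hu0 hk hT hp, div_confKahler hg hu hu0 hk hT hp]
    simp only [covDeriv_confKahler hg hu hu0 hk hT hp]
    rw [hwa b a, hwa c a, hwa c b, hg.symm_apply hp b a, hg.symm_apply hp c a,
      hg.symm_apply hp c b]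
    ring

/-- The divergence of the conformal Killing-Yano form `-(1/3) u⁻¹ J g` is the symplectic gradient of
`u`. -/
theorem divergence_confKahler (hg : IsMetricOn U g) (hu : ContDiffOn ℝ ∞ u U)
    (hu0 : ∀ q ∈ U, u q ≠ 0) (hk : IsKahlerOn U J (conf u g))
    (hT : ∀ q ∈ U, T q = (-(1 / 3) * (u q)⁻¹) • (J q * g q)) (hp : p ∈ U) (a : Fin 4) :
    ∑ c, (g p)⁻¹ a c * ∑ b, ∑ d, (g p)⁻¹ b d * covDeriv g T p d c b
      = ∑ c, ∑ b, (conf u g p)⁻¹ a c * J p c b * pd b u p := by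
  have h0 := hu0 p hp
  have hcky := isConformalKillingYanoOn_confKahler hg hu hu0 hk hT
  have hanti : ∀ d b c, covDeriv g T p d c b = -covDeriv g T p d b c := fun d b c => by
    have hpd : pd d (fun q => T q c b) p = -pd d (fun q => T q b c) p := by
      rw [pd_congr hg.isOpen (fun q hq => hcky.antisymm q hq c b) hp, pd_neg]
    simp only [covDeriv, hpd]
    rw [neg_sub, sub_eq_add_neg, add_comm, sub_eq_add_neg, ← Finset.sum_neg_distrib]
    congr 1
    refine Finset.sum_congr rfl fun e _ => ?_
    rw [hcky.antisymm p hp e b, hcky.antisymm p hp c e]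
    ring
  -- The normalization `t = -1/3` turns the factor `-3 t` of `div_confKahler` into 1.
  have hκ : ∀ c, ∑ b, ∑ d, (g p)⁻¹ b d * covDeriv g T p d c b
      = (u p)⁻¹ * ∑ b, J p c b * logd u b p := fun c => by
    have h1 : ∑ b, ∑ d, (g p)⁻¹ b d * covDeriv g T p d c b
        = -∑ b, ∑ d, (g p)⁻¹ b d * covDeriv g T p d b c := by
      simp only [← Finset.sum_neg_distrib]
      exact Finset.sum_congr rfl fun b _ => Finset.sum_congr rfl fun d _ => by
        rw [hanti]; ring
    have hwh : J p * g p * (g p)⁻¹ = J p := by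
      rw [Matrix.mul_assoc, hg.mul_inv hp, Matrix.mul_one]
    have h2 : ∑ e, logGrad u g e p * (J p * g p) e c = -∑ b, J p c b * logd u b p := by
      have h3 : ∑ b, J p c b * logd u b p = ((J p * g p) *ᵥ ((g p)⁻¹ *ᵥ fun b => logd u b p)) c := by
        rw [Matrix.mulVec_mulVec, hwh]; rfl
      rw [h3, Matrix.mulVec, dotProduct, ← Finset.sum_neg_distrib]
      refine Finset.sum_congr rfl fun e _ => ?_
      have h4 := congrFun (congrFun (transpose_J_mul_metric hg hk hu0 hp) c) e
      rw [Matrix.transpose_apply, Matrix.neg_apply] at h4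
      rw [h4]
      change logGrad u g e p * _ = -(_ * logGrad u g e p)
      ring
    rw [h1, div_confKahler hg hu hu0 hk hT hp, h2]
    ring
  simp only [hκ, conf_inv hg hp h0, Matrix.smul_apply, smul_eq_mul, logd, Finset.mul_sum]
  refine Finset.sum_congr rfl fun c _ => Finset.sum_congr rfl fun b _ => ?_
  field_simp

end ConformallyKahler

/-! ### Integrability -/

section Integrability

variable {U : Set Pt} {p : Pt} {J : MatField}

theorem nijenhuis_eq_mpd (J : MatField) (p : Pt) (a b c : Fin 4) : nijenhuis J p a b c
    = ∑ d, J p a d * mpd d J p b c - ∑ d, J p b d * mpd d J p a c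
      - (mpd a J p * J p) b c + (mpd b J p * J p) a c := by
  simp only [nijenhuis, Matrix.mul_apply, mpd_apply, ← Finset.sum_sub_distrib,
    ← Finset.sum_add_distrib]
  exact Finset.sum_congr rfl fun d _ => by ring

theorem nijenhuis_antisymm (J : MatField) (p : Pt) (a b c : Fin 4) :
    nijenhuis J p a b c = -nijenhuis J p b a c := by
  rw [nijenhuis_eq_mpd, nijenhuis_eq_mpd]
  ring

/-- The Nijenhuis tensor is `J`-antilinear. -/
theorem sum_J_nijenhuis (hU : IsOpen U) (hJ : SmoothOn U J) (hsq : ∀ q ∈ U, J q * J q = -1)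
    (hp : p ∈ U) (e b c : Fin 4) :
    ∑ a, J p e a * nijenhuis J p a b c = -∑ f, nijenhuis J p e b f * J p f c := by
  have hD : ∀ d, J p * mpd d J p = -(mpd d J p * J p) := fun d => by
    have h := mpd_mul hU hJ hJ hp d
    rw [mpd_congr hU (fun q hq => hsq q hq) hp, mpd_const] at h
    exact eq_neg_of_add_eq_zero_right h.symm
  have e1 : ∑ a, ∑ d, J p e a * (J p a d * mpd d J p b c) = -mpd e J p b c := by
    have h : ∀ d, ∑ a, J p e a * (J p a d * mpd d J p b c)
        = (-1 : Matrix (Fin 4) (Fin 4) ℝ) e d * mpd d J p b c := fun d => by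
      rw [← hsq p hp, Matrix.mul_apply, Finset.sum_mul]
      exact Finset.sum_congr rfl fun a _ => by ring
    rw [Finset.sum_comm]
    simp only [h]
    simp [Matrix.one_apply]
  have e2 : ∑ a, ∑ d, J p e a * (J p b d * mpd d J p a c)
      = -∑ d, J p b d * (mpd d J p * J p) e c := by
    rw [Finset.sum_comm, ← Finset.sum_neg_distrib]
    refine Finset.sum_congr rfl fun d _ => ?_
    rw [← mul_neg, ← Matrix.neg_apply, ← hD, Matrix.mul_apply, Finset.mul_sum]
    exact Finset.sum_congr rfl fun a _ => by ring
  have e3 : ∑ a, J p e a * (mpd b J p * J p) a c = mpd b J p e c := by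
    have h : J p * (mpd b J p * J p) = mpd b J p := by
      rw [← Matrix.mul_assoc, hD, Matrix.neg_mul, Matrix.mul_assoc, hsq p hp]; simp
    conv_rhs => rw [← h]
    rfl
  have e4 : ∀ a b, ∑ f, (mpd a J p * J p) b f * J p f c = -mpd a J p b c := fun a b => by
    rw [← Matrix.mul_apply, Matrix.mul_assoc, hsq p hp]; simp
  have e5 : ∀ a b, ∑ f, ∑ d, J p a d * mpd d J p b f * J p f c
      = ∑ d, J p a d * (mpd d J p * J p) b c := fun a b => by
    rw [Finset.sum_comm]
    refine Finset.sum_congr rfl fun d _ => ?_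
    rw [Matrix.mul_apply, Finset.mul_sum]
    exact Finset.sum_congr rfl fun a _ => by ring
  have e6 : ∑ a, J p e a * (mpd a J p * J p) b c = ∑ d, J p e d * (mpd d J p * J p) b c := rfl
  simp only [nijenhuis_eq_mpd, mul_add, mul_sub, add_mul, sub_mul, Finset.sum_add_distrib,
    Finset.sum_sub_distrib, Finset.mul_sum, Finset.sum_mul, e1, e2, e3, e4, e5]
  ring

/-- If `J` exchanges the distributions spanned by `∂₀, ∂₁` and by `∂₂, ∂₃`, it suffices to compute
the Nijenhuis tensor on `∂₀, ∂₁`. -/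
theorem nijenhuis_eq_zero (hU : IsOpen U) (hJ : SmoothOn U J) (hsq : ∀ q ∈ U, J q * J q = -1)
    (hp : p ∈ U) (h22 : J p 2 2 = 0) (h23 : J p 2 3 = 0) (h32 : J p 3 2 = 0) (h33 : J p 3 3 = 0)
    (h01 : ∀ c, nijenhuis J p 0 1 c = 0) (a b c : Fin 4) : nijenhuis J p a b c = 0 := by
  have hd : ∀ a c, nijenhuis J p a a c = 0 := fun a c => by
    linarith [nijenhuis_antisymm J p a a c]
  have h10 : ∀ c, nijenhuis J p 1 0 c = 0 := fun c => by rw [nijenhuis_antisymm, h01, neg_zero]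
  have hN : ∀ i b c, nijenhuis J p i b c
      = -∑ e, J p i e * ∑ a, J p e a * nijenhuis J p a b c := fun i b c => by
    have h : ∑ e, J p i e * ∑ a, J p e a * nijenhuis J p a b c
        = ∑ a, (J p * J p) i a * nijenhuis J p a b c := by
      simp only [Finset.mul_sum, Matrix.mul_apply, Finset.sum_mul]
      rw [Finset.sum_comm]
      exact Finset.sum_congr rfl fun a _ => Finset.sum_congr rfl fun e _ => by ring
    rw [h, hsq p hp]
    simp [Matrix.one_apply]
  -- For `i = 2, 3` the vector `J ∂_i` lies in the span of `∂₀, ∂₁`, and `∂_i = -J (J ∂_i)`.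
  -- Antilinearity therefore carries the vanishing from the first two directions to the last two.
  have hred : ∀ b, (∀ c, nijenhuis J p 0 b c = 0) → (∀ c, nijenhuis J p 1 b c = 0) →
      ∀ a c, nijenhuis J p a b c = 0 := by
    intro b h0 h1 a c
    have hz : ∀ e, (∀ f, nijenhuis J p e b f = 0) → ∑ a, J p e a * nijenhuis J p a b c = 0 :=
      fun e he => by rw [sum_J_nijenhuis hU hJ hsq hp]; simp [he]
    fin_cases a
    · exact h0 c
    · exact h1 c
    · refine (hN 2 b c).trans ?_
      rw [Fin.sum_univ_four, hz 0 h0, hz 1 h1, h22, h23]; ring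
    · refine (hN 3 b c).trans ?_
      rw [Fin.sum_univ_four, hz 0 h0, hz 1 h1, h32, h33]; ring
  have hb0 := hred 0 (hd 0) h10
  have hb1 := hred 1 h01 (hd 1)
  exact hred b (fun c => by rw [nijenhuis_antisymm, hb0, neg_zero])
    (fun c => by rw [nijenhuis_antisymm, hb1, neg_zero]) a c

/-- `J ∂_i` is holomorphic if `J` is integrable and does not depend on the `i`-th coordinate. -/
theorem lieDerivEndo_eq_zero (hU : IsOpen U) (hJ : SmoothOn U J)
    {V : Pt → Fin 4 → ℝ} {κ : ℝ} {i : Fin 4} (hV : ∀ q ∈ U, ∀ c, V q c = κ * J q i c) (hp : p ∈ U)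
    (hi : mpd i J p = 0) (hN : ∀ a c, nijenhuis J p i a c = 0) (a b : Fin 4) :
    lieDerivEndo V J p a b = 0 := by
  have hpd : ∀ x c, pd x (fun q => V q c) p = κ * mpd x J p i c := fun x c => by
    rw [pd_congr hU (fun q hq => hV q hq c) hp,
      pd_const_mul _ _ (hJ.differentiableAt hU hp i c), mpd_apply]
  have hz : ∀ a d, pd i (fun q => J q a d) p = 0 := fun a d => congrFun (congrFun hi a) d
  have h := hN a b
  simp only [nijenhuis, hz, zero_sub] at h
  rw [← mul_zero κ, ← h, lieDerivEndo, Finset.mul_sum]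
  refine Finset.sum_congr rfl fun c _ => ?_
  rw [hpd, hpd, hV p hp, mpd_apply, mpd_apply]
  ring

end Integrability

end Chart

end

noncomputable section

namespace Chart

/-! ### Explicit partial derivatives -/

/-- `f` is differentiable at `p`, with `∂_i f = f'`. -/
def HasPd (i : Fin 4) (f : Pt → ℝ) (f' : ℝ) (p : Pt) : Prop :=
  ∃ L : Pt →L[ℝ] ℝ, HasFDerivAt f L p ∧ L (Pi.single i 1) = f'

namespace HasPd

variable {i : Fin 4} {f h : Pt → ℝ} {f' h' : ℝ} {p : Pt}

theorem pd_eq (hf : HasPd i f f' p) : pd i f p = f' := by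
  obtain ⟨L, hL, rfl⟩ := hf
  rw [pd, hL.fderiv]

theorem of_differentiableAt (hf : DifferentiableAt ℝ f p) : HasPd i f (pd i f p) p :=
  ⟨_, hf.hasFDerivAt, rfl⟩

theorem congr_deriv (hf : HasPd i f f' p) (e : f' = h') : HasPd i f h' p := e ▸ hf

theorem const (c : ℝ) : HasPd i (fun _ => c) 0 p := ⟨0, hasFDerivAt_const c p, rfl⟩

theorem coord (j : Fin 4) : HasPd i (fun q => q j) (if j = i then 1 else 0) p :=
  ⟨ContinuousLinearMap.proj j, (ContinuousLinearMap.proj (R := ℝ) (φ := fun _ : Fin 4 => ℝ)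
    j).hasFDerivAt, by simp [Pi.single_apply]⟩

theorem add (hf : HasPd i f f' p) (hh : HasPd i h h' p) :
    HasPd i (fun q => f q + h q) (f' + h') p := by
  obtain ⟨L, hL, rfl⟩ := hf
  obtain ⟨M, hM, rfl⟩ := hh
  exact ⟨_, hL.fun_add hM, rfl⟩

theorem sub (hf : HasPd i f f' p) (hh : HasPd i h h' p) :
    HasPd i (fun q => f q - h q) (f' - h') p := by
  obtain ⟨L, hL, rfl⟩ := hf
  obtain ⟨M, hM, rfl⟩ := hh
  exact ⟨_, hL.fun_sub hM, rfl⟩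

theorem neg (hf : HasPd i f f' p) : HasPd i (fun q => -f q) (-f') p := by
  obtain ⟨L, hL, rfl⟩ := hf
  exact ⟨_, hL.fun_neg, rfl⟩

theorem mul (hf : HasPd i f f' p) (hh : HasPd i h h' p) :
    HasPd i (fun q => f q * h q) (f' * h p + f p * h') p := by
  obtain ⟨L, hL, rfl⟩ := hf
  obtain ⟨M, hM, rfl⟩ := hh
  refine ⟨_, hL.fun_mul hM, ?_⟩
  simp
  ring

theorem pow (hf : HasPd i f f' p) (n : ℕ) :
    HasPd i (fun q => f q ^ n) (n * f p ^ (n - 1) * f') p := by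
  obtain ⟨L, hL, rfl⟩ := hf
  exact ⟨_, (hasDerivAt_pow n (f p)).comp_hasFDerivAt p hL, rfl⟩

theorem div (hf : HasPd i f f' p) (hh : HasPd i h h' p) (h0 : h p ≠ 0) :
    HasPd i (fun q => f q / h q) ((f' * h p - f p * h') / h p ^ 2) p := by
  obtain ⟨L, hL, rfl⟩ := hf
  obtain ⟨M, hM, rfl⟩ := hh
  have hinv := (hasDerivAt_inv h0).comp_hasFDerivAt p hM
  refine ⟨_, hL.fun_mul hinv, ?_⟩
  simp
  field_simp
  ring

/-- The coefficients may depend on the other coordinates. This differentiates the two-variable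
polynomials `Q₁`, `Q₂` after sorting them by powers of one variable. -/
theorem poly {A₀ A₁ A₂ A₃ A₄ : Pt → ℝ} (h₀ : HasPd i A₀ 0 p) (h₁ : HasPd i A₁ 0 p)
    (h₂ : HasPd i A₂ 0 p) (h₃ : HasPd i A₃ 0 p) (h₄ : HasPd i A₄ 0 p)
    (hf : ∀ q, f q = A₀ q + A₁ q * q i + A₂ q * q i ^ 2 + A₃ q * q i ^ 3 + A₄ q * q i ^ 4) :
    HasPd i f (A₁ p + 2 * A₂ p * p i + 3 * A₃ p * p i ^ 2 + 4 * A₄ p * p i ^ 3) p := by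
  obtain rfl : f = _ := funext hf
  have hc : HasPd i (fun q => q i) 1 p := (coord i).congr_deriv (if_pos rfl)
  refine ((((h₀.add (h₁.mul hc)).add (h₂.mul (hc.pow 2))).add (h₃.mul (hc.pow 3))).add
    (h₄.mul (hc.pow 4))).congr_deriv ?_
  norm_num
  ring

end HasPd

end Chart

namespace ChenTeo

open Chart

variable (P : ChenTeo) {p : Pt}

/-! ### The polynomials of the Chen-Teo metrics -/

/-- The linear form `ν x + y`. -/
def ell (p : Pt) : ℝ := P.ν * p 0 + p 1

/-- The coordinate difference `x - y`. -/
def diff (p : Pt) : ℝ := p 0 - p 1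

/-- The polynomial `Q₁ = (x - y) (G y (x - y) + H x Y) / F`. -/
def Q₁ (p : Pt) : ℝ :=
  (P.a₀ * (1 - 2 * P.ν + P.ν ^ 2) * p 1 + P.a₁ * (1 - 2 * P.ν) * p 1 ^ 2
      + P.a₂ * (1 - 2 * P.ν) * p 1 ^ 3 + P.a₃ * p 1 ^ 4)
    + (2 * P.ν * (1 - P.ν) * P.a₀ + 2 * P.ν * P.a₁ * p 1 + 2 * P.ν * P.a₂ * p 1 ^ 2
      - 2 * P.a₃ * P.ν * p 1 ^ 3 + 2 * (1 - P.ν) * P.a₄ * p 1 ^ 4) * p 0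
    + (-(P.ν ^ 2 * P.a₁) - P.ν ^ 2 * P.a₂ * p 1 + P.ν * (2 - P.ν) * P.a₃ * p 1 ^ 2
      - (1 - P.ν) ^ 2 * P.a₄ * p 1 ^ 3) * p 0 ^ 2

/-- The polynomial `Q₂ = (x - y) (G x (x - y) + H y X) / F`. -/
def Q₂ (p : Pt) : ℝ :=
  (-((1 - P.ν) ^ 2 * P.a₀) * p 0 + P.ν * (2 - P.ν) * P.a₁ * p 0 ^ 2 - P.ν ^ 2 * P.a₂ * p 0 ^ 3
      - P.ν ^ 2 * P.a₃ * p 0 ^ 4)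
    + (2 * (1 - P.ν) * P.a₀ - 2 * P.ν * P.a₁ * p 0 + 2 * P.ν * P.a₂ * p 0 ^ 2
      + 2 * P.ν * P.a₃ * p 0 ^ 3 + 2 * P.ν * (1 - P.ν) * P.a₄ * p 0 ^ 4) * p 1
    + (P.a₁ + (1 - 2 * P.ν) * P.a₂ * p 0 + (1 - 2 * P.ν) * P.a₃ * p 0 ^ 2
      + (1 - P.ν) ^ 2 * P.a₄ * p 0 ^ 3) * p 1 ^ 2

/-- The derivative of the quartic. -/
def quartic' (t : ℝ) : ℝ := P.a₁ + 2 * P.a₂ * t + 3 * P.a₃ * t ^ 2 + 4 * P.a₄ * t ^ 3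

/-- The second derivative of the quartic. -/
def quartic'' (t : ℝ) : ℝ := 2 * P.a₂ + 6 * P.a₃ * t + 12 * P.a₄ * t ^ 2

/-- Exact divisibility by `F`. This, with its companion for `Q₂`, is what makes the complex
structure and the Kähler form free of `F` and `G`. -/
theorem F_mul_Q₁ (p : Pt) :
    P.F p * P.Q₁ p = diff p * (P.G p * p 1 * diff p + P.H p * p 0 * P.Y p) := by
  simp only [F, Q₁, diff, G, H, X, Y, quartic]
  ring

theorem F_mul_Q₂ (p : Pt) :
    P.F p * P.Q₂ p = diff p * (P.G p * p 0 * diff p + P.H p * p 1 * P.X p) := by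
  simp only [F, Q₂, diff, G, H, X, Y, quartic]
  ring

/-- One identity with two uses: it gives `J² = -1`, and it identifies the Pfaffian of the Kähler
form with the volume density. -/
theorem Q₂_sub_Q₁ (p : Pt) : p 1 * P.Q₂ p - p 0 * P.Q₁ p = P.H p * diff p := by
  simp only [Q₁, Q₂, diff, H]
  ring

theorem hasPd_coord_ne {i j : Fin 4} (h : j ≠ i) : HasPd i (fun q => q j) 0 p :=
  (HasPd.coord j).congr_deriv (if_neg h)

theorem hasPd_coord_self (i : Fin 4) : HasPd i (fun q => q i) 1 p :=
  (HasPd.coord i).congr_deriv (if_pos rfl)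

theorem hasPd_of_coord_ne {i j : Fin 4} (h : j ≠ i) {f : ℝ → ℝ} (hf : Differentiable ℝ f) :
    HasPd i (fun q => f (q j)) 0 p := by
  have hp := (ContinuousLinearMap.proj (R := ℝ) (φ := fun _ : Fin 4 => ℝ) j).hasFDerivAt (x := p)
  refine ⟨_, (hf (p j)).hasDerivAt.comp_hasFDerivAt p hp, ?_⟩
  simp [h]

theorem hasPd_quartic (i : Fin 4) : HasPd i (fun q => P.quartic (q i)) (P.quartic' (p i)) p := 
  (HasPd.poly (HasPd.const P.a₀) (HasPd.const P.a₁) (HasPd.const P.a₂) (HasPd.const P.a₃)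
    (HasPd.const P.a₄) fun _ => rfl)

theorem hasPd_quartic' (i : Fin 4) :
    HasPd i (fun q => P.quartic' (q i)) (P.quartic'' (p i)) p := by
  refine (HasPd.poly (HasPd.const P.a₁) (HasPd.const (2 * P.a₂)) (HasPd.const (3 * P.a₃))
    (HasPd.const (4 * P.a₄)) (HasPd.const 0) fun _ => ?_).congr_deriv ?_
  · simp only [quartic']; ring
  · simp only [quartic'']; ring

theorem hasPd_X : HasPd 0 P.X (P.quartic' (p 0)) p := P.hasPd_quartic 0

theorem hasPd_Y : HasPd 1 P.Y (P.quartic' (p 1)) p := P.hasPd_quartic 1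

theorem hasPd_X_of_ne {i : Fin 4} (hi : 0 ≠ i) : HasPd i P.X 0 p :=
  hasPd_of_coord_ne hi (by unfold quartic; fun_prop)

theorem hasPd_Y_of_ne {i : Fin 4} (hi : 1 ≠ i) : HasPd i P.Y 0 p :=
  hasPd_of_coord_ne hi (by unfold quartic; fun_prop)

theorem hasPd_ell_zero : HasPd 0 P.ell P.ν p :=
  (((HasPd.const P.ν).mul (hasPd_coord_self 0)).add
    (hasPd_coord_ne (by decide))).congr_deriv (by ring)

theorem hasPd_ell_one : HasPd 1 P.ell 1 p :=
  (((HasPd.const P.ν).mul (hasPd_coord_ne (by decide))).add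
    (hasPd_coord_self 1)).congr_deriv (by ring)

theorem hasPd_diff_zero : HasPd 0 diff 1 p :=
  ((hasPd_coord_self 0).sub (hasPd_coord_ne (by decide))).congr_deriv (by ring)

theorem hasPd_diff_one : HasPd 1 diff (-1) p :=
  ((hasPd_coord_ne (by decide)).sub (hasPd_coord_self 1)).congr_deriv (by ring)

theorem contDiff_coord (i : Fin 4) : ContDiff ℝ ∞ fun q : Pt => q i := by fun_prop

theorem contDiff_X : ContDiff ℝ ∞ P.X := by unfold X quartic; fun_prop

theorem contDiff_Y : ContDiff ℝ ∞ P.Y := by unfold Y quartic; fun_prop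

theorem contDiff_H : ContDiff ℝ ∞ P.H := by unfold H; fun_prop

theorem contDiff_ell : ContDiff ℝ ∞ P.ell := by unfold ell; fun_prop

theorem contDiff_diff : ContDiff ℝ ∞ diff := by unfold diff; fun_prop

theorem contDiff_F : ContDiff ℝ ∞ P.F := by unfold F X Y quartic; fun_prop

theorem contDiff_G : ContDiff ℝ ∞ P.G := by unfold G X Y quartic; fun_prop

theorem contDiff_Q₁ : ContDiff ℝ ∞ P.Q₁ := by unfold Q₁; fun_prop

theorem contDiff_Q₂ : ContDiff ℝ ∞ P.Q₂ := by unfold Q₂; fun_prop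

theorem contDiff_quartic' (i : Fin 4) : ContDiff ℝ ∞ fun q : Pt => P.quartic' (q i) := by
  unfold quartic'; fun_prop

/-- `∂_x (Q₁ / (x - y)²) = -2 (1 - ν) (ν x + y) Y / (x - y)³`, cleared of denominators. -/
theorem diff_mul_pd_Q₁ : diff p * pd 0 P.Q₁ p = 2 * P.Q₁ p - 2 * (1 - P.ν) * P.ell p * P.Y p := by
  rw [(HasPd.poly (hasPd_of_coord_ne (i := 0) (j := 1) (by decide) (f := fun y =>
      P.a₀ * (1 - 2 * P.ν + P.ν ^ 2) * y + P.a₁ * (1 - 2 * P.ν) * y ^ 2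
      + P.a₂ * (1 - 2 * P.ν) * y ^ 3 + P.a₃ * y ^ 4) (by fun_prop))
    (hasPd_of_coord_ne (j := 1) (by decide) (f := fun y =>
      2 * P.ν * (1 - P.ν) * P.a₀ + 2 * P.ν * P.a₁ * y + 2 * P.ν * P.a₂ * y ^ 2
      - 2 * P.a₃ * P.ν * y ^ 3 + 2 * (1 - P.ν) * P.a₄ * y ^ 4) (by fun_prop))
    (hasPd_of_coord_ne (j := 1) (by decide) (f := fun y =>
      -(P.ν ^ 2 * P.a₁) - P.ν ^ 2 * P.a₂ * y + P.ν * (2 - P.ν) * P.a₃ * y ^ 2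
      - (1 - P.ν) ^ 2 * P.a₄ * y ^ 3) (by fun_prop))
    (HasPd.const 0) (HasPd.const 0) fun _ => by simp only [Q₁]; ring : HasPd 0 P.Q₁ _ p).pd_eq]
  simp only [Q₁, diff, ell, Y, quartic]
  ring

/-- `∂_y (Q₂ / (x - y)²) = 2 (1 - ν) (ν x + y) X / (x - y)³`, cleared of denominators. -/
theorem diff_mul_pd_Q₂ : diff p * pd 1 P.Q₂ p = 2 * (1 - P.ν) * P.ell p * P.X p - 2 * P.Q₂ p := by
  rw [(HasPd.poly (hasPd_of_coord_ne (i := 1) (j := 0) (by decide) (f := fun x =>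
      -((1 - P.ν) ^ 2 * P.a₀) * x + P.ν * (2 - P.ν) * P.a₁ * x ^ 2 - P.ν ^ 2 * P.a₂ * x ^ 3
      - P.ν ^ 2 * P.a₃ * x ^ 4) (by fun_prop))
    (hasPd_of_coord_ne (j := 0) (by decide) (f := fun x =>
      2 * (1 - P.ν) * P.a₀ - 2 * P.ν * P.a₁ * x + 2 * P.ν * P.a₂ * x ^ 2
      + 2 * P.ν * P.a₃ * x ^ 3 + 2 * P.ν * (1 - P.ν) * P.a₄ * x ^ 4) (by fun_prop))
    (hasPd_of_coord_ne (j := 0) (by decide) (f := fun x =>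
      P.a₁ + (1 - 2 * P.ν) * P.a₂ * x + (1 - 2 * P.ν) * P.a₃ * x ^ 2
      + (1 - P.ν) ^ 2 * P.a₄ * x ^ 3) (by fun_prop))
    (HasPd.const 0) (HasPd.const 0) fun _ => by simp only [Q₂]; ring : HasPd 1 P.Q₂ _ p).pd_eq]
  simp only [Q₂, diff, ell, X, quartic]
  ring

/-- `∂_y (Q₁ / (x - y)² (ν x + y)²) + ∂_x (Q₂ / (x - y)² (ν x + y)²) = 0`, cleared of
denominators. -/
theorem pd_Q₁_add_pd_Q₂ : diff p * P.ell p * (pd 1 P.Q₁ p + pd 0 P.Q₂ p)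
    = 2 * (P.Q₁ p * (diff p - P.ell p) + P.Q₂ p * (P.ell p + P.ν * diff p)) := by
  rw [(HasPd.poly
    (hasPd_of_coord_ne (i := 1) (j := 0) (by decide) (f := fun x =>
      2 * P.ν * (1 - P.ν) * P.a₀ * x - P.ν ^ 2 * P.a₁ * x ^ 2) (by fun_prop))
    (hasPd_of_coord_ne (j := 0) (by decide) (f := fun x => P.a₀ * (1 - 2 * P.ν + P.ν ^ 2)
      + 2 * P.ν * P.a₁ * x - P.ν ^ 2 * P.a₂ * x ^ 2) (by fun_prop))
    (hasPd_of_coord_ne (j := 0) (by decide) (f := fun x => P.a₁ * (1 - 2 * P.ν)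
      + 2 * P.ν * P.a₂ * x + P.ν * (2 - P.ν) * P.a₃ * x ^ 2) (by fun_prop))
    (hasPd_of_coord_ne (j := 0) (by decide) (f := fun x => P.a₂ * (1 - 2 * P.ν)
      - 2 * P.a₃ * P.ν * x - (1 - P.ν) ^ 2 * P.a₄ * x ^ 2) (by fun_prop))
    (hasPd_of_coord_ne (j := 0) (by decide) (f := fun x => P.a₃
      + 2 * (1 - P.ν) * P.a₄ * x) (by fun_prop))
    fun _ => by simp only [Q₁]; ring : HasPd 1 P.Q₁ _ p).pd_eq,
    (HasPd.poly
    (hasPd_of_coord_ne (i := 0) (j := 1) (by decide) (f := fun y =>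
      2 * (1 - P.ν) * P.a₀ * y + P.a₁ * y ^ 2) (by fun_prop))
    (hasPd_of_coord_ne (j := 1) (by decide) (f := fun y => -((1 - P.ν) ^ 2 * P.a₀)
      - 2 * P.ν * P.a₁ * y + (1 - 2 * P.ν) * P.a₂ * y ^ 2) (by fun_prop))
    (hasPd_of_coord_ne (j := 1) (by decide) (f := fun y => P.ν * (2 - P.ν) * P.a₁
      + 2 * P.ν * P.a₂ * y + (1 - 2 * P.ν) * P.a₃ * y ^ 2) (by fun_prop))
    (hasPd_of_coord_ne (j := 1) (by decide) (f := fun y => -(P.ν ^ 2 * P.a₂)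
      + 2 * P.ν * P.a₃ * y + (1 - P.ν) ^ 2 * P.a₄ * y ^ 2) (by fun_prop))
    (hasPd_of_coord_ne (j := 1) (by decide) (f := fun y => -(P.ν ^ 2 * P.a₃)
      + 2 * P.ν * (1 - P.ν) * P.a₄ * y) (by fun_prop))
    fun _ => by simp only [Q₂]; ring : HasPd 0 P.Q₂ _ p).pd_eq]
  simp only [Q₁, Q₂, diff, ell]
  ring

/-! ### The domain -/

section Domain

variable {P} (hp : p ∈ P.domain)

include hp

theorem diff_pos : 0 < diff p := sub_pos.2 hp.1

theorem X_pos : 0 < P.X p := hp.2.1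

theorem Y_neg : P.Y p < 0 := hp.2.2.1

theorem H_pos : 0 < P.H p := hp.2.2.2

/-- `νx + y` is a factor of `H`, so positivity of `H` makes the conformal factor finite throughout
the domain. -/
theorem ell_ne_zero : P.ell p ≠ 0 := fun h => by
  have := H_pos hp
  rw [H, ← ell, h, zero_mul] at this
  exact this.false

theorem F_pos : 0 < P.F p := by
  have hX := X_pos hp
  have hY := Y_neg hp
  have hxy : p 1 < p 0 := hp.1
  rw [F]
  -- Both terms of `F` are nonnegative, and `y < x` prevents `x` and `y` from vanishing together.
  rcases eq_or_ne (p 1) 0 with h | h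
  · have : 0 < p 0 ^ 2 := by positivity [h ▸ hxy]
    nlinarith
  · have : 0 < p 1 ^ 2 := by positivity
    nlinarith [mul_pos hX this, mul_nonneg (sq_nonneg (p 0)) (neg_pos.2 hY).le]

end Domain

theorem isOpen_domain : IsOpen P.domain :=
  ((isOpen_lt (continuous_apply 1) (continuous_apply 0)).inter
    ((isOpen_lt continuous_const P.contDiff_X.continuous).inter
      ((isOpen_lt P.contDiff_Y.continuous continuous_const).inter
        (isOpen_lt continuous_const P.contDiff_H.continuous))))

end ChenTeo

end

/-! ### Block diagonal matrices, and the metric and complex structure in coordinates -/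

noncomputable section

namespace Chart

open Matrix

theorem det_blocks (a b c d e : ℝ) :
    (!![a, 0, 0, 0; 0, b, 0, 0; 0, 0, c, d; 0, 0, d, e]).det = a * b * (c * e - d ^ 2) := by
  simp [Matrix.det_succ_row_zero, Fin.sum_univ_succ, Fin.succAbove]
  ring

theorem posDef_blocks {a b c d e : ℝ} (ha : 0 < a) (hb : 0 < b) (hc : 0 < c)
    (hd : 0 < c * e - d ^ 2) :
    (!![a, 0, 0, 0; 0, b, 0, 0; 0, 0, c, d; 0, 0, d, e]).PosDef := by
  refine Matrix.PosDef.of_dotProduct_mulVec_pos ?_ fun v hv => ?_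
  · ext i j
    fin_cases i <;> fin_cases j <;> rfl
  · have hq : star v ⬝ᵥ (!![a, 0, 0, 0; 0, b, 0, 0; 0, 0, c, d; 0, 0, d, e]) *ᵥ v
        = a * v 0 ^ 2 + b * v 1 ^ 2 + (c * v 2 + d * v 3) ^ 2 / c
          + (c * e - d ^ 2) / c * v 3 ^ 2 := by
      simp [Matrix.mulVec, dotProduct, Fin.sum_univ_four]
      field_simp
      ring
    have hd' := div_pos hd hc
    rw [hq]
    by_contra h
    have h0 : 0 ≤ a * v 0 ^ 2 := by positivity
    have h1 : 0 ≤ b * v 1 ^ 2 := by positivity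
    have h2 : 0 ≤ (c * v 2 + d * v 3) ^ 2 / c := by positivity
    have h3 : 0 ≤ (c * e - d ^ 2) / c * v 3 ^ 2 := by positivity
    have e0 : a * v 0 ^ 2 = 0 := by linarith
    have e1 : b * v 1 ^ 2 = 0 := by linarith
    have e2 : (c * v 2 + d * v 3) ^ 2 / c = 0 := by linarith
    have e3 : (c * e - d ^ 2) / c * v 3 ^ 2 = 0 := by linarith
    simp only [mul_eq_zero, div_eq_zero_iff, ha.ne', hb.ne', hc.ne', hd.ne', false_or, or_false,
      ne_eq, OfNat.ofNat_ne_zero, not_false_eq_true, pow_eq_zero_iff] at e0 e1 e2 e3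
    rw [e3, mul_zero, add_zero, mul_eq_zero, or_iff_right hc.ne'] at e2
    refine hv (funext fun i => ?_)
    fin_cases i <;> assumption

end Chart

namespace ChenTeo

open Chart Matrix

variable (P : ChenTeo) {p : Pt}

/-! ### The metric and the complex structure in coordinates -/

/-- The real 2-form `2 i Ẑ¹`, which is `J_a^c g_{cb}`. -/
def twoForm : MatField := fun p =>
  let r : ℝ := Real.sqrt P.k
  !![0, 0, r * p 1 / diff p ^ 2, r * P.Q₁ p / diff p ^ 4;
     0, 0, -(r * p 0 / diff p ^ 2), -(r * P.Q₂ p / diff p ^ 4);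
     -(r * p 1 / diff p ^ 2), r * p 0 / diff p ^ 2, 0, 0;
     -(r * P.Q₁ p / diff p ^ 4), r * P.Q₂ p / diff p ^ 4, 0, 0]

/-- The complex structure in coordinates. -/
def matJ : MatField := fun p =>
  let r : ℝ := Real.sqrt P.k
  !![0, 0, r * (P.Q₂ p / (diff p ^ 2 * P.X p)), -(r * (p 0 / P.X p));
     0, 0, -(r * (P.Q₁ p / (diff p ^ 2 * P.Y p))), r * (p 1 / P.Y p);
     -(p 1 * P.X p * diff p / (r * P.H p)), -(p 0 * P.Y p * diff p / (r * P.H p)), 0, 0;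
     -(P.Q₁ p * P.X p / (r * P.H p * diff p)), -(P.Q₂ p * P.Y p / (r * P.H p * diff p)), 0, 0]

section Domain

variable {P} (hk : 0 < P.k) (hp : p ∈ P.domain)

include hp

theorem metric_eq : P.metric p = !![P.k * P.H p / (diff p ^ 3 * P.X p), 0, 0, 0;
     0, -(P.k * P.H p / (diff p ^ 3 * P.Y p)), 0, 0;
     0, 0, P.F p / (P.H p * diff p), P.G p / (P.H p * diff p);
     0, 0, P.G p / (P.H p * diff p), P.G p ^ 2 / (P.F p * P.H p * diff p)
       - P.k * P.H p / diff p ^ 3 * (P.X p * P.Y p / (P.k * P.F p))] := by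
  have hs := (diff_pos hp).ne'
  have hX := (X_pos hp).ne'
  have hY := (Y_neg hp).ne
  have hH := (H_pos hp).ne'
  have hF := (F_pos hp).ne'
  simp only [metric]
  rw [show p 0 - p 1 = diff p from rfl]
  have e11 : P.k * P.H p / diff p ^ 3 / P.Y p = P.k * P.H p / (diff p ^ 3 * P.Y p) := div_div _ _ _
  have e22 : P.F p ^ 2 / (P.F p * P.H p * diff p) = P.F p / (P.H p * diff p) := by field_simp
  have e23 : P.F p * P.G p / (P.F p * P.H p * diff p) = P.G p / (P.H p * diff p) := by field_simp
  rw [e11, e22, e23, div_div]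

include hk

/-- The fibre metric is a sum of squares of `F dτ + G dφ` and `dφ` with coefficients, so `G` drops
out of its determinant. -/
theorem fiber_det : P.F p / (P.H p * diff p) * (P.G p ^ 2 / (P.F p * P.H p * diff p)
       - P.k * P.H p / diff p ^ 3 * (P.X p * P.Y p / (P.k * P.F p)))
       - (P.G p / (P.H p * diff p)) ^ 2 = P.X p * (-P.Y p) / diff p ^ 4 := by
  have hs := (diff_pos hp).ne'
  have hH := (H_pos hp).ne'
  have hF := (F_pos hp).ne'
  field_simp
  ring

theorem metric_posDef : (P.metric p).PosDef := by
  have hs := diff_pos hp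
  have hX := X_pos hp
  have hY := neg_pos.2 (Y_neg hp)
  have hH := H_pos hp
  have hF := F_pos hp
  rw [metric_eq hp]
  refine posDef_blocks (by positivity) ?_ (by positivity) ?_
  · rw [← div_neg, ← mul_neg]; positivity
  · rw [fiber_det hk hp]; positivity

theorem metric_det : (P.metric p).det = (P.k * P.H p / diff p ^ 5) ^ 2 := by
  have hs := (diff_pos hp).ne'
  have hX := (X_pos hp).ne'
  have hY := (Y_neg hp).ne
  rw [metric_eq hp, det_blocks, fiber_det hk hp]
  field_simp

theorem matJ_mul_metric : P.matJ p * P.metric p = P.twoForm p := by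
  have hs := (diff_pos hp).ne'
  have hX := (X_pos hp).ne'
  have hY := (Y_neg hp).ne
  have hH := (H_pos hp).ne'
  have hF := (F_pos hp).ne'
  have h1 := P.F_mul_Q₁ p
  have h2 := P.F_mul_Q₂ p
  obtain ⟨r, hr, hrk⟩ : ∃ r, 0 < r ∧ P.k = r ^ 2 :=
    ⟨√P.k, Real.sqrt_pos.2 hk, (Real.sq_sqrt hk.le).symm⟩
  have hr' : √P.k = r := by rw [hrk, Real.sqrt_sq hr.le]
  have hr0 := hr.ne'
  rw [metric_eq hp]
  simp only [matJ, twoForm, hr']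
  rw [hrk]
  have e02 : r * (P.Q₂ p / (diff p ^ 2 * P.X p)) * (P.F p / (P.H p * diff p))
      + -(r * (p 0 / P.X p)) * (P.G p / (P.H p * diff p)) = r * p 1 / diff p ^ 2 := by
    field_simp
    linear_combination h2
  have e03 : r * (P.Q₂ p / (diff p ^ 2 * P.X p)) * (P.G p / (P.H p * diff p))
      + -(r * (p 0 / P.X p)) * (P.G p ^ 2 / (P.F p * P.H p * diff p)
       - r ^ 2 * P.H p / diff p ^ 3 * (P.X p * P.Y p / (r ^ 2 * P.F p)))
      = r * P.Q₁ p / diff p ^ 4 := by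
    field_simp
    linear_combination P.G p * diff p * h2 - P.X p * P.H p * h1
  have e12 : -(r * (P.Q₁ p / (diff p ^ 2 * P.Y p))) * (P.F p / (P.H p * diff p))
      + r * (p 1 / P.Y p) * (P.G p / (P.H p * diff p)) = -(r * p 0 / diff p ^ 2) := by
    field_simp
    linear_combination -h1
  have e13 : -(r * (P.Q₁ p / (diff p ^ 2 * P.Y p))) * (P.G p / (P.H p * diff p))
      + r * (p 1 / P.Y p) * (P.G p ^ 2 / (P.F p * P.H p * diff p)
       - r ^ 2 * P.H p / diff p ^ 3 * (P.X p * P.Y p / (r ^ 2 * P.F p)))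
      = -(r * P.Q₂ p / diff p ^ 4) := by
    field_simp
    linear_combination -P.G p * diff p * h1 + P.Y p * P.H p * h2
  have e20 : -(p 1 * P.X p * diff p / (r * P.H p)) * (r ^ 2 * P.H p / (diff p ^ 3 * P.X p))
      = -(r * p 1 / diff p ^ 2) := by field_simp
  have e21 : -(p 0 * P.Y p * diff p / (r * P.H p)) * -(r ^ 2 * P.H p / (diff p ^ 3 * P.Y p))
      = r * p 0 / diff p ^ 2 := by field_simp
  have e30 : -(P.Q₁ p * P.X p / (r * P.H p * diff p)) * (r ^ 2 * P.H p / (diff p ^ 3 * P.X p))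
      = -(r * P.Q₁ p / diff p ^ 4) := by field_simp
  have e31 : -(P.Q₂ p * P.Y p / (r * P.H p * diff p)) * -(r ^ 2 * P.H p / (diff p ^ 3 * P.Y p))
      = r * P.Q₂ p / diff p ^ 4 := by field_simp
  ext a b
  fin_cases a <;> fin_cases b
  any_goals simp [Matrix.mul_apply, Fin.sum_univ_four]; done
  · exact Eq.trans (by simp [Matrix.mul_apply, Fin.sum_univ_four]) e02
  · exact Eq.trans (by simp [Matrix.mul_apply, Fin.sum_univ_four]) e03
  · exact Eq.trans (by simp [Matrix.mul_apply, Fin.sum_univ_four]) e12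
  · exact Eq.trans (by simp [Matrix.mul_apply, Fin.sum_univ_four]) e13
  · exact Eq.trans (by simp [Matrix.mul_apply, Fin.sum_univ_four]) e20
  · exact Eq.trans (by simp [Matrix.mul_apply, Fin.sum_univ_four]) e21
  · exact Eq.trans (by simp [Matrix.mul_apply, Fin.sum_univ_four]) e30
  · exact Eq.trans (by simp [Matrix.mul_apply, Fin.sum_univ_four]) e31

/-- Both off-diagonal blocks have size two, so `J²` is block diagonal. Its diagonal entries reduce
to `Q₂_sub_Q₁`, and its other entries cancel identically. -/
theorem matJ_sq : P.matJ p * P.matJ p = -1 := by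
  have hs := (diff_pos hp).ne'
  have hX := (X_pos hp).ne'
  have hY := (Y_neg hp).ne
  have hH := (H_pos hp).ne'
  have h := P.Q₂_sub_Q₁ p
  have hr0 := (Real.sqrt_pos.2 hk).ne'
  simp only [matJ]
  ext a b
  fin_cases a <;> fin_cases b <;> simp [Matrix.mul_apply, Fin.sum_univ_four] <;>
    field_simp <;> first | linear_combination h | linear_combination -h | ring

omit hk hp in
theorem twoForm_antisymm (p : Pt) : (P.twoForm p)ᵀ = -P.twoForm p := by
  ext a b
  fin_cases a <;> fin_cases b <;> simp [twoForm]

end Domain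

theorem matJ_smooth (hk : 0 < P.k) : SmoothOn P.domain P.matJ := by
  have hr0 := (Real.sqrt_pos.2 hk).ne'
  have x := (contDiff_coord 0).contDiffOn (s := P.domain)
  have y := (contDiff_coord 1).contDiffOn (s := P.domain)
  have X := P.contDiff_X.contDiffOn (s := P.domain)
  have Y := P.contDiff_Y.contDiffOn (s := P.domain)
  have H := P.contDiff_H.contDiffOn (s := P.domain)
  have s := contDiff_diff.contDiffOn (s := P.domain)
  have q1 := P.contDiff_Q₁.contDiffOn (s := P.domain)
  have q2 := P.contDiff_Q₂.contDiffOn (s := P.domain)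
  have c := contDiffOn_const (𝕜 := ℝ) (n := ∞) (s := P.domain) (c := √P.k)
  have hs : ∀ q ∈ P.domain, diff q ≠ 0 := fun q hq => (diff_pos hq).ne'
  have hX : ∀ q ∈ P.domain, P.X q ≠ 0 := fun q hq => (X_pos hq).ne'
  have hY : ∀ q ∈ P.domain, P.Y q ≠ 0 := fun q hq => (Y_neg hq).ne
  have hH : ∀ q ∈ P.domain, P.H q ≠ 0 := fun q hq => (H_pos hq).ne'
  have z := contDiffOn_const (𝕜 := ℝ) (n := ∞) (s := P.domain) (c := (0 : ℝ))
  intro a b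
  fin_cases a <;> fin_cases b
  any_goals exact z
  · exact c.mul (q2.div ((s.pow 2).mul X) fun q hq => mul_ne_zero (pow_ne_zero _ (hs q hq)) (hX q hq))
  · exact (c.mul (x.div X hX)).neg
  · exact (c.mul (q1.div ((s.pow 2).mul Y) fun q hq =>
      mul_ne_zero (pow_ne_zero _ (hs q hq)) (hY q hq))).neg
  · exact c.mul (y.div Y hY)
  · exact (((y.mul X).mul s).div (c.mul H) fun q hq => mul_ne_zero hr0 (hH q hq)).neg
  · exact (((x.mul Y).mul s).div (c.mul H) fun q hq => mul_ne_zero hr0 (hH q hq)).neg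
  · exact ((q1.mul X).div ((c.mul H).mul s) fun q hq =>
      mul_ne_zero (mul_ne_zero hr0 (hH q hq)) (hs q hq)).neg
  · exact ((q2.mul Y).div ((c.mul H).mul s) fun q hq =>
      mul_ne_zero (mul_ne_zero hr0 (hH q hq)) (hs q hq)).neg

theorem metric_smooth (hk : 0 < P.k) : SmoothOn P.domain P.metric := by
  have X := P.contDiff_X.contDiffOn (s := P.domain)
  have Y := P.contDiff_Y.contDiffOn (s := P.domain)
  have H := P.contDiff_H.contDiffOn (s := P.domain)
  have F := P.contDiff_F.contDiffOn (s := P.domain)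
  have G := P.contDiff_G.contDiffOn (s := P.domain)
  have s := contDiff_diff.contDiffOn (s := P.domain)
  have c := contDiffOn_const (𝕜 := ℝ) (n := ∞) (s := P.domain) (c := P.k)
  have hs : ∀ q ∈ P.domain, diff q ≠ 0 := fun q hq => (diff_pos hq).ne'
  have hX : ∀ q ∈ P.domain, P.X q ≠ 0 := fun q hq => (X_pos hq).ne'
  have hY : ∀ q ∈ P.domain, P.Y q ≠ 0 := fun q hq => (Y_neg hq).ne
  have hH : ∀ q ∈ P.domain, P.H q ≠ 0 := fun q hq => (H_pos hq).ne'
  have hF : ∀ q ∈ P.domain, P.F q ≠ 0 := fun q hq => (F_pos hq).ne'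
  have z := contDiffOn_const (𝕜 := ℝ) (n := ∞) (s := P.domain) (c := (0 : ℝ))
  have A := (c.mul H).div (s.pow 3) fun q hq => pow_ne_zero _ (hs q hq)
  have B := (F.mul H).mul s
  have hB : ∀ q ∈ P.domain, P.F q * P.H q * diff q ≠ 0 := fun q hq =>
    mul_ne_zero (mul_ne_zero (hF q hq) (hH q hq)) (hs q hq)
  have h23 := (F.mul G).div B hB
  intro a b
  fin_cases a <;> fin_cases b
  any_goals exact z
  · exact A.div X hX
  · exact (A.div Y hY).neg
  · exact (F.pow 2).div B hB
  · exact h23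
  · exact h23
  · exact ((G.pow 2).div B hB).sub (A.mul ((X.mul Y).div (c.mul F) fun q hq =>
      mul_ne_zero hk.ne' (hF q hq)))

theorem isMetricOn_metric (hk : 0 < P.k) : IsMetricOn P.domain P.metric where
  isOpen := P.isOpen_domain
  smooth := P.metric_smooth hk
  symm _ hp := (metric_posDef hk hp).isHermitian
  det _ hp := (metric_posDef hk hp).det_pos.ne'

end ChenTeo

end

/-! ### Symmetry in `τ, φ`, integrability, and closedness of the Kähler form -/

noncomputable section

namespace Chart

open Matrix

theorem pd_eq_zero_of_update {i : Fin 4} {f : Pt → ℝ} {p : Pt}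
    (h : ∀ t, f (Function.update p i t) = f p) : pd i f p = 0 := by
  by_cases hf : DifferentiableAt ℝ f p
  · have hl : HasDerivAt (fun t : ℝ => Function.update p i t) (Pi.single i 1) (p i) :=
      hasDerivAt_update p i (p i)
    have hf' : HasFDerivAt f (fderiv ℝ f p) (Function.update p i (p i)) := by
      rw [Function.update_eq_self]
      exact hf.hasFDerivAt
    have hc := hf'.comp_hasDerivAt (p i) hl
    have he : f ∘ (fun t : ℝ => Function.update p i t) = fun _ => f p := funext h
    rw [he] at hc
    exact hc.unique (hasDerivAt_const _ _)
  -- Without differentiability the derivative takes its default value 0, so no regularity hypothesis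
  -- is needed.
  · rw [pd, fderiv_zero_of_not_differentiableAt hf]
    rfl

theorem inv_blocks {a b c d e : ℝ} (ha : a ≠ 0) (hb : b ≠ 0) (hd : c * e - d ^ 2 ≠ 0) :
    (!![a, 0, 0, 0; 0, b, 0, 0; 0, 0, c, d; 0, 0, d, e])⁻¹
      = !![a⁻¹, 0, 0, 0; 0, b⁻¹, 0, 0; 0, 0, e / (c * e - d ^ 2), -(d / (c * e - d ^ 2));
          0, 0, -(d / (c * e - d ^ 2)), c / (c * e - d ^ 2)] := by
  refine Matrix.inv_eq_right_inv ?_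
  ext i j
  fin_cases i <;> fin_cases j <;> simp [Matrix.mul_apply, Fin.sum_univ_four, ha, hb]
  all_goals
    generalize hD : c * e - d ^ 2 = D at *
    field_simp
    first | linear_combination hD | ring

end Chart

namespace ChenTeo

open Chart Matrix

variable (P : ChenTeo) {p : Pt}

/-! ### Independence of the coordinates `τ` and `φ` -/

section Update

variable {i : Fin 4} (h0 : 0 ≠ i) (h1 : 1 ≠ i) (q : Pt) (t : ℝ)

include h0 in
theorem X_update : P.X (Function.update q i t) = P.X q := by
  rw [X, Function.update_of_ne h0, X]

include h1 in
theorem Y_update : P.Y (Function.update q i t) = P.Y q := by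
  rw [Y, Function.update_of_ne h1, Y]

include h0 h1

theorem H_update : P.H (Function.update q i t) = P.H q := by
  simp only [H, Function.update_of_ne h0, Function.update_of_ne h1]

theorem ell_update : P.ell (Function.update q i t) = P.ell q := by
  simp only [ell, Function.update_of_ne h0, Function.update_of_ne h1]

theorem diff_update : diff (Function.update q i t) = diff q := by
  simp only [diff, Function.update_of_ne h0, Function.update_of_ne h1]

theorem Q₁_update : P.Q₁ (Function.update q i t) = P.Q₁ q := by
  simp only [Q₁, Function.update_of_ne h0, Function.update_of_ne h1]

theorem Q₂_update : P.Q₂ (Function.update q i t) = P.Q₂ q := by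
  simp only [Q₂, Function.update_of_ne h0, Function.update_of_ne h1]

theorem u_update : P.u (Function.update q i t) = P.u q := by
  simp only [u, Function.update_of_ne h0, Function.update_of_ne h1]

theorem metric_update : P.metric (Function.update q i t) = P.metric q := by
  simp only [metric, H_update P h0 h1, X_update P h0, Y_update P h1, F, G,
    Function.update_of_ne h0, Function.update_of_ne h1]

theorem matJ_update : P.matJ (Function.update q i t) = P.matJ q := by
  simp only [matJ, H_update P h0 h1, X_update P h0, Y_update P h1, Q₁_update P h0 h1,
    Q₂_update P h0 h1, diff_update h0 h1, Function.update_of_ne h0, Function.update_of_ne h1]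

theorem mpd_matJ_eq_zero : mpd i P.matJ p = 0 := by
  ext a b
  exact pd_eq_zero_of_update fun t => by rw [matJ_update P h0 h1]

theorem mpd_metric_eq_zero : mpd i P.metric p = 0 := by
  ext a b
  exact pd_eq_zero_of_update fun t => by rw [metric_update P h0 h1]

theorem mpd_metricBar_eq_zero : mpd i P.metricBar p = 0 := by
  ext a b
  exact pd_eq_zero_of_update fun t => by
    rw [metricBar, metricBar, metric_update P h0 h1, u_update P h0 h1]

end Update

/-! ### The conformal factor -/

theorem u_eq (p : Pt) : P.u p = -diff p / P.ell p := rfl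

theorem contDiffOn_u : ContDiffOn ℝ ∞ P.u P.domain :=
  (contDiff_diff.contDiffOn.neg).div P.contDiff_ell.contDiffOn fun _ hq => ell_ne_zero hq

theorem u_ne_zero {p : Pt} (hp : p ∈ P.domain) : P.u p ≠ 0 :=
  div_ne_zero (neg_ne_zero.2 (diff_pos hp).ne') (ell_ne_zero hp)

theorem metricBar_eq : P.metricBar = conf P.u P.metric := rfl

theorem isMetricOn_metricBar (hk : 0 < P.k) : IsMetricOn P.domain P.metricBar :=
  (P.isMetricOn_metric hk).conf P.contDiffOn_u fun _ => P.u_ne_zero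

section Domain

variable {P} (hk : 0 < P.k) (hp : p ∈ P.domain)

include hp

theorem pd_u_zero : pd 0 P.u p = -((1 + P.ν) * p 1) / P.ell p ^ 2 := by
  have h : HasPd 0 P.u _ p := (hasPd_diff_zero.neg.div P.hasPd_ell_zero (ell_ne_zero hp))
  rw [h.pd_eq, diff, ell]
  ring

theorem pd_u_one : pd 1 P.u p = (1 + P.ν) * p 0 / P.ell p ^ 2 := by
  have h : HasPd 1 P.u _ p := (hasPd_diff_one.neg.div P.hasPd_ell_one (ell_ne_zero hp))
  rw [h.pd_eq, diff, ell]
  ring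

omit hp in
theorem pd_u_of_ne {i : Fin 4} (h0 : 0 ≠ i) (h1 : 1 ≠ i) : pd i P.u p = 0 :=
  pd_eq_zero_of_update fun t => P.u_update h0 h1 p t

include hk

theorem metric_inv : (P.metric p)⁻¹ = !![diff p ^ 3 * P.X p / (P.k * P.H p), 0, 0, 0;
    0, -(diff p ^ 3 * P.Y p / (P.k * P.H p)), 0, 0;
    0, 0, (P.metric p)⁻¹ 2 2, (P.metric p)⁻¹ 2 3; 0, 0, (P.metric p)⁻¹ 3 2, (P.metric p)⁻¹ 3 3] := by
  have hs := (diff_pos hp).ne'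
  have hX := (X_pos hp).ne'
  have hY := (Y_neg hp).ne
  have hH := (H_pos hp).ne'
  have hk0 := hk.ne'
  rw [metric_eq hp, inv_blocks (by positivity)
    (neg_ne_zero.2 (div_ne_zero (by positivity) (by positivity))) (by
      rw [fiber_det hk hp]
      exact div_ne_zero (mul_ne_zero hX (neg_ne_zero.2 hY)) (by positivity)),
    inv_div, inv_neg, inv_div]
  rfl

end Domain

/-! ### Integrability -/

/-- Only `N(∂_x, ∂_y)` has to be checked, and there the condition is `∂_x J_y^c = ∂_y J_x^c`. For `c
= τ` both sides equal `2 √k (1 - ν)(νx + y)/(x - y)³` by the derivative identities for `Q₁`, `Q₂`;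
for `c = φ` both vanish, since `x / X` and `y / Y` depend on one variable each. -/
theorem nijenhuis_matJ (hk : 0 < P.k) (hp : p ∈ P.domain) (a b c : Fin 4) :
    nijenhuis P.matJ p a b c = 0 := by
  refine nijenhuis_eq_zero P.isOpen_domain (P.matJ_smooth hk) (fun q hq => matJ_sq hk hq) hp
    rfl rfl rfl rfl (fun c => ?_) a b c
  have hs := (diff_pos hp).ne'
  have hX := (X_pos hp).ne'
  have hY := (Y_neg hp).ne
  have hr0 := (Real.sqrt_pos.2 hk).ne'
  have z2 : ∀ a b, pd 2 (fun q => P.matJ q a b) p = 0 := fun a b =>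
    congrFun (congrFun (P.mpd_matJ_eq_zero (p := p) (i := 2) (by decide) (by decide)) a) b
  have z3 : ∀ a b, pd 3 (fun q => P.matJ q a b) p = 0 := fun a b =>
    congrFun (congrFun (P.mpd_matJ_eq_zero (p := p) (i := 3) (by decide) (by decide)) a) b
  have c0 : pd 0 (fun q => P.matJ q 1 0) p = 0 := pd_const _ _
  have c0' : pd 1 (fun q => P.matJ q 0 0) p = 0 := pd_const _ _
  have c1 : pd 0 (fun q => P.matJ q 1 1) p = 0 := pd_const _ _
  have c1' : pd 1 (fun q => P.matJ q 0 1) p = 0 := pd_const _ _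
  have q1 := HasPd.of_differentiableAt (i := 0) (p := p)
    (P.contDiff_Q₁.differentiable (by simp)).differentiableAt
  have q2 := HasPd.of_differentiableAt (i := 1) (p := p)
    (P.contDiff_Q₂.differentiable (by simp)).differentiableAt
  have c2 : pd 0 (fun q => P.matJ q 1 2) p
      = √P.k * (2 * (1 - P.ν) * P.ell p / (diff p ^ 3)) := by
    have h : HasPd 0 (fun q => P.matJ q 1 2) _ p := ((HasPd.const √P.k).mul
      (q1.div ((hasPd_diff_zero.pow 2).mul (P.hasPd_Y_of_ne (by decide)))
        (mul_ne_zero (pow_ne_zero 2 hs) hY))).neg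
    rw [h.pd_eq]
    field_simp
    push_cast
    linear_combination (-diff p * P.Y p * √P.k) * P.diff_mul_pd_Q₁ (p := p)
  have c2' : pd 1 (fun q => P.matJ q 0 2) p
      = √P.k * (2 * (1 - P.ν) * P.ell p / (diff p ^ 3)) := by
    have h : HasPd 1 (fun q => P.matJ q 0 2) _ p := (HasPd.const √P.k).mul
      (q2.div ((hasPd_diff_one.pow 2).mul (P.hasPd_X_of_ne (by decide)))
        (mul_ne_zero (pow_ne_zero 2 hs) hX))
    rw [h.pd_eq]
    field_simp
    push_cast
    linear_combination diff p * P.X p * √P.k * P.diff_mul_pd_Q₂ (p := p)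
  have c3 : pd 0 (fun q => P.matJ q 1 3) p = 0 := by
    have h : HasPd 0 (fun q => P.matJ q 1 3) _ p := (HasPd.const √P.k).mul
      ((hasPd_coord_ne (by decide)).div (P.hasPd_Y_of_ne (by decide)) hY)
    rw [h.pd_eq]
    simp
  have c3' : pd 1 (fun q => P.matJ q 0 3) p = 0 := by
    have h : HasPd 1 (fun q => P.matJ q 0 3) _ p := ((HasPd.const √P.k).mul
      ((hasPd_coord_ne (by decide)).div (P.hasPd_X_of_ne (by decide)) hX)).neg
    rw [h.pd_eq]
    simp
  have j00 : P.matJ p 0 0 = 0 := rfl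
  have j01 : P.matJ p 0 1 = 0 := rfl
  have j10 : P.matJ p 1 0 = 0 := rfl
  have j11 : P.matJ p 1 1 = 0 := rfl
  rw [nijenhuis, Fin.sum_univ_four]
  simp only [z2, z3, c0, c0', c1, c1', c2, c2', c3, c3', j00, j01, j10, j11]
  ring

theorem isComplexStructureOn_matJ (hk : 0 < P.k) : IsComplexStructureOn P.domain P.matJ where
  smooth := P.matJ_smooth hk
  sq _ hp := matJ_sq hk hp
  integrable _ hp := P.nijenhuis_matJ hk hp

/-! ### The Kähler form -/

/-- The 2-form `u² J_a^c g_{cb}`. -/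
def twoFormBar : MatField := fun p =>
  let r : ℝ := Real.sqrt P.k
  !![0, 0, r * (p 1 / P.ell p ^ 2), r * (P.Q₁ p / (diff p * P.ell p) ^ 2);
     0, 0, -(r * (p 0 / P.ell p ^ 2)), -(r * (P.Q₂ p / (diff p * P.ell p) ^ 2));
     -(r * (p 1 / P.ell p ^ 2)), r * (p 0 / P.ell p ^ 2), 0, 0;
     -(r * (P.Q₁ p / (diff p * P.ell p) ^ 2)), r * (P.Q₂ p / (diff p * P.ell p) ^ 2), 0, 0]

theorem kahlerForm_eq (hk : 0 < P.k) (hp : p ∈ P.domain) :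
    kahlerForm P.matJ P.metricBar p = P.twoFormBar p := by
  have hs := (diff_pos hp).ne'
  have hl := ell_ne_zero hp
  rw [metricBar_eq, kahlerForm_conf, matJ_mul_metric hk hp, u_eq]
  ext a b
  fin_cases a <;> fin_cases b <;> simp [twoForm, twoFormBar] <;> field_simp

/-- The form has no `dx∧dy` or `dτ∧dφ` part and does not depend on `τ, φ`, so only the components
`xyτ` and `xyφ` of its differential matter. The first is elementary, the second is
`pd_Q₁_add_pd_Q₂`. -/
theorem closed_twoFormBar (hp : p ∈ P.domain) (a b c : Fin 4) :
    mpd a P.twoFormBar p b c + mpd b P.twoFormBar p c a + mpd c P.twoFormBar p a b = 0 := by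
  have hs := (diff_pos hp).ne'
  have hl := ell_ne_zero hp
  have z : ∀ i : Fin 4, 0 ≠ i → 1 ≠ i → mpd i P.twoFormBar p = 0 := fun i h0 h1 => by
    ext a b
    refine pd_eq_zero_of_update fun t => ?_
    simp only [twoFormBar, Q₁_update P h0 h1, ell_update P h0 h1, Q₂_update P h0 h1,
      diff_update h0 h1, Function.update_of_ne h0, Function.update_of_ne h1]
  have anti : ∀ i a b, mpd i P.twoFormBar p a b = -mpd i P.twoFormBar p b a := fun i a b => by
    rw [mpd_apply, mpd_apply, ← pd_neg]
    congr 1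
    funext q
    fin_cases a <;> fin_cases b <;> simp [twoFormBar]
  have z01 : ∀ i, mpd i P.twoFormBar p 0 1 = 0 := fun i => pd_const _ _
  have z23 : ∀ i, mpd i P.twoFormBar p 2 3 = 0 := fun i => pd_const _ _
  have q1 := HasPd.of_differentiableAt (i := 1) (p := p)
    (P.contDiff_Q₁.differentiable (by simp)).differentiableAt
  have q2 := HasPd.of_differentiableAt (i := 0) (p := p)
    (P.contDiff_Q₂.differentiable (by simp)).differentiableAt
  have e2 : mpd 0 P.twoFormBar p 1 2 = mpd 1 P.twoFormBar p 0 2 := by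
    have h : HasPd 0 (fun q => P.twoFormBar q 1 2) _ p := ((HasPd.const √P.k).mul
      ((hasPd_coord_self 0).div (P.hasPd_ell_zero.pow 2) (pow_ne_zero 2 hl))).neg
    have h' : HasPd 1 (fun q => P.twoFormBar q 0 2) _ p := (HasPd.const √P.k).mul
      ((hasPd_coord_self 1).div (P.hasPd_ell_one.pow 2) (pow_ne_zero 2 hl))
    rw [mpd_apply, mpd_apply, h.pd_eq, h'.pd_eq]
    field_simp
    simp only [ell]
    push_cast
    ring
  have e3 : mpd 0 P.twoFormBar p 1 3 = mpd 1 P.twoFormBar p 0 3 := by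
    have h : HasPd 0 (fun q => P.twoFormBar q 1 3) _ p := ((HasPd.const √P.k).mul
      (q2.div ((hasPd_diff_zero.mul P.hasPd_ell_zero).pow 2)
        (pow_ne_zero 2 (mul_ne_zero hs hl)))).neg
    have h' : HasPd 1 (fun q => P.twoFormBar q 0 3) _ p := (HasPd.const √P.k).mul
      (q1.div ((hasPd_diff_one.mul P.hasPd_ell_one).pow 2)
        (pow_ne_zero 2 (mul_ne_zero hs hl)))
    rw [mpd_apply, mpd_apply, h.pd_eq, h'.pd_eq]
    field_simp
    push_cast
    linear_combination (-diff p * P.ell p * √P.k) * P.pd_Q₁_add_pd_Q₂ (p := p)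
  have z2 := z 2 (by decide) (by decide)
  have z3 := z 3 (by decide) (by decide)
  have hd : ∀ i a, mpd i P.twoFormBar p a a = 0 := fun i a => by linarith [anti i a a]
  have h10 : ∀ i, mpd i P.twoFormBar p 1 0 = 0 := fun i => by rw [anti, z01, neg_zero]
  have h32 : ∀ i, mpd i P.twoFormBar p 3 2 = 0 := fun i => by rw [anti, z23, neg_zero]
  fin_cases a <;> fin_cases b <;> fin_cases c <;>
    simp [z2, z3, hd, h10, h32, z01, z23, e2, e3, anti _ 2 0, anti _ 3 0, anti _ 2 1, anti _ 3 1]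

theorem isKahlerOn_matJ (hk : 0 < P.k) : IsKahlerOn P.domain P.matJ P.metricBar where
  smooth := (P.isMetricOn_metricBar hk).smooth
  posDef p hp := (metric_posDef hk hp).smul (sq_pos_of_ne_zero (P.u_ne_zero hp))
  complexStructure := P.isComplexStructureOn_matJ hk
  hermitian p hp a b := by
    have hJ := matJ_sq hk hp
    have hg : (P.metric p)ᵀ = P.metric p := (P.isMetricOn_metric hk).symm p hp
    have h : P.matJ p * P.metric p * (P.matJ p)ᵀ = P.metric p := by
      have h1 : P.metric p * (P.matJ p)ᵀ = -(P.matJ p * P.metric p) := by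
        rw [← hg, ← Matrix.transpose_mul, hg, matJ_mul_metric hk hp, twoForm_antisymm]
      rw [Matrix.mul_assoc, h1, Matrix.mul_neg, ← Matrix.mul_assoc, hJ, Matrix.neg_mul, neg_neg,
        Matrix.one_mul]
    have h' : P.matJ p * P.metricBar p * (P.matJ p)ᵀ = P.metricBar p := by
      rw [metricBar, Matrix.mul_smul, Matrix.smul_mul, h]
    conv_rhs => rw [← h']
    rw [mul_mul_transpose_apply]
  closed p hp a b c := by
    have h := P.closed_twoFormBar hp a b c
    have e := fun i => mpd_congr P.isOpen_domain (fun q hq => P.kahlerForm_eq hk hq) hp i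
    rwa [← e, ← e, ← e] at h

end ChenTeo

end

noncomputable section

namespace ChenTeo

open Chart Matrix

variable (P : ChenTeo) {p : Pt}

/-! ### The scalar curvature of the Kähler metric -/

/-- The volume density of `u² g`. -/
def volBar (p : Pt) : ℝ := P.k * P.H p / (P.ell p ^ 4 * diff p)

/-- A 1-form `η` with `∂_c (v J_d^c) = v J_d^b η_b`, where `v` is the volume density of `u² g`. -/
def eta : Fin 4 → Pt → ℝ :=
  ![fun q => P.quartic' (q 0) / P.X q - 4 * P.ν / P.ell q,
    fun q => P.quartic' (q 1) / P.Y q - 4 / P.ell q, fun _ => 0, fun _ => 0]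

theorem contDiffOn_volBar : ContDiffOn ℝ ∞ P.volBar P.domain :=
  (contDiff_const.mul P.contDiff_H).contDiffOn.div
    ((P.contDiff_ell.pow 4).mul contDiff_diff).contDiffOn fun _ hq =>
      mul_ne_zero (pow_ne_zero 4 (ell_ne_zero hq)) (diff_pos hq).ne'

theorem contDiffOn_eta (b : Fin 4) : ContDiffOn ℝ ∞ (P.eta b) P.domain := by
  have hl : ∀ c : ℝ, ContDiffOn ℝ ∞ (fun q => c / P.ell q) P.domain := fun c =>
    contDiffOn_const.div P.contDiff_ell.contDiffOn fun _ hq => ell_ne_zero hq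
  fin_cases b
  · exact ((P.contDiff_quartic' 0).contDiffOn.div P.contDiff_X.contDiffOn fun _ hq =>
      (X_pos hq).ne').sub (hl _)
  · exact ((P.contDiff_quartic' 1).contDiffOn.div P.contDiff_Y.contDiffOn fun _ hq =>
      (Y_neg hq).ne).sub (hl _)
  · exact contDiffOn_const
  · exact contDiffOn_const

section Domain

variable {P} (hk : 0 < P.k) (hp : p ∈ P.domain)

include hk hp

theorem volBar_pos : 0 < P.volBar p := by
  have hs := diff_pos hp
  have hH := H_pos hp
  have hl := ell_ne_zero hp
  have : 0 < P.ell p ^ 4 := by positivity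
  unfold volBar
  positivity

theorem metricBar_det : (P.metricBar p).det = P.volBar p ^ 2 := by
  have hs := (diff_pos hp).ne'
  have hl := ell_ne_zero hp
  rw [metricBar, Matrix.det_smul, metric_det hk hp, volBar, u_eq, Fintype.card_fin]
  field_simp

/-- This settles the orientation: the Pfaffian is the positive root, so the Weyl half described by
the Kähler structure is the self dual one for the orientation of the chart. -/
theorem sqrt_det_metricBar :
    Real.sqrt (P.metricBar p).det = pfaffian (kahlerForm P.matJ P.metricBar p) := by
  have hs := (diff_pos hp).ne'
  have hl := ell_ne_zero hp
  rw [metricBar_det hk hp, Real.sqrt_sq (volBar_pos hk hp).le, P.kahlerForm_eq hk hp]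
  obtain ⟨r, hr, hrk⟩ : ∃ r, 0 < r ∧ P.k = r ^ 2 :=
    ⟨√P.k, Real.sqrt_pos.2 hk, (Real.sq_sqrt hk.le).symm⟩
  simp [pfaffian, twoFormBar, volBar, hrk, Real.sqrt_sq hr.le]
  field_simp
  linear_combination -P.Q₂_sub_Q₁ p

/-- The fibre block is left unevaluated: `eta` has no fibre components, so only the base block
enters the divergence. -/
theorem metricBar_inv : (P.metricBar p)⁻¹
    = !![diff p * P.X p * P.ell p ^ 2 / (P.k * P.H p), 0, 0, 0;
      0, -(diff p * P.Y p * P.ell p ^ 2 / (P.k * P.H p)), 0, 0;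
      0, 0, (P.metricBar p)⁻¹ 2 2, (P.metricBar p)⁻¹ 2 3;
      0, 0, (P.metricBar p)⁻¹ 3 2, (P.metricBar p)⁻¹ 3 3] := by
  have hs := (diff_pos hp).ne'
  have hl := ell_ne_zero hp
  have hH := (H_pos hp).ne'
  have hk0 := hk.ne'
  have h := conf_inv (P.isMetricOn_metric hk) hp (P.u_ne_zero hp)
  rw [← metricBar_eq, u_eq] at h
  conv_lhs => rw [h, metric_inv hk hp]
  rw [h]
  ext a b
  fin_cases a <;> fin_cases b <;> simp <;> field_simp

/-- The factor `H` cancels in the density times `J`. With `ℓ = νx + y`, the `τ` row is `-√k (y X, x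
Y) / ℓ⁴`, whose divergence is visibly of the required form. In the `φ` row, `-√k (Q₁ X, Q₂ Y) / ((x
- y)² ℓ⁴)`, the two derivatives of `Q₁ / (x - y)²` and `Q₂ / (x - y)²` contribute opposite terms. -/
theorem pd_volBar_mul_matJ (d : Fin 4) : ∑ c, pd c (fun r => P.volBar r * P.matJ r d c) p
    = P.volBar p * ∑ b, P.matJ p d b * P.eta b p := by
  have hs := (diff_pos hp).ne'
  have hl := ell_ne_zero hp
  have hX := (X_pos hp).ne'
  have hY := (Y_neg hp).ne
  have hH := (H_pos hp).ne'
  obtain ⟨r, hr, hrk⟩ : ∃ r, 0 < r ∧ P.k = r ^ 2 :=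
    ⟨√P.k, Real.sqrt_pos.2 hk, (Real.sq_sqrt hk.le).symm⟩
  have hr0 := hr.ne'
  have z : ∀ i : Fin 4, 0 ≠ i → 1 ≠ i → ∀ d c,
      pd i (fun r => P.volBar r * P.matJ r d c) p = 0 := fun i h0 h1 d c =>
    pd_eq_zero_of_update fun t => by
      simp only [volBar, matJ_update P h0 h1, H_update P h0 h1, ell_update P h0 h1,
        diff_update h0 h1]
  have z2 := z 2 (by decide) (by decide)
  have z3 := z 3 (by decide) (by decide)
  have e : P.eta 2 p = 0 := rfl
  have e' : P.eta 3 p = 0 := rfl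
  have q1 := HasPd.of_differentiableAt (i := 0) (p := p)
    (P.contDiff_Q₁.differentiable (by simp)).differentiableAt
  have q2 := HasPd.of_differentiableAt (i := 1) (p := p)
    (P.contDiff_Q₂.differentiable (by simp)).differentiableAt
  have hy0 : HasPd 0 (fun q : Pt => q 1) 0 p := hasPd_coord_ne (by decide)
  have hx1 : HasPd 1 (fun q : Pt => q 0) 0 p := hasPd_coord_ne (by decide)
  have hc0 : HasPd 0 (fun _ : Pt => -r) 0 p := HasPd.const _
  have hc1 : HasPd 1 (fun _ : Pt => -r) 0 p := HasPd.const _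
  rw [Fin.sum_univ_four, Fin.sum_univ_four, z2, z3, e, e']
  have hlow : ∀ q : Pt, ∀ i, pd i (fun r => P.volBar r * 0) q = 0 := fun q i => by
    simp only [mul_zero]
    exact pd_const _ _
  fin_cases d
  · have h0 : pd 0 (fun r => P.volBar r * P.matJ r 0 0) p = 0 := hlow p 0
    have h1 : pd 1 (fun r => P.volBar r * P.matJ r 0 1) p = 0 := hlow p 1
    have j0 : P.matJ p 0 0 = 0 := rfl
    have j1 : P.matJ p 0 1 = 0 := rfl
    simp [h0, h1, j0, j1]
  · have h0 : pd 0 (fun r => P.volBar r * P.matJ r 1 0) p = 0 := hlow p 0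
    have h1 : pd 1 (fun r => P.volBar r * P.matJ r 1 1) p = 0 := hlow p 1
    have j0 : P.matJ p 1 0 = 0 := rfl
    have j1 : P.matJ p 1 1 = 0 := rfl
    simp [h0, h1, j0, j1]
  · have h0 : pd 0 (fun r => P.volBar r * P.matJ r 2 0) p = _ :=
      (pd_congr (h := fun q => -r * (q 1 * P.X q) / P.ell q ^ 4) P.isOpen_domain
        (fun q hq => by
          have hs := (diff_pos hq).ne'
          have hl := ell_ne_zero hq
          have hH := (H_pos hq).ne'
          simp [volBar, matJ, hrk, Real.sqrt_sq hr.le]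
          field_simp) hp 0).trans
      (((hc0.mul (hy0.mul P.hasPd_X)).div (P.hasPd_ell_zero.pow 4) (pow_ne_zero 4 hl)).pd_eq)
    have h1 : pd 1 (fun r => P.volBar r * P.matJ r 2 1) p = _ :=
      (pd_congr (h := fun q => -r * (q 0 * P.Y q) / P.ell q ^ 4) P.isOpen_domain
        (fun q hq => by
          have hs := (diff_pos hq).ne'
          have hl := ell_ne_zero hq
          have hH := (H_pos hq).ne'
          simp [volBar, matJ, hrk, Real.sqrt_sq hr.le]
          field_simp) hp 1).trans
      (((hc1.mul (hx1.mul P.hasPd_Y)).div (P.hasPd_ell_one.pow 4) (pow_ne_zero 4 hl)).pd_eq)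
    change pd 0 (fun r => P.volBar r * P.matJ r 2 0) p
      + pd 1 (fun r => P.volBar r * P.matJ r 2 1) p + 0 + 0
      = P.volBar p * (P.matJ p 2 0 * P.eta 0 p + P.matJ p 2 1 * P.eta 1 p
        + P.matJ p 2 2 * 0 + P.matJ p 2 3 * 0)
    rw [h0, h1]
    simp [volBar, matJ, hrk, Real.sqrt_sq hr.le, eta]
    field_simp
    ring
  · have h0 : pd 0 (fun r => P.volBar r * P.matJ r 3 0) p = _ :=
      (pd_congr (h := fun q => -r * (P.Q₁ q * P.X q) / (diff q ^ 2 * P.ell q ^ 4))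
        P.isOpen_domain
        (fun q hq => by
          have hs := (diff_pos hq).ne'
          have hl := ell_ne_zero hq
          have hH := (H_pos hq).ne'
          simp [volBar, matJ, hrk, Real.sqrt_sq hr.le]
          field_simp) hp 0).trans
      (((hc0.mul (q1.mul P.hasPd_X)).div ((hasPd_diff_zero.pow 2).mul (P.hasPd_ell_zero.pow 4))
        (mul_ne_zero (pow_ne_zero 2 hs) (pow_ne_zero 4 hl))).pd_eq)
    have h1 : pd 1 (fun r => P.volBar r * P.matJ r 3 1) p = _ :=
      (pd_congr (h := fun q => -r * (P.Q₂ q * P.Y q) / (diff q ^ 2 * P.ell q ^ 4))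
        P.isOpen_domain
        (fun q hq => by
          have hs := (diff_pos hq).ne'
          have hl := ell_ne_zero hq
          have hH := (H_pos hq).ne'
          simp [volBar, matJ, hrk, Real.sqrt_sq hr.le]
          field_simp) hp 1).trans
      (((hc1.mul (q2.mul P.hasPd_Y)).div ((hasPd_diff_one.pow 2).mul (P.hasPd_ell_one.pow 4))
        (mul_ne_zero (pow_ne_zero 2 hs) (pow_ne_zero 4 hl))).pd_eq)
    change pd 0 (fun r => P.volBar r * P.matJ r 3 0) p
      + pd 1 (fun r => P.volBar r * P.matJ r 3 1) p + 0 + 0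
      = P.volBar p * (P.matJ p 3 0 * P.eta 0 p + P.matJ p 3 1 * P.eta 1 p
        + P.matJ p 3 2 * 0 + P.matJ p 3 3 * 0)
    have d1 : pd 0 P.Q₁ p = (2 * P.Q₁ p - 2 * (1 - P.ν) * P.ell p * P.Y p) / diff p := by
      rw [eq_div_iff hs, ← P.diff_mul_pd_Q₁]; ring
    have d2 : pd 1 P.Q₂ p = (2 * (1 - P.ν) * P.ell p * P.X p - 2 * P.Q₂ p) / diff p := by
      rw [eq_div_iff hs, ← P.diff_mul_pd_Q₂]; ring
    rw [h0, h1, d1, d2]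
    simp [volBar, matJ, hrk, Real.sqrt_sq hr.le, eta]
    field_simp
    ring

theorem scal_metricBar : scal P.metricBar p = 6 * (1 + P.ν) / P.k * P.u p := by
  have hs := (diff_pos hp).ne'
  have hl := ell_ne_zero hp
  have hH := (H_pos hp).ne'
  have hk0 := hk.ne'
  have h := (P.isKahlerOn_matJ hk).mul_scal_eq P.isOpen_domain P.contDiffOn_volBar
    (fun q hq => metricBar_det hk hq) P.contDiffOn_eta
    (fun q hq => pd_volBar_mul_matJ hk hq) (fun q hq c d hcd => by
      -- `J` varies only with `x` and `y`, and `g⁻¹ J` has no entries between these two directions.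
      by_contra! hc
      have hi : ∀ i, mpd i P.matJ q ≠ 0 → i = 0 ∨ i = 1 := fun i hi => by
        by_contra! hne
        exact hi (P.mpd_matJ_eq_zero hne.1.symm hne.2.symm)
      refine hcd ?_
      rw [metricBar_inv hk hq, Matrix.mul_apply, Fin.sum_univ_four]
      rcases hi c hc.1 with rfl | rfl <;> rcases hi d hc.2 with rfl | rfl <;> simp [matJ]) hp
  have e : ∀ q ∈ P.domain, ∀ c, ∑ b, P.volBar q * (P.metricBar q)⁻¹ c b * P.eta b q
      = (![(P.quartic' (q 0) * P.ell q - 4 * P.ν * P.X q) / P.ell q ^ 3,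
          -((P.quartic' (q 1) * P.ell q - 4 * P.Y q) / P.ell q ^ 3), 0, 0] : Fin 4 → ℝ) c := by
    intro q hq c
    have hs := (diff_pos hq).ne'
    have hl := ell_ne_zero hq
    have hH := (H_pos hq).ne'
    have hX := (X_pos hq).ne'
    have hY := (Y_neg hq).ne
    rw [metricBar_inv hk hq, Fin.sum_univ_four]
    fin_cases c
    · simp [volBar, eta]
      field_simp
    · simp [volBar, eta]
      field_simp
    · simp [eta]
    · simp [eta]
  rw [Fin.sum_univ_four, pd_congr P.isOpen_domain (fun q hq => e q hq 0) hp,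
    pd_congr P.isOpen_domain (fun q hq => e q hq 1) hp,
    pd_congr P.isOpen_domain (fun q hq => e q hq 2) hp,
    pd_congr P.isOpen_domain (fun q hq => e q hq 3) hp] at h
  have h0 : HasPd 0 (fun q => (P.quartic' (q 0) * P.ell q - 4 * P.ν * P.X q) / P.ell q ^ 3) _ p :=
    (((P.hasPd_quartic' 0).mul P.hasPd_ell_zero).sub ((HasPd.const (4 * P.ν)).mul P.hasPd_X)).div
      (P.hasPd_ell_zero.pow 3) (pow_ne_zero 3 hl)
  have h1 : HasPd 1 (fun q => -((P.quartic' (q 1) * P.ell q - 4 * P.Y q) / P.ell q ^ 3)) _ p :=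
    ((((P.hasPd_quartic' 1).mul P.hasPd_ell_one).sub ((HasPd.const 4).mul P.hasPd_Y)).div
      (P.hasPd_ell_one.pow 3) (pow_ne_zero 3 hl)).neg
  have h2 : pd 2 (fun _ => (0 : ℝ)) p = 0 := pd_const _ _
  have h3 : pd 3 (fun _ => (0 : ℝ)) p = 0 := pd_const _ _
  simp only [Matrix.cons_val_zero, Matrix.cons_val_one, Matrix.cons_val] at h
  rw [h0.pd_eq, h1.pd_eq, h2, h3] at h
  have hv : P.volBar p * (6 * (1 + P.ν) / P.k * P.u p) = -(6 * (1 + P.ν) * P.H p / P.ell p ^ 5) := by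
    rw [volBar, u_eq]
    field_simp
  refine mul_left_cancel₀ (volBar_pos hk hp).ne' (h.trans ?_)
  rw [hv]
  field_simp
  -- What is left is the polynomial identity `ℓ ((X'' ℓ² - 6 ν X' ℓ + 12 ν² X) - (Y'' ℓ² - 6 Y' ℓ +
  -- 12 Y)) = 6 (1 + ν) H` with `ℓ = νx + y`.
  simp only [H, ell, X, Y, quartic, quartic', quartic'']
  push_cast
  ring

theorem weylPlusNorm_metric : weylPlusNorm P.metric p
    = |P.u p| ^ 3 * |Real.sqrt 6 * (1 + P.ν) / P.k| := by
  have h6 : Real.sqrt 6 ≠ 0 := by positivity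
  have h66 : (6 : ℝ) = Real.sqrt 6 * Real.sqrt 6 := (Real.mul_self_sqrt (by norm_num)).symm
  have h := (P.isKahlerOn_matJ hk).weylPlusNorm_eq P.isOpen_domain hp (sqrt_det_metricBar hk hp)
  rw [weylPlusNorm_conf (P.isMetricOn_metric hk) P.contDiffOn_u (fun _ => P.u_ne_zero) hp,
    ← metricBar_eq, h, scal_metricBar hk hp]
  have e : 6 * (1 + P.ν) / P.k * P.u p
      = Real.sqrt 6 * (Real.sqrt 6 * (1 + P.ν) / P.k * P.u p) := by
    conv_lhs => rw [h66]
    ring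
  rw [e, abs_mul, abs_of_nonneg (Real.sqrt_nonneg 6), abs_mul, ← sq_abs (P.u p)]
  field_simp

theorem weylPlus_metric_eq_zero (hν : P.ν = -1) (a b c d : Fin 4) :
    weylPlus P.metric p a b c d = 0 := by
  have h := (P.isKahlerOn_matJ hk).weylPlus_eq P.isOpen_domain hp (sqrt_det_metricBar hk hp) a b c d
  rw [scal_metricBar hk hp, hν, metricBar_eq, weylPlus_conf (P.isMetricOn_metric hk)
    P.contDiffOn_u (fun _ => P.u_ne_zero) hp] at h
  have h' : P.u p ^ 2 * weylPlus P.metric p a b c d = 0 := h.trans (by ring)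
  exact (mul_eq_zero.1 h').resolve_left (pow_ne_zero 2 (P.u_ne_zero hp))

end Domain

end ChenTeo

end

noncomputable section

namespace ChenTeo

open Chart Complex

variable (P : ChenTeo) {p : Pt}

/-! ### The adapted tetrad -/

/-- At the angle `π/4` the contributions of `L ∧ N` and `M ∧ P` cancel, so only products of a base
covector with a fibre covector survive. -/
theorem wedge_rotation {c e e' : ℂ} (hc : c ^ 2 = 1 / 2) (he : e * e' = 1)
    (L N M Q : Fin 4 → ℂ) (a b : Fin 4) :
    wedge (fun a => c * (L a + e * Q a)) (fun a => c * (N a - e' * M a)) a b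
      - wedge (fun a => c * (M a + e * N a)) (fun a => c * (Q a - e' * L a)) a b
      = e * wedge Q N a b - e' * wedge L M a b := by
  simp only [wedge]
  linear_combination (c ^ 2 / 2 * (N a * L b - N b * L a - Q a * M b + Q b * M a)) * he
    + (e * (Q a * N b - Q b * N a) - e' * (L a * M b - L b * M a)) * hc

/-- The two terms combine so that their real parts cancel: the form is `i` times a real matrix,
which is the source of the reality of `J` and of the Killing–Yano form. -/
theorem wedge_frame (e e' m n α γ g h : ℝ) (a b : Fin 4) :
    ((e : ℂ) + I * (e' : ℂ)) * wedge ![I * (m : ℂ), (n : ℂ), 0, 0]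
        ![0, 0, (α : ℂ), (γ : ℂ) * ((g : ℂ) - I * (h : ℂ))] a b
      - ((e : ℂ) - I * (e' : ℂ)) * wedge ![0, 0, (α : ℂ), (γ : ℂ) * ((g : ℂ) + I * (h : ℂ))]
        ![I * (m : ℂ), -(n : ℂ), 0, 0] a b
      = I * ((!![0, 0, m * e * α, m * γ * (e * g + e' * h);
          0, 0, n * e' * α, n * γ * (e' * g - e * h);
          -(m * e * α), -(n * e' * α), 0, 0;
          -(m * γ * (e * g + e' * h)), -(n * γ * (e' * g - e * h)), 0, 0] a b : ℝ) : ℂ) := by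
  fin_cases a <;> fin_cases b <;> simp [wedge] <;> ring_nf <;> simp <;> ring

theorem I_mul_eq {m t : ℝ} (h : m = -(1 / 2) * t) : I * (m : ℂ) = -(I / 2) * (t : ℂ) := by
  rw [h]
  push_cast
  ring

/-- The norm of the fibre part `√2 L` of the tetrad along `∂_τ`. -/
def frameA (p : Pt) : ℝ := Real.sqrt (P.H p * (p 0 - p 1) / P.F p)

/-- The coefficient of the fibre part of the tetrad along `∂_φ`. -/
def frameB (p : Pt) : ℝ :=
  Real.sqrt (P.F p * (p 0 - p 1) ^ 3 / (P.H p * P.X p * (-P.Y p)))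

/-- The coefficient of the base part of the tetrad. -/
def frameC (p : Pt) : ℝ := Real.sqrt ((p 0 - p 1) ^ 3) / Real.sqrt (2 * P.k * P.H p)

theorem vecL_eq (p : Pt) : P.vecL p = fun a => (1 / (Real.sqrt 2 : ℂ)) *
    (![0, 0, (P.frameA p : ℂ) - I * P.frameB p * (P.G p / P.F p), I * P.frameB p] : Fin 4 → ℂ) a :=
  rfl

theorem vecN_eq (p : Pt) : P.vecN p = fun a => (1 / (Real.sqrt 2 : ℂ)) *
    (![0, 0, (P.frameA p : ℂ) + I * P.frameB p * (P.G p / P.F p), -(I * P.frameB p)] :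
      Fin 4 → ℂ) a :=
  rfl

theorem normSq_f (hp : p ∈ P.domain) : ‖P.f p‖ ^ 2 = P.F p := by
  have hX := Real.sq_sqrt (X_pos hp).le
  have hY := Real.sq_sqrt (neg_pos.2 (Y_neg hp)).le
  rw [← Complex.normSq_eq_norm_sq, Complex.normSq_apply]
  simp only [f, add_re, add_im, mul_re, mul_im, ofReal_re, ofReal_im, I_re, I_im]
  rw [F]
  linear_combination p 0 ^ 2 * hY + p 1 ^ 2 * hX

theorem norm_f_pos (hp : p ∈ P.domain) : 0 < ‖P.f p‖ := by
  have h := F_pos hp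
  rw [← P.normSq_f hp] at h
  exact (norm_nonneg _).lt_of_ne fun h0 => by simp [← h0] at h

section Domain

variable {P} (hk : 0 < P.k) (hp : p ∈ P.domain)

include hp

theorem frameA_pos : 0 < P.frameA p :=
  Real.sqrt_pos.2 (div_pos (mul_pos (H_pos hp) (diff_pos hp)) (F_pos hp))

theorem frameA_sq : P.frameA p ^ 2 = P.H p * diff p / P.F p :=
  Real.sq_sqrt (div_pos (mul_pos (H_pos hp) (diff_pos hp)) (F_pos hp)).le

theorem frameB_arg_pos : 0 < P.F p * diff p ^ 3 / (P.H p * P.X p * (-P.Y p)) :=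
  div_pos (mul_pos (F_pos hp) (pow_pos (diff_pos hp) 3))
    (mul_pos (mul_pos (H_pos hp) (X_pos hp)) (neg_pos.2 (Y_neg hp)))

theorem frameB_pos : 0 < P.frameB p := Real.sqrt_pos.2 (frameB_arg_pos hp)

theorem frameB_sq : P.frameB p ^ 2 = P.F p * diff p ^ 3 / (P.H p * P.X p * (-P.Y p)) :=
  Real.sq_sqrt (frameB_arg_pos hp).le

include hk

theorem frameC_pos : 0 < P.frameC p :=
  div_pos (Real.sqrt_pos.2 (pow_pos (diff_pos hp) 3))
    (Real.sqrt_pos.2 (mul_pos (mul_pos two_pos hk) (H_pos hp)))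

theorem frameC_sq : P.frameC p ^ 2 = diff p ^ 3 / (2 * P.k * P.H p) := by
  rw [frameC, div_pow, Real.sq_sqrt (pow_pos (sub_pos.2 hp.1) 3).le,
    Real.sq_sqrt (mul_pos (mul_pos two_pos hk) (H_pos hp)).le, diff]

/-- Proved by squaring, both sides being positive. Together with `frame_prod₂` it records the
relations between the radicals that `hatZ_eq` needs. -/
theorem frame_prod₁ :
    P.frameC p * P.frameA p * ‖P.f p‖ * Real.sqrt 2 * Real.sqrt P.k = diff p ^ 2 := by
  have hF := (F_pos hp).ne'
  have hH := (H_pos hp).ne'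
  have hk0 := hk.ne'
  have hs := diff_pos hp
  have h1 := frameA_pos hp
  have h2 := frameC_pos hk hp
  have h3 := P.norm_f_pos hp
  refine (pow_left_inj₀ (by positivity) (by positivity) two_ne_zero).1 ?_
  simp only [mul_pow]
  rw [frameC_sq hk hp, frameA_sq hp, P.normSq_f hp, Real.sq_sqrt hk.le, Real.sq_sqrt zero_le_two]
  field_simp

theorem frame_prod₂ : P.frameC p * P.frameB p * Real.sqrt 2 * Real.sqrt P.k * P.H p
    * Real.sqrt (P.X p) * Real.sqrt (-P.Y p) = diff p ^ 3 * ‖P.f p‖ := by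
  have hF := (F_pos hp).ne'
  have hH := H_pos hp
  have hk0 := hk.ne'
  have hX := (X_pos hp).ne'
  have hY := (Y_neg hp).ne
  have hs := diff_pos hp
  have h1 := frameB_pos hp
  have h2 := frameC_pos hk hp
  refine (pow_left_inj₀ (by positivity) (by positivity) two_ne_zero).1 ?_
  simp only [mul_pow]
  rw [frameC_sq hk hp, frameB_sq hp, P.normSq_f hp, Real.sq_sqrt hk.le, Real.sq_sqrt zero_le_two,
    Real.sq_sqrt (X_pos hp).le, Real.sq_sqrt (neg_pos.2 (Y_neg hp)).le]
  field_simp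

theorem metric_eq_frame : P.metric p
    = !![1 / (2 * P.frameC p ^ 2 * Real.sqrt (P.X p) ^ 2), 0, 0, 0;
      0, 1 / (2 * P.frameC p ^ 2 * Real.sqrt (-P.Y p) ^ 2), 0, 0;
      0, 0, 1 / P.frameA p ^ 2, P.G p / (P.F p * P.frameA p ^ 2);
      0, 0, P.G p / (P.F p * P.frameA p ^ 2),
        P.G p ^ 2 / (P.F p ^ 2 * P.frameA p ^ 2) + 1 / P.frameB p ^ 2] := by
  have hF := (F_pos hp).ne'
  have hH := (H_pos hp).ne'
  have hk0 := hk.ne'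
  have hX := (X_pos hp).ne'
  have hY := (Y_neg hp).ne
  have hs := (diff_pos hp).ne'
  rw [metric_eq hp, frameC_sq hk hp, frameB_sq hp, frameA_sq hp, Real.sq_sqrt (X_pos hp).le,
    Real.sq_sqrt (neg_pos.2 (Y_neg hp)).le]
  ext a b
  fin_cases a <;> fin_cases b <;> simp <;> field_simp
  ring

theorem lower_vecL : P.lower p (P.vecL p) = ![0, 0,
    ((1 / Real.sqrt 2 * (1 / P.frameA p) : ℝ) : ℂ),
    ((1 / Real.sqrt 2 : ℝ) : ℂ) * ((P.G p / (P.F p * P.frameA p) : ℝ)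
      + I * (1 / P.frameB p : ℝ))] := by
  have hF : (P.F p : ℂ) ≠ 0 := ofReal_ne_zero.2 (F_pos hp).ne'
  have hA : (P.frameA p : ℂ) ≠ 0 := ofReal_ne_zero.2 (frameA_pos hp).ne'
  have hB : (P.frameB p : ℂ) ≠ 0 := ofReal_ne_zero.2 (frameB_pos hp).ne'
  have h2 : ((Real.sqrt 2 : ℝ) : ℂ) ≠ 0 := ofReal_ne_zero.2 (by positivity)
  ext a
  simp only [lower, P.vecL_eq p]
  rw [metric_eq_frame hk hp, Fin.sum_univ_four]
  fin_cases a <;> simp <;> field_simp <;> ring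

theorem lower_vecN : P.lower p (P.vecN p) = ![0, 0,
    ((1 / Real.sqrt 2 * (1 / P.frameA p) : ℝ) : ℂ),
    ((1 / Real.sqrt 2 : ℝ) : ℂ) * ((P.G p / (P.F p * P.frameA p) : ℝ)
      - I * (1 / P.frameB p : ℝ))] := by
  have hF : (P.F p : ℂ) ≠ 0 := ofReal_ne_zero.2 (F_pos hp).ne'
  have hA : (P.frameA p : ℂ) ≠ 0 := ofReal_ne_zero.2 (frameA_pos hp).ne'
  have hB : (P.frameB p : ℂ) ≠ 0 := ofReal_ne_zero.2 (frameB_pos hp).ne'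
  have h2 : ((Real.sqrt 2 : ℝ) : ℂ) ≠ 0 := ofReal_ne_zero.2 (by positivity)
  ext a
  simp only [lower, P.vecN_eq p]
  rw [metric_eq_frame hk hp, Fin.sum_univ_four]
  fin_cases a <;> simp <;> field_simp <;> ring

theorem lower_vecM : P.lower p (P.vecM p) = ![
    I * (1 / (2 * P.frameC p * Real.sqrt (P.X p)) : ℝ),
    -((1 / (2 * P.frameC p * Real.sqrt (-P.Y p)) : ℝ) : ℂ), 0, 0] := by
  have hC : (P.frameC p : ℂ) ≠ 0 := ofReal_ne_zero.2 (frameC_pos hk hp).ne'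
  have hX : ((Real.sqrt (P.X p) : ℝ) : ℂ) ≠ 0 :=
    ofReal_ne_zero.2 (Real.sqrt_pos.2 (X_pos hp)).ne'
  have hY : ((Real.sqrt (-P.Y p) : ℝ) : ℂ) ≠ 0 :=
    ofReal_ne_zero.2 (Real.sqrt_pos.2 (neg_pos.2 (Y_neg hp))).ne'
  have e : I * (Real.sqrt ((p 0 - p 1) ^ 3) : ℂ) / (Real.sqrt (2 * P.k * P.H p) : ℂ)
      = I * (P.frameC p : ℂ) := by rw [frameC]; push_cast; ring
  ext a
  simp only [lower, vecM, e]
  rw [metric_eq_frame hk hp, Fin.sum_univ_four]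
  fin_cases a <;> simp <;> field_simp
  linear_combination I_sq

theorem lower_vecP : P.lower p (P.vecP p) = ![
    I * (1 / (2 * P.frameC p * Real.sqrt (P.X p)) : ℝ),
    ((1 / (2 * P.frameC p * Real.sqrt (-P.Y p)) : ℝ) : ℂ), 0, 0] := by
  have hC : (P.frameC p : ℂ) ≠ 0 := ofReal_ne_zero.2 (frameC_pos hk hp).ne'
  have hX : ((Real.sqrt (P.X p) : ℝ) : ℂ) ≠ 0 :=
    ofReal_ne_zero.2 (Real.sqrt_pos.2 (X_pos hp)).ne'
  have hY : ((Real.sqrt (-P.Y p) : ℝ) : ℂ) ≠ 0 :=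
    ofReal_ne_zero.2 (Real.sqrt_pos.2 (neg_pos.2 (Y_neg hp))).ne'
  have e : I * (Real.sqrt ((p 0 - p 1) ^ 3) : ℂ) / (Real.sqrt (2 * P.k * P.H p) : ℂ)
      = I * (P.frameC p : ℂ) := by rw [frameC]; push_cast; ring
  ext a
  simp only [lower, vecP, e]
  rw [metric_eq_frame hk hp, Fin.sum_univ_four]
  fin_cases a <;> simp <;> field_simp
  linear_combination -I_sq

omit hk in
theorem phase_eq : P.phase p = ((-(p 1 * Real.sqrt (P.X p)) / ‖P.f p‖ : ℝ) : ℂ)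
    + I * ((p 0 * Real.sqrt (-P.Y p) / ‖P.f p‖ : ℝ) : ℂ) := by
  have h0 : (‖P.f p‖ : ℂ) ≠ 0 := ofReal_ne_zero.2 (P.norm_f_pos hp).ne'
  rw [phase]
  push_cast
  field_simp
  rw [f]
  linear_combination (p 1 * (Real.sqrt (P.X p) : ℂ)) * I_sq

omit hk in
theorem phase_inv : (P.phase p)⁻¹ = ((-(p 1 * Real.sqrt (P.X p)) / ‖P.f p‖ : ℝ) : ℂ)
    - I * ((p 0 * Real.sqrt (-P.Y p) / ‖P.f p‖ : ℝ) : ℂ) := by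
  refine inv_eq_of_mul_eq_one_right ?_
  have h0 := (P.norm_f_pos hp).ne'
  have h : (-(p 1 * Real.sqrt (P.X p)) / ‖P.f p‖) ^ 2
      + (p 0 * Real.sqrt (-P.Y p) / ‖P.f p‖) ^ 2 = 1 := by
    have hX := Real.sq_sqrt (X_pos hp).le
    have hY := Real.sq_sqrt (neg_pos.2 (Y_neg hp)).le
    rw [div_pow, div_pow, ← add_div, P.normSq_f hp, div_eq_one_iff_eq (F_pos hp).ne', F]
    linear_combination p 0 ^ 2 * hY + p 1 ^ 2 * hX
  rw [phase_eq hp]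
  have h' := congrArg (fun t : ℝ => (t : ℂ)) h
  simp only [ofReal_add, ofReal_pow, ofReal_one] at h'
  linear_combination h' - ((p 0 * Real.sqrt (-P.Y p) / ‖P.f p‖ : ℝ) : ℂ) ^ 2 * I_sq

theorem hatZ_eq (a b : Fin 4) : P.hatZ p a b = -(I / 2) * (P.twoForm p a b : ℂ) := by
  have hA := (frameA_pos hp).ne'
  have hB := (frameB_pos hp).ne'
  have hC := (frameC_pos hk hp).ne'
  have hF := (F_pos hp).ne'
  have hs := (diff_pos hp).ne'
  have hH := (H_pos hp).ne'
  have hρ := (P.norm_f_pos hp).ne'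
  have hX := (Real.sqrt_pos.2 (X_pos hp)).ne'
  have hY := (Real.sqrt_pos.2 (neg_pos.2 (Y_neg hp))).ne'
  have h2 : Real.sqrt 2 ≠ 0 := by positivity
  have hr0 := (Real.sqrt_pos.2 hk).ne'
  have hYsq : P.Y p = -Real.sqrt (-P.Y p) ^ 2 := by
    rw [Real.sq_sqrt (neg_pos.2 (Y_neg hp)).le, neg_neg]
  have hXsq : P.X p = Real.sqrt (P.X p) ^ 2 := (Real.sq_sqrt (X_pos hp).le).symm
  have hFsq := (P.normSq_f hp).symm
  have hph : P.phase p ≠ 0 := mul_ne_zero I_ne_zero (div_ne_zero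
    (fun h => hρ (by rw [h, norm_zero])) (ofReal_ne_zero.2 hρ))
  have hrot := wedge_rotation (c := 1 / (Real.sqrt 2 : ℂ)) (e := P.phase p) (e' := (P.phase p)⁻¹)
    (by rw [div_pow, one_pow, ← ofReal_pow, Real.sq_sqrt zero_le_two]; norm_num)
    (mul_inv_cancel₀ hph) (P.lower p (P.vecL p)) (P.lower p (P.vecN p)) (P.lower p (P.vecM p))
    (P.lower p (P.vecP p)) a b
  refine Eq.trans hrot ?_
  have p1 := frame_prod₁ hk hp
  have p2 := frame_prod₂ hk hp
  have q1 : P.Q₁ p = diff p * (P.G p * p 1 * diff p + P.H p * p 0 * P.Y p) / P.F p := by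
    rw [← P.F_mul_Q₁, mul_div_cancel_left₀ _ hF]
  have q2 : P.Q₂ p = diff p * (P.G p * p 0 * diff p + P.H p * p 1 * P.X p) / P.F p := by
    rw [← P.F_mul_Q₂, mul_div_cancel_left₀ _ hF]
  rw [lower_vecL hk hp, lower_vecN hk hp, lower_vecM hk hp, lower_vecP hk hp, phase_inv hp,
    phase_eq hp, wedge_frame]
  simp only [twoForm, q1, q2]
  generalize P.frameA p = A at *
  generalize P.frameB p = B at *
  generalize P.frameC p = C at *
  generalize ‖P.f p‖ = ρ at *
  generalize Real.sqrt (P.X p) = sx at *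
  generalize Real.sqrt (-P.Y p) = sy at *
  generalize Real.sqrt 2 = t at *
  generalize Real.sqrt P.k = r at *
  generalize diff p = s at *
  generalize P.G p = G at *
  rw [hFsq, hXsq, hYsq]
  generalize P.H p = H at *
  generalize p 0 = x at *
  generalize p 1 = y at *
  -- Solving the two radical relations for `√k` and `H` leaves a rational identity in symbols that
  -- can be treated as independent.
  obtain rfl : r = s ^ 2 / (C * A * ρ * t) := by
    field_simp
    linear_combination p1
  obtain rfl : H = s * A * ρ ^ 2 / (B * sx * sy) := by
    field_simp at p2 ⊢
    linear_combination p2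
  refine I_mul_eq ?_
  fin_cases a <;> fin_cases b <;> simp <;> field_simp <;> ring

end Domain

end ChenTeo

end

/-! ### Transfer to the tetrad, the Killing field, and the norm of the Weyl tensor -/

noncomputable section

namespace Chart

open Matrix

section Congruence

variable {U : Set Pt} {p : Pt} {J J' g : MatField}

theorem nijenhuis_congr (hU : IsOpen U) (h : ∀ q ∈ U, J q = J' q) (hp : p ∈ U) (a b c : Fin 4) :
    nijenhuis J p a b c = nijenhuis J' p a b c := by
  have e : ∀ d b c, pd d (fun q => J q b c) p = pd d (fun q => J' q b c) p := fun d b c =>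
    pd_congr hU (fun q hq => by rw [h q hq]) hp d
  simp only [nijenhuis, e, h p hp]

theorem IsComplexStructureOn.congr (hJ : IsComplexStructureOn U J') (hU : IsOpen U)
    (h : ∀ q ∈ U, J q = J' q) : IsComplexStructureOn U J where
  smooth := hJ.smooth.congr h
  sq p hp := by rw [h p hp, hJ.sq p hp]
  integrable p hp a b c := by rw [nijenhuis_congr hU h hp, hJ.integrable p hp]

theorem IsKahlerOn.congr (hk : IsKahlerOn U J' g) (hU : IsOpen U) (h : ∀ q ∈ U, J q = J' q) :
    IsKahlerOn U J g where
  smooth := hk.smooth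
  posDef := hk.posDef
  complexStructure := hk.complexStructure.congr hU h
  hermitian p hp a b := by
    simp only [h p hp]
    exact hk.hermitian p hp a b
  closed p hp a b c := by
    have e : ∀ d a b, pd d (fun q => kahlerForm J g q a b) p
        = pd d (fun q => kahlerForm J' g q a b) p := fun d a b =>
      pd_congr hU (fun q hq => by rw [kahlerForm, kahlerForm, h q hq]) hp d
    rw [e, e, e, hk.closed p hp]

end Congruence

/-- A field that is a constant multiple of `∂_i` is Killing if the metric does not depend on the
`i`-th coordinate. -/
theorem isKillingOn_of_mpd_eq_zero {U : Set Pt} {g : MatField} {V : Pt → Fin 4 → ℝ} {κ : ℝ}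
    {i : Fin 4} (hU : IsOpen U) (hV : ∀ q ∈ U, ∀ a, V q a = κ * (Pi.single i 1 : Fin 4 → ℝ) a)
    (hg : ∀ q ∈ U, mpd i g q = 0) : IsKillingOn U g V where
  smooth a := contDiffOn_const.congr fun q hq => hV q hq a
  lie p hp a b := by
    have e : ∀ d c, pd d (fun q => V q c) p = 0 := fun d c => by
      rw [pd_congr hU (fun q hq => hV q hq c) hp, pd_const]
    refine Finset.sum_eq_zero fun c _ => ?_
    rw [e, e, hV p hp]
    rcases eq_or_ne c i with rfl | hc
    · have h := congrFun (congrFun (hg p hp) a) b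
      rw [mpd_apply] at h
      rw [h]
      simp
    · simp [hc]

theorem abs_cubeRoot (r : ℝ) : |cubeRoot r| = |r| ^ (1 / 3 : ℝ) := by
  rcases lt_trichotomy r 0 with h | rfl | h
  · rw [cubeRoot, sign_neg h, abs_mul, abs_of_nonneg (Real.rpow_nonneg (abs_nonneg r) _)]
    simp
  · simp [cubeRoot]
  · rw [cubeRoot, sign_pos h, abs_mul, abs_of_nonneg (Real.rpow_nonneg (abs_nonneg r) _)]
    simp

theorem cubeRoot_mul_nonneg (r : ℝ) : 0 ≤ cubeRoot r * r := by
  have h0 := Real.rpow_nonneg (abs_nonneg r) (1 / 3)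
  rcases lt_trichotomy r 0 with h | rfl | h
  · rw [cubeRoot, sign_neg h]
    simp only [SignType.coe_neg, SignType.coe_one]
    nlinarith
  · simp
  · rw [cubeRoot, sign_pos h]
    simp only [SignType.coe_one]
    positivity

end Chart

namespace ChenTeo

open Chart Matrix

variable (P : ChenTeo) {p : Pt}

section Domain

variable {P} (hk : 0 < P.k) (hp : p ∈ P.domain)

include hk hp

/-! ### The complex structure and the Killing-Yano form of the tetrad -/

theorem complexJ_eq (a b : Fin 4) : P.complexJ p a b = (P.matJ p a b : ℂ) := by
  have hg := P.isMetricOn_metric hk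
  have h : P.matJ p = P.twoForm p * (P.metric p)⁻¹ := by
    rw [← matJ_mul_metric hk hp, Matrix.mul_assoc, hg.mul_inv hp, Matrix.mul_one]
  rw [h, complexJ, Matrix.mul_apply, Finset.mul_sum, Complex.ofReal_sum]
  refine Finset.sum_congr rfl fun c _ => ?_
  rw [hatZ_eq hk hp, hg.inv_symm_apply hp b c]
  push_cast
  linear_combination (-(((P.metric p)⁻¹ c b : ℝ) : ℂ) * (P.twoForm p a c : ℂ)) * Complex.I_sq

theorem J_eq : P.J p = P.matJ p := by
  ext a b
  rw [J, Matrix.of_apply, complexJ_eq hk hp, Complex.ofReal_re]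

theorem complexY_eq (a b : Fin 4) :
    P.complexY p a b = ((-(1 / 3) * (P.u p)⁻¹ * P.twoForm p a b : ℝ) : ℂ) := by
  rw [complexY, hatZ_eq hk hp]
  push_cast
  linear_combination (1 / 3 * (P.u p : ℂ)⁻¹ * (P.twoForm p a b : ℂ)) * Complex.I_sq

theorem killingYano_eq : P.killingYano p = (-(1 / 3) * (P.u p)⁻¹) • (P.J p * P.metric p) := by
  ext a b
  rw [killingYano, Matrix.of_apply, complexY_eq hk hp, Complex.ofReal_re, J_eq hk hp,
    matJ_mul_metric hk hp]
  rfl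

theorem hatZ_eq_wedge (a b : Fin 4) : P.hatZ p a b
    = wedge (P.formα p) (Pi.single 2 1) a b + wedge (P.formβ p) (Pi.single 3 1) a b := by
  have hs : ((p 0 : ℂ) - p 1) ≠ 0 := by
    have h := Complex.ofReal_ne_zero.2 (diff_pos hp).ne'
    rwa [diff, Complex.ofReal_sub] at h
  have hF := (F_pos hp).ne'
  have hF' : (P.F p : ℂ) ≠ 0 := Complex.ofReal_ne_zero.2 hF
  have q1 : P.Q₁ p = diff p * (P.G p * p 1 * diff p + P.H p * p 0 * P.Y p) / P.F p := by
    rw [← P.F_mul_Q₁, mul_div_cancel_left₀ _ hF]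
  have q2 : P.Q₂ p = diff p * (P.G p * p 0 * diff p + P.H p * p 1 * P.X p) / P.F p := by
    rw [← P.F_mul_Q₂, mul_div_cancel_left₀ _ hF]
  rw [hatZ_eq hk hp]
  simp only [twoForm, q1, q2, diff]
  fin_cases a <;> fin_cases b <;> simp [wedge, formα, formβ] <;> field_simp <;> ring

omit hp in
theorem isComplexStructureOn_J : IsComplexStructureOn P.domain P.J :=
  (P.isComplexStructureOn_matJ hk).congr P.isOpen_domain fun _ hq => J_eq hk hq

omit hp in
theorem isKahlerOn_J : IsKahlerOn P.domain P.J P.metricBar :=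
  (P.isKahlerOn_matJ hk).congr P.isOpen_domain fun _ hq => J_eq hk hq

/-! ### The Killing field -/

/-- The `∂_τ` row of the Kähler form is `√k (-y dx + x dy) / (νx + y)²`, which is `du` up to the
factor `√k / (1 + ν)` when `ν ≠ -1`; for `ν = -1` both sides vanish. Thus `u` is a moment map. -/
theorem pd_u_eq (a : Fin 4) : pd a P.u p = ∑ b, ((1 + P.ν) / Real.sqrt P.k
    * (Pi.single 2 1 : Fin 4 → ℝ) b) * kahlerForm P.J P.metricBar p b a := by
  have hl := ell_ne_zero hp
  have hr0 := (Real.sqrt_pos.2 hk).ne'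
  have e : kahlerForm P.J P.metricBar p = P.twoFormBar p := by
    rw [← P.kahlerForm_eq hk hp, kahlerForm, J_eq hk hp, kahlerForm]
  rw [e, Fin.sum_univ_four]
  fin_cases a
  · refine (pd_u_zero hp).trans ?_
    simp [twoFormBar]
    field_simp
  · refine (pd_u_one hp).trans ?_
    simp [twoFormBar]
    field_simp
  · refine (pd_u_of_ne (by decide) (by decide)).trans ?_
    simp [twoFormBar]
  · refine (pd_u_of_ne (by decide) (by decide)).trans ?_
    simp [twoFormBar]

theorem grad_u (c : Fin 4) :
    grad P.metricBar P.u p c = (1 + P.ν) / Real.sqrt P.k * P.J p 2 c := by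
  have hg := P.isMetricOn_metricBar hk
  have h : kahlerForm P.J P.metricBar p * (P.metricBar p)⁻¹ = P.J p := by
    rw [kahlerForm, Matrix.mul_assoc, hg.mul_inv hp, Matrix.mul_one]
  simp only [grad, pd_u_eq hk hp, Finset.mul_sum]
  rw [Finset.sum_comm, Finset.sum_eq_single 2 (fun b _ hb => by simp [hb]) (by simp), ← h,
    Matrix.mul_apply, Finset.mul_sum]
  refine Finset.sum_congr rfl fun b _ => ?_
  rw [hg.inv_symm_apply hp c b, Pi.single_eq_same]
  ring

theorem ξ_eq_divergence (a : Fin 4) :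
    P.ξ p a = ∑ c, ∑ b, (P.metricBar p)⁻¹ a c * P.J p c b * pd b P.u p :=
  divergence_confKahler (P.isMetricOn_metric hk) P.contDiffOn_u (fun _ => P.u_ne_zero)
    (isKahlerOn_J hk) (fun _ hq => killingYano_eq hk hq) hp a

theorem ξ_eq (a : Fin 4) :
    P.ξ p a = (1 + P.ν) / Real.sqrt P.k * (Pi.single 2 1 : Fin 4 → ℝ) a := by
  have hg := P.isMetricOn_metricBar hk
  have hK := isKahlerOn_J hk
  have hW := hK.kahlerForm_transpose P.isOpen_domain hp
  -- `-g⁻¹ J` inverts the Kähler form, so the symplectic gradient of `u` recovers the vector field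
  -- found in `pd_u_eq`.
  have hid : (P.metricBar p)⁻¹ * P.J p * kahlerForm P.J P.metricBar p = -1 := by
    rw [kahlerForm, Matrix.mul_assoc, ← Matrix.mul_assoc (P.J p),
      hK.complexStructure.sq p hp, Matrix.neg_mul, Matrix.one_mul, Matrix.mul_neg, hg.inv_mul hp]
  have e : ∀ b, pd b P.u p = -((1 + P.ν) / Real.sqrt P.k)
      * kahlerForm P.J P.metricBar p b 2 := fun b => by
    rw [pd_u_eq hk hp, Finset.sum_eq_single 2 (fun b _ hb => by simp [hb]) (by simp),
      Pi.single_eq_same]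
    have := congrFun (congrFun hW b) 2
    rw [Matrix.transpose_apply, Matrix.neg_apply] at this
    rw [this]
    ring
  rw [ξ_eq_divergence hk hp, Finset.sum_comm]
  have h := congrFun (congrFun hid a) 2
  rw [Matrix.mul_apply] at h
  have h' : ∑ b, ∑ c, (P.metricBar p)⁻¹ a c * P.J p c b * pd b P.u p
      = -((1 + P.ν) / Real.sqrt P.k) * ∑ b, ((P.metricBar p)⁻¹ * P.J p) a b
        * kahlerForm P.J P.metricBar p b 2 := by
    rw [Finset.mul_sum]
    refine Finset.sum_congr rfl fun b _ => ?_
    rw [← Finset.sum_mul, e, Matrix.mul_apply]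
    ring
  rw [h', h, Matrix.neg_apply, Matrix.one_apply, Pi.single_apply]
  ring

theorem mpd_J_eq_zero {i : Fin 4} (h0 : 0 ≠ i) (h1 : 1 ≠ i) : mpd i P.J p = 0 := by
  rw [mpd_congr P.isOpen_domain (fun _ hq => J_eq hk hq) hp, P.mpd_matJ_eq_zero h0 h1]

theorem grad_scal_metricBar (c : Fin 4) : grad P.metricBar (scal P.metricBar) p c
    = 6 * (1 + P.ν) / P.k * ((1 + P.ν) / Real.sqrt P.k) * P.J p 2 c := by
  have hu := differentiableAt_of_contDiffOn P.isOpen_domain P.contDiffOn_u hp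
  have e : ∀ b, pd b (scal P.metricBar) p = 6 * (1 + P.ν) / P.k * pd b P.u p := fun b => by
    rw [pd_congr P.isOpen_domain (fun _ hq => scal_metricBar hk hq) hp, pd_const_mul _ _ hu]
  rw [mul_assoc, ← grad_u hk hp, grad, grad, Finset.mul_sum]
  refine Finset.sum_congr rfl fun b _ => ?_
  rw [e]
  ring

omit hp in
-- The gradient of the scalar curvature is a constant times `J ∂_τ`. For a field of this kind, the
-- Lie derivative of `J` is that constant times the Nijenhuis tensor paired with `∂_τ`, because `J`
-- does not depend on `τ`.
theorem isExtremalKahlerOn_J : IsExtremalKahlerOn P.domain P.J P.metricBar where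
  kahler := isKahlerOn_J hk
  holomorphic q hq := lieDerivEndo_eq_zero P.isOpen_domain (isComplexStructureOn_J hk).smooth
    (fun _ hr => grad_scal_metricBar hk hr) hq (mpd_J_eq_zero hk hq (by decide) (by decide))
    ((isComplexStructureOn_J hk).integrable q hq 2)

/-! ### The conformal factor and the Weyl tensor -/

theorem abs_u_eq (hν : P.ν ≠ -1) :
    |P.u p| = |P.c| * weylPlusNorm P.metric p ^ (1 / 3 : ℝ) := by
  have hν' : 1 + P.ν ≠ 0 := fun h => hν (by linarith)
  have hd : Real.sqrt 6 * (1 + P.ν) ≠ 0 := mul_ne_zero (by positivity) hν'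
  have hr : |P.k / (Real.sqrt 6 * (1 + P.ν))| * |Real.sqrt 6 * (1 + P.ν) / P.k| = 1 := by
    rw [← abs_mul, div_mul_div_cancel₀ hd, div_self hk.ne', abs_one]
  rw [weylPlusNorm_metric hk hp, c, abs_cubeRoot,
    ← Real.mul_rpow (abs_nonneg _) (mul_nonneg (pow_nonneg (abs_nonneg _) 3) (abs_nonneg _)),
    mul_left_comm, hr, mul_one, one_div]
  exact (Real.pow_rpow_inv_natCast (abs_nonneg _) three_ne_zero).symm

theorem u_eq_of_neg (hneg : (1 + P.ν) * P.ell p < 0) :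
    P.u p = P.c * weylPlusNorm P.metric p ^ (1 / 3 : ℝ) := by
  have hl := ell_ne_zero hp
  have hs := diff_pos hp
  have hν : P.ν ≠ -1 := fun h => by simp [h] at hneg
  have hν' : 1 + P.ν ≠ 0 := fun h => hν (by linarith)
  have h := abs_u_eq hk hp hν
  have hw : 0 ≤ weylPlusNorm P.metric p ^ (1 / 3 : ℝ) :=
    Real.rpow_nonneg (Real.sqrt_nonneg _) _
  -- Both `c` and `u` are compared in sign with `1 + ν`; then the identity of absolute values loses
  -- its bars.
  have hc : 0 ≤ P.c * (1 + P.ν) := by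
    have h1 := cubeRoot_mul_nonneg (P.k / (Real.sqrt 6 * (1 + P.ν)))
    have h2 : P.c * (1 + P.ν) = P.c * (P.k / (Real.sqrt 6 * (1 + P.ν)))
        * (Real.sqrt 6 * (1 + P.ν) ^ 2 / P.k) := by
      have : Real.sqrt 6 ≠ 0 := by positivity
      have := hk.ne'
      field_simp
    rw [h2]
    exact mul_nonneg h1 (by positivity)
  have hu : 0 < P.u p * (1 + P.ν) := by
    have : P.u p * (1 + P.ν) = diff p * -((1 + P.ν) * P.ell p) / P.ell p ^ 2 := by
      rw [u_eq]
      field_simp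
    rw [this]
    exact div_pos (mul_pos hs (neg_pos.2 hneg)) (by positivity)
  rcases lt_or_gt_of_ne hν' with hn | hn
  · rwa [abs_of_neg ((neg_iff_neg_of_mul_pos hu).2 hn), abs_of_nonpos (nonpos_of_mul_nonneg_left hc hn),
      neg_mul, neg_inj] at h
  · rwa [abs_of_pos (pos_of_mul_pos_left hu hn.le), abs_of_nonneg (nonneg_of_mul_nonneg_left hc hn)]
      at h

omit hk in
theorem u_eq_one (hν : P.ν = -1) : P.u p = 1 := by
  have hs := (diff_pos hp).ne'
  rw [u_eq, ell, hν, neg_one_mul, div_eq_one_iff_eq (by rw [neg_add_eq_sub, ← neg_sub]; exact neg_ne_zero.2 hs),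
    diff]
  ring

end Domain

end ChenTeo

end

theorem corollary3p7 (P : ChenTeo) (hk : 0 < P.k) :
    -- the 2-form of the adapted tetrad in coordinates
    (∀ p ∈ P.domain, ∀ a b,
      P.hatZ p a b = Chart.wedge (P.formα p) (Pi.single 2 1) a b
        + Chart.wedge (P.formβ p) (Pi.single 3 1) a b) ∧
    -- (1) the function `u` and the norm of the self dual Weyl tensor
    (P.ν ≠ -1 → ∀ p ∈ P.domain,
      |P.u p| = |P.c| * Chart.weylPlusNorm P.metric p ^ (1 / 3 : ℝ) ∧
      ((1 + P.ν) * (P.ν * p 0 + p 1) < 0 →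
        P.u p = P.c * Chart.weylPlusNorm P.metric p ^ (1 / 3 : ℝ))) ∧
    (P.ν = -1 → ∀ p ∈ P.domain,
      (∀ a b c d, Chart.weylPlus P.metric p a b c d = 0) ∧ P.u p = 1) ∧
    -- (2) the complex structure
    (∀ p ∈ P.domain, ∀ a b, (P.J p a b : ℂ) = P.complexJ p a b) ∧
    Chart.IsComplexStructureOn P.domain P.J ∧
    -- (3) the Kähler metric
    Chart.IsKahlerOn P.domain P.J P.metricBar ∧
    -- (4) the conformal Killing-Yano tensor, the Killing field, and extremality
    (∀ p ∈ P.domain, ∀ a b, (P.killingYano p a b : ℂ) = P.complexY p a b) ∧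
    Chart.IsConformalKillingYanoOn P.domain P.metric P.killingYano ∧
    (∀ p ∈ P.domain, ∀ a,
      P.ξ p a = ∑ c, ∑ b, (P.metricBar p)⁻¹ a c * P.J p c b * Chart.pd b P.u p ∧
      P.ξ p a = (1 + P.ν) / Real.sqrt P.k * (Pi.single 2 1 : Fin 4 → ℝ) a) ∧
    Chart.IsKillingOn P.domain P.metric P.ξ ∧
    Chart.IsKillingOn P.domain P.metricBar P.ξ ∧
    Chart.IsHamiltonianOn P.domain (Chart.kahlerForm P.J P.metricBar) P.ξ P.u ∧
    Chart.IsExtremalKahlerOn P.domain P.J P.metricBar ∧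
    -- (5) the scalar curvature
    (∀ p ∈ P.domain, Chart.scal P.metricBar p = 6 * (1 + P.ν) / P.k * P.u p) ∧
    (P.ν = -1 → ∀ p ∈ P.domain,
      P.metricBar p = P.metric p ∧ Chart.scal P.metricBar p = 0) := by
  have hJ : ∀ p ∈ P.domain, ∀ a b, (P.J p a b : ℂ) = P.complexJ p a b := fun p hp a b => by
    rw [ChenTeo.J_eq hk hp, ChenTeo.complexJ_eq hk hp]
  have hY : ∀ p ∈ P.domain, ∀ a b, (P.killingYano p a b : ℂ) = P.complexY p a b :=
    fun p hp a b => by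
      rw [ChenTeo.killingYano, Matrix.of_apply, ChenTeo.complexY_eq hk hp, Complex.ofReal_re]
  have hKahler := ChenTeo.isKahlerOn_J hk
  have hξ := fun p (hp : p ∈ P.domain) => ChenTeo.ξ_eq hk hp
  refine ⟨fun p hp => ChenTeo.hatZ_eq_wedge hk hp, fun hν p hp =>
    ⟨ChenTeo.abs_u_eq hk hp hν, ChenTeo.u_eq_of_neg hk hp⟩, fun hν p hp =>
    ⟨ChenTeo.weylPlus_metric_eq_zero hk hp hν, ChenTeo.u_eq_one hp hν⟩, hJ,
    ChenTeo.isComplexStructureOn_J hk, hKahler, hY,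
    Chart.isConformalKillingYanoOn_confKahler (P.isMetricOn_metric hk) P.contDiffOn_u
      (fun _ => P.u_ne_zero) hKahler (fun _ hq => ChenTeo.killingYano_eq hk hq),
    fun p hp a => ⟨ChenTeo.ξ_eq_divergence hk hp a, hξ p hp a⟩,
    Chart.isKillingOn_of_mpd_eq_zero P.isOpen_domain hξ fun q _ =>
      P.mpd_metric_eq_zero (by decide) (by decide),
    Chart.isKillingOn_of_mpd_eq_zero P.isOpen_domain hξ fun q _ =>
      P.mpd_metricBar_eq_zero (by decide) (by decide),
    ⟨P.contDiffOn_u, fun p hp a => ?_⟩, ChenTeo.isExtremalKahlerOn_J hk,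
    fun p hp => ChenTeo.scal_metricBar hk hp, fun hν p hp => ⟨?_, ?_⟩⟩
  · simp only [ChenTeo.pd_u_eq hk hp, hξ p hp]
  · rw [ChenTeo.metricBar, ChenTeo.u_eq_one hp hν, one_pow, one_smul]
  · rw [ChenTeo.scal_metricBar hk hp, hν]
    ring
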